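/- **Setting.** Let $\mathbb H=\{-1,0,1\}$, let $S$ be a finite nonempty set, and let $A_{i,j}$ ($i,j\in\mathbb H$) be nonnegative $S\times S$ matrices whose sum $A_{*,*}=\sum_{i,j}A_{i,j}$ is stochastic. Assume that the Markov chain on $\mathbb Z^2\times S$ which moves from $(x_1,x_2,a)$ to $(x_1+i,x_2+j,b)$ with probability $[A_{i,j}]_{ab}$ is irreducible and aperiodic. Let $\pi$ be the stationary distribution of $A_{*,*}$, and assume that at least one of the mean drifts $\pi\sum_{j}(A_{1,j}-A_{-1,j})\mathbf 1$ and $\pi\sum_{i}(A_{i,1}-A_{i,-1})\mathbf 1$ is negative. **Notation.** Put $A_{*,j}(z)=\sum_{i\in\mathbb H}A_{i,j}z^i$ and $C(z,w)=\sum_{j\in\mathbb H}A_{*,j}(z)w^j$. For $x,y>0$ let $\chi(x,y)$ be the spectral radius of $C(x,y)$. Let $\bar\Gamma=\{(s_1,s_2)\in\mathbb R^2:\chi(e^{s_1},e^{s_2})\le 1\}$, and let $\underline z_1^*=e^{\min s_1}$ and $\bar z_1^*=e^{\max s_1}$, the extrema being over $\bar\Gamma$. Let $\underline\zeta_2(x)\le\bar\zeta_2(x)$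 be the smallest and the largest solution $w>0$ of $\chi(x,w)=1$. For $z\in\mathbb C$ with $\underline z_1^*\le|z|\le\bar z_1^*$ define $$N_1(z)=\sum_{n\ge0}\ \sum_{i\in\mathscr I_n}A_{*,i_1}(z)\cdots A_{*,i_n}(z),\qquad G_1(z)=\sum_{n\ge1}\ \sum_{i\in\mathscr D_n}A_{*,i_1}(z)\cdots A_{*,i_n}(z),\qquad R_1(z)=\sum_{n\ge1}\ \sum_{i\in\mathscr U_n}A_{*,i_1}(z)\cdots A_{*,i_n}(z).$$ Here $\mathscr I_n$ (resp. $\mathscr D_n$) is the set of $i\in\mathbb H^n$ with $i_1+\dots+i_k\ge0$ for $1\le k\le n-1$ and total sum $0$ (resp. $-1$), and $\mathscr U_n$ is the set of $i\in\mathbb H^n$ with $i_1+\dots+i_k\ge1$ for $1\le k\le n-1$ and total sum $1$; the term $n=0$ of $N_1$ is $I$. For $r,\varepsilon>0$ and $\theta\in[0,\pi/2)$ let $\tilde\Delta_r(\varepsilon,\theta)=\{z\in\mathbb C:|z|<r+\varepsilon,\ z\ne r,\ |\arg(z-r)|>\theta\}$. Square roots are principal. **Proposition 5.6.** The three series converge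 absolutely for $\underline z_1^*\le|z|\le\bar z_1^*$. There are a matrix function $\tilde G_1(\zeta)=\sum_{k\ge0}\tilde G_{1,k}\zeta^k$ and a scalar function $\tilde\alpha_{s_0}(\zeta)=\sum_{k\ge0}\tilde\alpha_{s_0,k}\zeta^k$, both analytic in a neighbourhood of $0$, such that for all $z$ near $\bar z_1^*$ with $\underline z_1^*\le|z|\le\bar z_1^*$ one has $G_1(z)=\tilde G_1((\bar z_1^*-z)^{1/2})$, the number $\tilde\alpha_{s_0}((\bar z_1^*-z)^{1/2})$ is an eigenvalue of $G_1(z)$, and this eigenvalue equals $\underline\zeta_2(z)$ if $z$ is real. Moreover: 1. For some $\varepsilon>0$, $G_1$ extends analytically, near $\bar z_1^*$, to $\{z\in\tilde\Delta_{\bar z_1^*}(\varepsilon,0):|z-\bar z_1^*|<\varepsilon\}$. For all $\varepsilon>0$ and $\theta\in[0,\pi/2)$, any analytic extension of $G_1$ to $\{z\in\tilde\Delta_{\bar z_1^*}(\varepsilon,\theta):|z-\bar z_1^*|<\varepsilon\}$, still denoted $G_1$, equals $\tilde G_1((\bar z_1^*-z)^{1/2})$ near $\bar z_1^*$ and satisfies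 $$\lim_{\tilde\Delta_{\bar z_1^*}(\varepsilon,\theta)\ni z\to\bar z_1^*}\frac{G_1(\bar z_1^*)-G_1(z)}{(\bar z_1^*-z)^{1/2}}=-\tilde G_{1,1}.$$ 2. $G_1(\bar z_1^*)$ has a left eigenvector for the eigenvalue $\underline\zeta_2(\bar z_1^*)$. For every such left eigenvector $u_{s_0}^{G_1}$ there is a right eigenvector $v^{R_1}$ of $R_1(\bar z_1^*)$ for the eigenvalue $\bar\zeta_2(\bar z_1^*)^{-1}$ with $u_{s_0}^{G_1}N_1(\bar z_1^*)v^{R_1}=1$, and every such $v^{R_1}$ satisfies $$-\tilde G_{1,1}=-\tilde\alpha_{s_0,1}\,N_1(\bar z_1^*)\,v^{R_1}\,u_{s_0}^{G_1}.$$ 3. All entries of $-\tilde G_{1,1}$ are nonnegative real numbers, and $-\tilde G_{1,1}\ne0$. -/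

import Mathlib

open Filter Topology
open scoped Matrix

namespace TwoDQBD

noncomputable section

/-- The set of increments `{-1, 0, 1}`. -/
def H : Finset ℤ := {-1, 0, 1}

/-! ### The Markov chain on `ℤ² × S` generated by the blocks `A i j` -/

/-- `n`-step transition probabilities of a Markov chain with transition probabilities `P`. -/
def nStep {X : Type*} [DecidableEq X] (P : X → X → ℝ) : ℕ → X → X → ℝ
  | 0, x, y => if x = y then 1 else 0
  | n + 1, x, y => ∑' z, P x z * nStep P n z y

/-- Every state can be reached from every state. -/
def ChainIrreducible {X : Type*} [DecidableEq X] (P : X → X → ℝ) : Prop :=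
  ∀ x y, ∃ n, 0 < nStep P n x y

/-- For every state, the possible return times have greatest common divisor one. -/
def ChainAperiodic {X : Type*} [DecidableEq X] (P : X → X → ℝ) : Prop :=
  ∀ x, ∀ d : ℕ, (∀ n, 1 ≤ n → 0 < nStep P n x x → d ∣ n) → d = 1

variable {S : Type*} [Fintype S] [DecidableEq S]

/-- Transition probabilities, on the state space `ℤ × ℤ × S`, of the chain without boundaries
generated by the blocks `A i j`, `i, j ∈ H`. -/
def pTilde (A : ℤ → ℤ → Matrix S S ℝ) (x y : ℤ × ℤ × S) : ℝ :=
  if y.1 - x.1 ∈ H ∧ y.2.1 - x.2.1 ∈ H then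
    A (y.1 - x.1) (y.2.1 - x.2.1) x.2.2 y.2.2
  else 0

/-- `A_{*,*}`, the transition matrix of the phase process. -/
def Atot (A : ℤ → ℤ → Matrix S S ℝ) : Matrix S S ℝ := ∑ i ∈ H, ∑ j ∈ H, A i j

/-- `p` is a stationary distribution of the finite transition matrix `P`. -/
def IsStationaryDist (P : Matrix S S ℝ) (p : S → ℝ) : Prop :=
  (∀ a, 0 ≤ p a) ∧ ∑ a, p a = 1 ∧ p ᵥ* P = p

/-- Mean drift in the first coordinate, `π (-A_{-1,*} + A_{1,*}) 1`. -/
def drift₁ (A : ℤ → ℤ → Matrix S S ℝ) (p : S → ℝ) : ℝ :=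
  p ⬝ᵥ ((-(∑ j ∈ H, A (-1) j) + ∑ j ∈ H, A 1 j) *ᵥ (fun _ => 1))

/-- Mean drift in the second coordinate, `π (-A_{*,-1} + A_{*,1}) 1`. -/
def drift₂ (A : ℤ → ℤ → Matrix S S ℝ) (p : S → ℝ) : ℝ :=
  p ⬝ᵥ ((-(∑ i ∈ H, A i (-1)) + ∑ i ∈ H, A i 1) *ᵥ (fun _ => 1))

/-! ### The matrix generating functions and the set `Γ` -/

/-- `A_{*,j}(z) = ∑ i, A_{i,j} z ^ i`. -/
def Acol (A : ℤ → ℤ → Matrix S S ℝ) (j : ℤ) (z : ℂ) : Matrix S S ℂ :=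
  ∑ i ∈ H, z ^ i • (A i j).map Complex.ofReal

/-- `C(z, w) = ∑ i, ∑ j, A_{i,j} z ^ i w ^ j`. -/
def C (A : ℤ → ℤ → Matrix S S ℝ) (z w : ℂ) : Matrix S S ℂ :=
  ∑ j ∈ H, w ^ j • Acol A j z

/-- Spectral radius (maximum modulus of the eigenvalues) of a square complex matrix. -/
def spr (M : Matrix S S ℂ) : ℝ := (spectralRadius ℂ M).toReal

/-- `χ(x, y) = spr (C(x, y))`, for positive real `x`, `y`. -/
def chi (A : ℤ → ℤ → Matrix S S ℝ) (x y : ℝ) : ℝ := spr (C A x y)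

/-- The closed convex set `{(s₁, s₂) : χ(exp s₁, exp s₂) ≤ 1}`. -/
def Gam (A : ℤ → ℤ → Matrix S S ℝ) : Set (ℝ × ℝ) :=
  {s | chi A (Real.exp s.1) (Real.exp s.2) ≤ 1}

/-- `exp` of the largest first coordinate of a point of `Gam A`. -/
def zMax (A : ℤ → ℤ → Matrix S S ℝ) : ℝ := Real.exp (sSup (Prod.fst '' Gam A))

/-- `exp` of the smallest first coordinate of a point of `Gam A`. -/
def zMin (A : ℤ → ℤ → Matrix S S ℝ) : ℝ := Real.exp (sInf (Prod.fst '' Gam A))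

/-- The smaller positive solution `w` of `χ(x, w) = 1`. -/
def zetaLow (A : ℤ → ℤ → Matrix S S ℝ) (x : ℝ) : ℝ := sInf {w : ℝ | 0 < w ∧ chi A x w = 1}

/-- The larger positive solution `w` of `χ(x, w) = 1`
(equal to the smaller one at the two ends of the range of `x`). -/
def zetaHigh (A : ℤ → ℤ → Matrix S S ℝ) (x : ℝ) : ℝ := sSup {w : ℝ | 0 < w ∧ chi A x w = 1}

/-- The closed annulus of the complex `z` with `zMin A ≤ |z| ≤ zMax A`. -/
def annulus (A : ℤ → ℤ → Matrix S S ℝ) : Set ℂ := {z | zMin A ≤ ‖z‖ ∧ ‖z‖ ≤ zMax A}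

/-! ### The matrix series `N₁`, `G₁`, `R₁` -/

/-- The partial sum `i_1 + ⋯ + i_k` of an index sequence. -/
def psum {n : ℕ} (i : Fin n → ℤ) (k : ℕ) : ℤ := ∑ l : Fin n with l.val < k, i l

/-- The ordered product `A_{*,i_1}(z) A_{*,i_2}(z) ⋯ A_{*,i_n}(z)`. -/
def wordProd (A : ℤ → ℤ → Matrix S S ℝ) (z : ℂ) {n : ℕ} (i : Fin n → ℤ) : Matrix S S ℂ :=
  (List.ofFn fun l => Acol A (i l) z).prod

/-- Sequences in `H ^ n` with `i_1 + ⋯ + i_k ≥ 0` for `1 ≤ k ≤ n - 1` and total sum `0`. -/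
def seqQ (n : ℕ) : Finset (Fin n → ℤ) :=
  (Fintype.piFinset fun _ : Fin n => H).filter fun i : Fin n → ℤ =>
    (∀ k : ℕ, k < n → 1 ≤ k → 0 ≤ psum i k) ∧ ∑ l, i l = 0

/-- Sequences in `H ^ n` with `i_1 + ⋯ + i_k ≥ 0` for `1 ≤ k ≤ n - 1` and total sum `-1`. -/
def seqD (n : ℕ) : Finset (Fin n → ℤ) :=
  (Fintype.piFinset fun _ : Fin n => H).filter fun i : Fin n → ℤ =>
    (∀ k : ℕ, k < n → 1 ≤ k → 0 ≤ psum i k) ∧ ∑ l, i l = -1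

/-- Sequences in `H ^ n` with `i_1 + ⋯ + i_k ≥ 1` for `1 ≤ k ≤ n - 1` and total sum `1`. -/
def seqU (n : ℕ) : Finset (Fin n → ℤ) :=
  (Fintype.piFinset fun _ : Fin n => H).filter fun i : Fin n → ℤ =>
    (∀ k : ℕ, k < n → 1 ≤ k → 1 ≤ psum i k) ∧ ∑ l, i l = 1

/-- The `n`-th term of `N₁(z)`; it is the identity matrix for `n = 0`. -/
def Qterm (A : ℤ → ℤ → Matrix S S ℝ) (n : ℕ) (z : ℂ) : Matrix S S ℂ :=
  ∑ i ∈ seqQ n, wordProd A z i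

/-- The `n`-th term of `G₁(z)`; it is zero for `n = 0`. -/
def Dterm (A : ℤ → ℤ → Matrix S S ℝ) (n : ℕ) (z : ℂ) : Matrix S S ℂ :=
  ∑ i ∈ seqD n, wordProd A z i

/-- The `n`-th term of `R₁(z)`; it is zero for `n = 0`. -/
def Uterm (A : ℤ → ℤ → Matrix S S ℝ) (n : ℕ) (z : ℂ) : Matrix S S ℂ :=
  ∑ i ∈ seqU n, wordProd A z i

def N₁ (A : ℤ → ℤ → Matrix S S ℝ) (z : ℂ) : Matrix S S ℂ := ∑' n, Qterm A n z

def G₁ (A : ℤ → ℤ → Matrix S S ℝ) (z : ℂ) : Matrix S S ℂ := ∑' n, Dterm A n z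

def R₁ (A : ℤ → ℤ → Matrix S S ℝ) (z : ℂ) : Matrix S S ℂ := ∑' n, Uterm A n z

/-! ### The branch point -/

/-- The domain `{z : |z| < r + ε, z ≠ r, |arg (z - r)| > θ}`. -/
def deltaTilde (r ε θ : ℝ) : Set ℂ :=
  {z | ‖z‖ < r + ε ∧ z ≠ (r : ℂ) ∧ θ < |Complex.arg (z - (r : ℂ))|}

/-- The principal square root `(z̄ - z) ^ (1/2)` with `z̄ = zMax A`. -/
def root (A : ℤ → ℤ → Matrix S S ℝ) (z : ℂ) : ℂ := ((zMax A : ℂ) - z) ^ (1 / 2 : ℂ)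

/-- `F` is the analytic continuation of `G₁`, near the point `z̄ = zMax A`, from the annulus on
which the series converges to the part of `deltaTilde z̄ ε θ` within distance `ε` of `z̄`. (This
part is connected for `0 ≤ θ < π / 2`, so there is at most one.) -/
structure IsContinuationG₁ (A : ℤ → ℤ → Matrix S S ℝ) (ε θ : ℝ) (F : ℂ → Matrix S S ℂ) :
    Prop where
  analytic : ∀ a b, AnalyticOnNhd ℂ (fun z => F z a b)
    (deltaTilde (zMax A) ε θ ∩ Metric.ball (zMax A : ℂ) ε)
  agree : ∀ z ∈ annulus A ∩ Metric.ball (zMax A : ℂ) ε, F z = G₁ A z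

/-- `Gt` is analytic at the origin and `G₁(z) = Gt((z̄ - z) ^ (1/2))` near `z̄ = zMax A`, so that
the Taylor coefficients of `Gt` are the Puiseux coefficients of `G₁`. -/
structure IsPuiseuxG₁ (A : ℤ → ℤ → Matrix S S ℝ) (Gt : ℂ → Matrix S S ℂ) : Prop where
  analytic : ∀ a b, AnalyticAt ℂ (fun t => Gt t a b) 0
  eq : ∀ᶠ z in 𝓝[annulus A] (zMax A : ℂ), G₁ A z = Gt (root A z)

/-- `αt` is analytic at the origin and `αt((z̄ - z) ^ (1/2))` is, near `z̄ = zMax A`, the eigenvalue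
of `G₁(z)` that is the smaller solution of `χ(z, w) = 1` for real `z ≤ z̄`. -/
structure IsPuiseuxEigenvalue (A : ℤ → ℤ → Matrix S S ℝ) (αt : ℂ → ℂ) : Prop where
  analytic : AnalyticAt ℂ αt 0
  eigenvalue : ∀ᶠ z in 𝓝[annulus A] (zMax A : ℂ), αt (root A z) ∈ spectrum ℂ (G₁ A z)
  real : ∀ᶠ x : ℝ in 𝓝[≤] (zMax A), αt (root A x) = (zetaLow A x : ℂ)

/-- The coefficient of `t` in the Taylor series of `Gt` at the origin. -/
def coeffOne (Gt : ℂ → Matrix S S ℂ) : Matrix S S ℂ :=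
  Matrix.of fun a b => deriv (fun t => Gt t a b) 0

/-- Left (row) eigenvectors. -/
def IsLeftEigenvector (M : Matrix S S ℂ) (c : ℂ) (u : S → ℂ) : Prop :=
  u ≠ 0 ∧ u ᵥ* M = c • u

/-- Right (column) eigenvectors. -/
def IsRightEigenvector (M : Matrix S S ℂ) (c : ℂ) (v : S → ℂ) : Prop :=
  v ≠ 0 ∧ M *ᵥ v = c • v

/-- All entries are nonnegative real numbers. -/
def EntrywiseNonneg (M : Matrix S S ℂ) : Prop :=
  ∀ a b, 0 ≤ (M a b).re ∧ (M a b).im = 0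

end

end TwoDQBD

open TwoDQBD

set_option linter.unusedSectionVars false

/-! Write z̄ for `zMax A` and V for the matrix 1 - A_{*,0} - A_{*,1}N₁A_{*,-1}. Cutting words at
first descents gives N₁ = 1 + A_{*,0}N₁ + A_{*,1}N₁A_{*,-1}N₁, that is, VN₁ = 1. Since G₁ =
N₁A_{*,-1} and R₁ = A_{*,1}N₁, it follows that G₁ solves A_{*,-1} + A_{*,0}X + A_{*,1}X² = X, and
that 1 - C(z,w) = (1 - wR₁) V (1 - w⁻¹G₁). The singularity of G₁ at z̄ is a fold of the quadratic
equation.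

Location of the fold. A point s lies in `Gam A` iff C(exp s₁, exp s₂) has a positive superharmonic
vector exp h (`Blocks.mem_Gam_iff`). This is a convex condition on (s,h), so χ itself never has to
be differentiated. The negative drift yields a strictly feasible point (`Blocks.exists_strict`). At
the rightmost point (log z̄, log w) the tilted second drift vanishes, the first is positive, and w
is the only root of χ(z̄,·) = 1 (`Blocks.exists_critical`).

The fold. Let y and u be the right and left Perron vectors of C(z̄,w). Because the second drift is
zero, the inequalities G₁y ≤ wy and uR₁ ≤ w⁻¹u are equalities (`Fold.G_mulVec`, `Fold.vecMul_R`).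
Let ψ be a left eigenvector of G₁(z̄) for w and v a right eigenvector of R₁(z̄) for w⁻¹. By
irreducibility w is the only number μ on its circle for which C(z̄,μ) has eigenvalue one
(`Critical.circle`), so the X-derivative of the quadratic equation has the one-dimensional kernel
spanned by N₁vψ (`Fold.kernel`). The functional X ↦ uXy kills the range of that derivative, and its
value on the z-derivative is a positive multiple of the first drift. Hence the solutions near the
fold form an analytic curve s ↦ (Z(s), X(s)) parametrized by the eigenvalue s
(`FoldFamily.exists_curve`), and z̄ - Z(s) vanishes exactly to second order at w
(`FoldFamily.exists_fold_limit`). Inverting an analytic square root of z̄ - Z(s) makes s and X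
analytic in (z̄ - z)^(1/2); continuity of G₁ on the annulus fixes the sign of the root
(`FoldFamily.exists_puiseux`).

The coefficient. By the chain rule the first Puiseux coefficient of G₁ is that of the eigenvalue
times X'(w), and X'(w) = N₁vψ/(ψN₁v) (`FoldFamily.hasDerivAt_curve`). For real z the eigenvalue is
the smaller root of χ(z,·) = 1 (`eventually_eq_zetaLow`). It lies below every superharmonic level,
so convexity gives α(t) ≤ w + Lt² for small t > 0 and α'(0) ≤ 0 (`deriv_nonpos_of_le`); it is
nonzero by the fold. As ψ and v may be taken nonnegative, the sign statement follows. Continuations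
are identified by the identity theorem on a star-shaped sector. -/

namespace TwoDQBD

/-! ### Perron–Frobenius theory of nonnegative matrices -/

section Perron

variable {S : Type*} [Fintype S]

/-- Irreducibility of a matrix, as an induction principle along its positive entries. -/
def MIrr (M : Matrix S S ℝ) : Prop :=
  ∀ Q : S → Prop, (∃ a, Q a) → (∀ a b, Q a → 0 < M a b → Q b) → ∀ b, Q b

/-- A set closed along reversed edges has a complement closed along edges. -/
theorem MIrr.transpose {M : Matrix S S ℝ} (h : MIrr M) : MIrr Mᵀ := by
  intro Q hQ hstep b
  by_contra hb
  obtain ⟨a, ha⟩ := hQ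
  refine h (fun c => ¬ Q c) ⟨b, hb⟩ (fun c d hc hcd hd => hc (hstep d c hd hcd)) a ha

/-- A zero of `y` propagates along positive entries of `M`, because a nonnegative sum that is at
most zero has only zero terms. -/
theorem MIrr.pos_of_mulVec_le {M : Matrix S S ℝ} (h : MIrr M) (h0 : ∀ a b, 0 ≤ M a b)
    {y : S → ℝ} (hy : ∀ a, 0 ≤ y a) (hne : ∃ a, 0 < y a) {c : ℝ}
    (hle : ∀ a, (M *ᵥ y) a ≤ c * y a) (a : S) : 0 < y a := by
  by_contra hya
  obtain ⟨b, hb⟩ := hne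
  have key := h (fun a => y a = 0) ⟨a, le_antisymm (not_lt.1 hya) (hy a)⟩ (fun a b ha hab => by
    have h1 : M a b * y b ≤ (M *ᵥ y) a :=
      Finset.single_le_sum (f := fun b => M a b * y b)
        (fun i _ => mul_nonneg (h0 a i) (hy i)) (Finset.mem_univ b)
    have h2 := hle a
    rw [ha, mul_zero] at h2
    have h3 : y b ≤ 0 := by
      by_contra hlt
      have := mul_pos hab (not_le.1 hlt)
      linarith
    exact le_antisymm h3 (hy b)) b
  exact hb.ne' key

theorem map_ofReal_mulVec (M : Matrix S S ℝ) (y : S → ℝ) :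
    M.map Complex.ofReal *ᵥ (fun a => (y a : ℂ)) = fun a => (((M *ᵥ y) a : ℝ) : ℂ) := by
  ext a; simp [Matrix.mulVec, dotProduct]

theorem vecMul_map_ofReal (M : Matrix S S ℝ) (y : S → ℝ) :
    (fun a => (y a : ℂ)) ᵥ* M.map Complex.ofReal = fun a => (((y ᵥ* M) a : ℝ) : ℂ) := by
  ext a; simp [Matrix.vecMul, dotProduct]

theorem norm_mulVec_le {M : Matrix S S ℝ} {Z : Matrix S S ℂ} (hZ : ∀ a b, ‖Z a b‖ ≤ M a b)
    (x : S → ℂ) (a : S) : ‖(Z *ᵥ x) a‖ ≤ (M *ᵥ fun b => ‖x b‖) a := by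
  refine (norm_sum_le _ _).trans (Finset.sum_le_sum fun b _ => ?_)
  rw [norm_mul]
  exact mul_le_mul_of_nonneg_right (hZ a b) (norm_nonneg _)

/-- An eigenvalue of a matrix dominated by `M` is at most `c` in modulus if `M y ≤ c y` for some
positive `y`. -/
theorem norm_eigenvalue_le {M : Matrix S S ℝ} {Z : Matrix S S ℂ} (hZ : ∀ a b, ‖Z a b‖ ≤ M a b)
    {y : S → ℝ} (hy : ∀ a, 0 < y a) {c : ℝ} (hle : ∀ a, (M *ᵥ y) a ≤ c * y a)
    {x : S → ℂ} (hx : x ≠ 0) {μ : ℂ} (hμ : Z *ᵥ x = μ • x) : ‖μ‖ ≤ c := by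
  have h0 : ∀ a b, 0 ≤ M a b := fun a b => (norm_nonneg _).trans (hZ a b)
  obtain ⟨b, hb⟩ := Function.ne_iff.1 hx
  have : Nonempty S := ⟨b⟩
  -- The least multiple of `y` above the moduli of `x` touches them at `a`, and the eigenvalue
  -- equation is read there.
  obtain ⟨a, ha⟩ := Finite.exists_max (fun a => ‖x a‖ / y a)
  set m := ‖x a‖ / y a with hm
  have hm0 : 0 < m := lt_of_lt_of_le (div_pos (norm_pos_iff.2 hb) (hy b)) (ha b)
  have hxm : ∀ d, ‖x d‖ ≤ m * y d := fun d => (div_le_iff₀ (hy d)).1 (ha d)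
  have h1 := norm_mulVec_le hZ x a
  rw [hμ] at h1
  have h2 : (M *ᵥ fun b => ‖x b‖) a ≤ m * (M *ᵥ y) a := by
    simp only [Matrix.mulVec, dotProduct, Finset.mul_sum]
    refine Finset.sum_le_sum fun d _ => ?_
    calc M a d * ‖x d‖ ≤ M a d * (m * y d) := mul_le_mul_of_nonneg_left (hxm d) (h0 a d)
      _ = m * (M a d * y d) := by ring
  have h3 : ‖x a‖ = m * y a := by rw [hm, div_mul_cancel₀ _ (hy a).ne']
  simp only [Pi.smul_apply, smul_eq_mul, norm_mul, h3] at h1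
  have h4 := mul_le_mul_of_nonneg_left (hle a) hm0.le
  have h5 : 0 < m * y a := mul_pos hm0 (hy a)
  by_contra hlt
  rw [not_le] at hlt
  have := mul_lt_mul_of_pos_right hlt h5
  nlinarith

/-- Each factor spreads positivity along one more edge, while the summand `1` keeps what is already
positive. Thus the entries increase with `n`, and the finitely many waiting times have a common
bound without any aperiodicity of `M`. -/
theorem MIrr.exists_pow_pos [DecidableEq S] {M : Matrix S S ℝ} (h : MIrr M)
    (h0 : ∀ a b, 0 ≤ M a b) {r : S → ℝ} (hr : ∀ a, 0 ≤ r a) (hne : ∃ a, 0 < r a) :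
    ∃ n : ℕ, ∀ a, 0 < (((1 + M) ^ n) *ᵥ r) a := by
  have hstep : ∀ (x : S → ℝ) (a : S), ((1 + M) *ᵥ x) a = x a + ∑ b, M a b * x b := by
    intro x a
    rw [Matrix.add_mulVec, Matrix.one_mulVec]; rfl
  have hpow : ∀ n a, (((1 + M) ^ (n + 1)) *ᵥ r) a
      = (((1 + M) ^ n) *ᵥ r) a + ∑ b, M a b * (((1 + M) ^ n) *ᵥ r) b := by
    intro n a
    rw [pow_succ', ← Matrix.mulVec_mulVec, hstep]
  have hnn : ∀ n a, 0 ≤ (((1 + M) ^ n) *ᵥ r) a := by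
    intro n
    induction n with
    | zero => intro a; simpa using hr a
    | succ n ih =>
      intro a; rw [hpow]
      exact add_nonneg (ih a) (Finset.sum_nonneg fun b _ => mul_nonneg (h0 a b) (ih b))
  have hmono : ∀ a, Monotone fun n => (((1 + M) ^ n) *ᵥ r) a := fun a =>
    monotone_nat_of_le_succ fun n => by
      rw [hpow]
      exact le_add_of_nonneg_right (Finset.sum_nonneg fun b _ => mul_nonneg (h0 a b) (hnn n b))
  have hex : ∀ a, ∃ n, 0 < (((1 + M) ^ n) *ᵥ r) a := by
    refine h.transpose _ ?_ ?_
    · obtain ⟨a, ha⟩ := hne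
      exact ⟨a, 0, by simpa using ha⟩
    · rintro a b ⟨n, hn⟩ hab
      refine ⟨n + 1, ?_⟩
      rw [hpow]
      refine add_pos_of_nonneg_of_pos (hnn n b) ?_
      refine lt_of_lt_of_le (mul_pos hab hn)
        (Finset.single_le_sum (f := fun c => M b c * (((1 + M) ^ n) *ᵥ r) c)
          (fun i _ => mul_nonneg (h0 b i) (hnn n i)) (Finset.mem_univ a))
  choose f hf using hex
  refine ⟨Finset.univ.sup f, fun a => (hf a).trans_le (hmono a (Finset.le_sup (Finset.mem_univ a)))⟩

/-- Collatz–Wielandt: maximize `c` over pairs with `c y ≤ M y` and `y` in the simplex. If the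
maximizer were not an eigenvector, a power of `1 + M` would make the slack positive in every
coordinate, and `c` could be increased. -/
theorem MIrr.exists_perron [DecidableEq S] [Nonempty S] {M : Matrix S S ℝ} (h : MIrr M)
    (h0 : ∀ a b, 0 ≤ M a b) : ∃ ρ : ℝ, 0 ≤ ρ ∧ ∃ y : S → ℝ, (∀ a, 0 < y a) ∧ M *ᵥ y = ρ • y := by
  set B := ∑ a, ∑ b, M a b with hB
  have hcomp : IsCompact ((Set.Icc 0 B ×ˢ stdSimplex ℝ S) ∩
      {q : ℝ × (S → ℝ) | ∀ a, q.1 * q.2 a ≤ (M *ᵥ q.2) a}) := by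
    refine (isCompact_Icc.prod (isCompact_stdSimplex ℝ S)).inter_right ?_
    simp only [Set.ofPred_forall]
    refine isClosed_iInter fun a => isClosed_le (by fun_prop) ?_
    simp only [Matrix.mulVec, dotProduct]
    fun_prop
  have hle_one : ∀ y ∈ stdSimplex ℝ S, ∀ a, y a ≤ 1 := fun y hy a =>
    hy.2 ▸ Finset.single_le_sum (fun i _ => hy.1 i) (Finset.mem_univ a)
  have hbd : ∀ c : ℝ, ∀ y ∈ stdSimplex ℝ S, (∀ a, c * y a ≤ (M *ᵥ y) a) → c ≤ B := by
    intro c y hy hc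
    have h1 : ∑ a, c * y a ≤ ∑ a, (M *ᵥ y) a := Finset.sum_le_sum fun a _ => hc a
    rw [← Finset.mul_sum, hy.2, mul_one] at h1
    refine h1.trans (Finset.sum_le_sum fun a _ => Finset.sum_le_sum fun b _ => ?_)
    exact mul_le_of_le_one_right (h0 a b) (hle_one y hy b)
  have hB0 : 0 ≤ B := Finset.sum_nonneg fun a _ => Finset.sum_nonneg fun b _ => h0 a b
  obtain ⟨a₀⟩ := ‹Nonempty S›
  have hne : ((Set.Icc 0 B ×ˢ stdSimplex ℝ S) ∩
      {q : ℝ × (S → ℝ) | ∀ a, q.1 * q.2 a ≤ (M *ᵥ q.2) a}).Nonempty := by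
    refine ⟨(0, Pi.single a₀ 1), ⟨⟨le_rfl, hB0⟩, single_mem_stdSimplex ℝ a₀⟩, fun a => ?_⟩
    simp [h0]
  obtain ⟨⟨c, y⟩, ⟨⟨⟨hc0, hcB⟩, hy⟩, hcy⟩, hmax⟩ := hcomp.exists_isMaxOn hne continuousOn_fst
  simp only [Set.mem_ofPred_eq] at hcy hc0
  have heq : M *ᵥ y = c • y := by
    by_contra hneq
    set r : S → ℝ := M *ᵥ y - c • y with hr
    have hr0 : ∀ a, 0 ≤ r a := fun a => by simpa [hr] using hcy a
    have hrp : ∃ a, 0 < r a := by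
      by_contra hcon
      push Not at hcon
      apply hneq
      have : r = 0 := funext fun a => le_antisymm (hcon a) (hr0 a)
      exact sub_eq_zero.1 this
    obtain ⟨n, hn⟩ := h.exists_pow_pos h0 hr0 hrp
    set z := ((1 + M) ^ n) *ᵥ y with hz
    have hPnn : ∀ (n : ℕ) a b, 0 ≤ ((1 + M) ^ n : Matrix S S ℝ) a b := by
      intro n
      induction n with
      | zero => intro a b; simp only [pow_zero, Matrix.one_apply]; split_ifs <;> norm_num
      | succ n ih =>
        intro a b; rw [pow_succ, Matrix.mul_apply]
        refine Finset.sum_nonneg fun d _ => mul_nonneg (ih a d) ?_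
        simp only [Matrix.add_apply, Matrix.one_apply]
        split_ifs <;> linarith [h0 d b]
    have hz0 : ∀ a, 0 ≤ z a := fun a =>
      Finset.sum_nonneg fun b _ => mul_nonneg (hPnn n a b) (hy.1 b)
    have hzr : M *ᵥ z - c • z = ((1 + M) ^ n) *ᵥ r := by
      have hcomm : M * (1 + M) ^ n = (1 + M) ^ n * M :=
        ((Commute.one_right M).add_right (Commute.refl M)).pow_right n
      rw [hz, hr, Matrix.mulVec_sub, Matrix.mulVec_mulVec, Matrix.mulVec_mulVec, hcomm,
        Matrix.mulVec_smul]
    have hpos : ∀ a, 0 < (M *ᵥ z) a - c * z a := fun a => by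
      have := congrFun hzr a
      simp only [Pi.sub_apply, Pi.smul_apply, smul_eq_mul] at this
      rw [this]; exact hn a
    have hznz : 0 < ∑ a, z a := by
      rcases (Finset.sum_nonneg fun a _ => hz0 a : 0 ≤ ∑ a, z a).lt_or_eq with hlt | heq0
      · exact hlt
      · exfalso
        have hz' : z = 0 := funext fun a =>
          (Finset.sum_eq_zero_iff_of_nonneg fun a _ => hz0 a).1 heq0.symm a (Finset.mem_univ a)
        have := hpos a₀
        simp [hz'] at this
    have : Nonempty S := ⟨a₀⟩
    obtain ⟨am, ham⟩ := Finite.exists_min fun a => (M *ᵥ z) a - c * z a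
    -- The smallest slack divided by the total mass: as no coordinate exceeds the total mass, `c`
    -- can be raised by this amount.
    set δ := ((M *ᵥ z) am - c * z am) / ∑ a, z a with hδ
    have hδ0 : 0 < δ := div_pos (hpos am) hznz
    set z' : S → ℝ := (∑ a, z a)⁻¹ • z with hz'
    have hz's : z' ∈ stdSimplex ℝ S := by
      refine ⟨fun a => mul_nonneg (inv_nonneg.2 hznz.le) (hz0 a), ?_⟩
      simp only [hz', Pi.smul_apply, smul_eq_mul, ← Finset.mul_sum]
      exact inv_mul_cancel₀ hznz.ne'
    have hc' : ∀ a, (c + δ) * z' a ≤ (M *ᵥ z') a := by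
      intro a
      have h1 : δ * z a ≤ (M *ᵥ z) a - c * z a := by
        refine le_trans ?_ (ham a)
        rw [hδ, div_mul_eq_mul_div, div_le_iff₀ hznz]
        exact mul_le_mul_of_nonneg_left
          (Finset.single_le_sum (fun i _ => hz0 i) (Finset.mem_univ a)) (hpos am).le
      rw [hz', Matrix.mulVec_smul]
      simp only [Pi.smul_apply, smul_eq_mul]
      have := mul_le_mul_of_nonneg_left h1 (inv_nonneg.2 hznz.le)
      nlinarith
    have := hmax (a := (c + δ, z')) ⟨⟨⟨by positivity, hbd _ _ hz's hc'⟩, hz's⟩, hc'⟩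
    simp only [Set.mem_ofPred_eq] at this
    linarith
  refine ⟨c, hc0, y, fun a => ?_, heq⟩
  have hyp : ∃ a, 0 < y a := by
    by_contra hcon
    push Not at hcon
    have : ∑ a, y a ≤ 0 := Finset.sum_nonpos fun a _ => hcon a
    linarith [hy.2]
  exact h.pos_of_mulVec_le h0 hy.1 hyp (c := c) (fun a => by rw [heq]; rfl) a

theorem mem_spectrum_iff_exists_mulVec [DecidableEq S] {Z : Matrix S S ℂ} {μ : ℂ} :
    μ ∈ spectrum ℂ Z ↔ ∃ x : S → ℂ, x ≠ 0 ∧ Z *ᵥ x = μ • x := by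
  rw [spectrum.mem_iff, Matrix.isUnit_iff_isUnit_det, isUnit_iff_ne_zero, not_not,
    ← Matrix.exists_mulVec_eq_zero_iff]
  refine exists_congr fun x => and_congr_right fun _ => ?_
  rw [Matrix.sub_mulVec, sub_eq_zero, eq_comm, Algebra.algebraMap_eq_smul_one, Matrix.smul_mulVec,
    Matrix.one_mulVec]

theorem spr_map_ofReal [DecidableEq S] [Nonempty S] {M : Matrix S S ℝ} (h0 : ∀ a b, 0 ≤ M a b)
    {y : S → ℝ} (hy : ∀ a, 0 < y a) {ρ : ℝ} (hρ : 0 ≤ ρ) (hM : M *ᵥ y = ρ • y) :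
    spr (M.map Complex.ofReal) = ρ := by
  have hZ : ∀ a b, ‖(M.map Complex.ofReal) a b‖ ≤ M a b := fun a b => by simp [abs_of_nonneg (h0 a b)]
  have h1 : spectralRadius ℂ (M.map Complex.ofReal) = ENNReal.ofReal ρ := by
    refine le_antisymm (iSup₂_le fun μ hμ => ?_) ?_
    · obtain ⟨x, hx, hxe⟩ := mem_spectrum_iff_exists_mulVec.1 hμ
      have := norm_eigenvalue_le hZ hy (c := ρ) (fun a => by rw [hM]; rfl) hx hxe
      rw [← enorm_eq_nnnorm, ← ofReal_norm]
      exact ENNReal.ofReal_le_ofReal this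
    · have hmem : (ρ : ℂ) ∈ spectrum ℂ (M.map Complex.ofReal) := by
        rw [mem_spectrum_iff_exists_mulVec]
        refine ⟨fun a => (y a : ℂ), fun h => ?_, ?_⟩
        · obtain ⟨a⟩ := ‹Nonempty S›
          have := congrFun h a
          simp only [Pi.zero_apply, Complex.ofReal_eq_zero] at this
          exact (hy a).ne' this
        · rw [map_ofReal_mulVec, hM]; ext a; simp
      refine le_trans ?_ (le_iSup₂ (f := fun (k : ℂ) (_ : k ∈ spectrum ℂ (M.map Complex.ofReal)) =>
        (‖k‖₊ : ENNReal)) (ρ : ℂ) hmem)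
      rw [← enorm_eq_nnnorm, ← ofReal_norm, Complex.norm_real, Real.norm_of_nonneg hρ]
  rw [spr, h1, ENNReal.toReal_ofReal hρ]

/-- The Perron vector gives one direction; a positive superharmonic vector bounds every eigenvalue
in the other. This trades the spectral radius for an inequality between vectors. -/
theorem spr_le_one_iff [DecidableEq S] [Nonempty S] {M : Matrix S S ℝ} (h : MIrr M)
    (h0 : ∀ a b, 0 ≤ M a b) : spr (M.map Complex.ofReal) ≤ 1 ↔
      ∃ y : S → ℝ, (∀ a, 0 < y a) ∧ ∀ a, (M *ᵥ y) a ≤ y a := by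
  obtain ⟨ρ, hρ, y, hy, hM⟩ := h.exists_perron h0
  rw [spr_map_ofReal h0 hy hρ hM]
  constructor
  · intro hle
    refine ⟨y, hy, fun a => ?_⟩
    rw [hM]
    exact mul_le_of_le_one_left (hy a).le hle
  · rintro ⟨z, hz, hMz⟩
    have hZ : ∀ a b, ‖(M.map Complex.ofReal) a b‖ ≤ M a b :=
      fun a b => by simp [abs_of_nonneg (h0 a b)]
    have := norm_eigenvalue_le hZ hz (c := 1) (by simpa using hMz)
      (x := fun a => (y a : ℂ)) (μ := ρ) (fun h => by
        obtain ⟨a⟩ := ‹Nonempty S›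
        have := congrFun h a
        simp only [Pi.zero_apply, Complex.ofReal_eq_zero] at this
        exact (hy a).ne' this) (by rw [map_ofReal_mulVec, hM]; ext a; simp)
    rw [Complex.norm_real] at this
    exact (le_abs_self ρ).trans this

theorem spr_eq_one_iff [DecidableEq S] [Nonempty S] {M : Matrix S S ℝ} (h : MIrr M)
    (h0 : ∀ a b, 0 ≤ M a b) : spr (M.map Complex.ofReal) = 1 ↔
      ∃ y : S → ℝ, (∀ a, 0 < y a) ∧ M *ᵥ y = y := by
  constructor
  · intro h1
    obtain ⟨ρ, hρ, y, hy, hM⟩ := h.exists_perron h0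
    rw [spr_map_ofReal h0 hy hρ hM] at h1
    exact ⟨y, hy, by rw [hM, h1, one_smul]⟩
  · rintro ⟨y, hy, hM⟩
    exact spr_map_ofReal h0 hy zero_le_one (by rw [hM, one_smul])

/-- The least multiple of `y` above `x` touches `x` somewhere; the difference is a nonnegative fixed
vector with a zero, so it vanishes. -/
theorem MIrr.eq_smul_of_mulVec_eq_real [Nonempty S] {M : Matrix S S ℝ} (h : MIrr M)
    (h0 : ∀ a b, 0 ≤ M a b)
    {y : S → ℝ} (hy : ∀ a, 0 < y a) (hM : M *ᵥ y = y) {x : S → ℝ} (hx : M *ᵥ x = x) :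
    ∃ c : ℝ, x = c • y := by
  obtain ⟨a, ha⟩ := Finite.exists_max (fun a => x a / y a)
  refine ⟨x a / y a, ?_⟩
  set c := x a / y a
  have hd0 : ∀ b, 0 ≤ (c • y - x) b := fun b => by
    have := (div_le_iff₀ (hy b)).1 (ha b)
    simpa using this
  have hMd : M *ᵥ (c • y - x) = c • y - x := by
    rw [Matrix.mulVec_sub, Matrix.mulVec_smul, hM, hx]
  by_contra hne
  have hpos : ∃ b, 0 < (c • y - x) b := by
    by_contra hcon
    push Not at hcon
    apply hne
    have : c • y - x = 0 := funext fun b => le_antisymm (hcon b) (hd0 b)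
    exact (sub_eq_zero.1 this).symm
  have := h.pos_of_mulVec_le h0 hd0 hpos (c := 1) (fun b => by rw [hMd, one_mul]) a
  simp only [Pi.sub_apply, Pi.smul_apply, smul_eq_mul, c, div_mul_cancel₀ _ (hy a).ne',
    sub_self, lt_irrefl] at this

theorem MIrr.eq_smul_of_mulVec_eq [Nonempty S] {M : Matrix S S ℝ} (h : MIrr M)
    (h0 : ∀ a b, 0 ≤ M a b) {y : S → ℝ} (hy : ∀ a, 0 < y a) (hM : M *ᵥ y = y)
    {x : S → ℂ} (hx : M.map Complex.ofReal *ᵥ x = x) :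
    ∃ c : ℂ, x = c • fun a => (y a : ℂ) := by
  have hre : M *ᵥ (fun a => (x a).re) = fun a => (x a).re := by
    ext a
    have := congrArg Complex.re (congrFun hx a)
    simpa [Matrix.mulVec, dotProduct] using this
  have him : M *ᵥ (fun a => (x a).im) = fun a => (x a).im := by
    ext a
    have := congrArg Complex.im (congrFun hx a)
    simpa [Matrix.mulVec, dotProduct] using this
  obtain ⟨c, hc⟩ := h.eq_smul_of_mulVec_eq_real h0 hy hM hre
  obtain ⟨d, hd⟩ := h.eq_smul_of_mulVec_eq_real h0 hy hM him
  refine ⟨⟨c, d⟩, ?_⟩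
  ext a
  have h1 := congrFun hc a
  have h2 := congrFun hd a
  simp only [Pi.smul_apply, smul_eq_mul] at h1 h2
  apply Complex.ext <;> simp [h1, h2]

/-- For any left eigenvector the absolute values satisfy the eigenvector inequality with `≥`, and
pairing with the positive right eigenvector leaves no slack. Irreducibility is not assumed, since G₁
and R₁ may be reducible. -/
theorem exists_left_fixed_nonneg [DecidableEq S] [Nonempty S] {M : Matrix S S ℝ}
    (h0 : ∀ a b, 0 ≤ M a b) {y : S → ℝ} (hy : ∀ a, 0 < y a) {c : ℝ} (hM : M *ᵥ y = c • y) :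
    ∃ u : S → ℝ, (∀ a, 0 ≤ u a) ∧ u ≠ 0 ∧ u ᵥ* M = c • u := by
  have hy0 : y ≠ 0 := fun h => by
    obtain ⟨a⟩ := ‹Nonempty S›
    exact (hy a).ne' (congrFun h a)
  have hdet : (M - c • (1 : Matrix S S ℝ)).det = 0 := by
    rw [← Matrix.exists_mulVec_eq_zero_iff]
    exact ⟨y, hy0, by rw [Matrix.sub_mulVec, hM, Matrix.smul_mulVec, Matrix.one_mulVec, sub_self]⟩
  obtain ⟨u, hu0, hu⟩ := Matrix.exists_vecMul_eq_zero_iff.2 hdet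
  rw [Matrix.vecMul_sub, Matrix.vecMul_smul, Matrix.vecMul_one, sub_eq_zero] at hu
  have hc : 0 ≤ c := by
    obtain ⟨a⟩ := ‹Nonempty S›
    have h1 : 0 ≤ (M *ᵥ y) a := Finset.sum_nonneg fun b _ => mul_nonneg (h0 a b) (hy b).le
    rw [hM] at h1
    exact nonneg_of_mul_nonneg_left h1 (hy a)
  have hge : ∀ b, c * |u b| ≤ ((fun a => |u a|) ᵥ* M) b := by
    intro b
    have := congrFun hu b
    simp only [Pi.smul_apply, smul_eq_mul] at this
    rw [← abs_of_nonneg hc, ← abs_mul, ← this]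
    refine (Finset.abs_sum_le_sum_abs _ _).trans (Finset.sum_le_sum fun a _ => ?_)
    rw [abs_mul, abs_of_nonneg (h0 a b)]
  refine ⟨fun a => |u a|, fun a => abs_nonneg _, fun h => hu0 (funext fun a => ?_), ?_⟩
  · exact abs_eq_zero.1 (congrFun h a)
  · have hsum : ∑ b, (((fun a => |u a|) ᵥ* M) b - c * |u b|) * y b = 0 := by
      have h1 : ∑ b, ((fun a => |u a|) ᵥ* M) b * y b = ∑ a, |u a| * (M *ᵥ y) a :=
        (Matrix.dotProduct_mulVec (fun a => |u a|) M y).symm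
      simp only [sub_mul, Finset.sum_sub_distrib, h1, hM, Pi.smul_apply, smul_eq_mul]
      rw [sub_eq_zero]
      exact Finset.sum_congr rfl fun a _ => by ring
    have hz := (Finset.sum_eq_zero_iff_of_nonneg fun b _ =>
      mul_nonneg (sub_nonneg.2 (hge b)) (hy b).le).1 hsum
    ext b
    have := (mul_eq_zero.1 (hz b (Finset.mem_univ b))).resolve_right (hy b).ne'
    simpa [sub_eq_zero] using this

theorem MIrr.exists_left_fixed [DecidableEq S] [Nonempty S] {M : Matrix S S ℝ} (h : MIrr M)
    (h0 : ∀ a b, 0 ≤ M a b) {y : S → ℝ} (hy : ∀ a, 0 < y a) (hM : M *ᵥ y = y) :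
    ∃ u : S → ℝ, (∀ a, 0 < u a) ∧ u ᵥ* M = u := by
  obtain ⟨u, hu0, hune, hu⟩ := exists_left_fixed_nonneg h0 hy (c := 1) (by rw [hM, one_smul])
  rw [one_smul] at hu
  refine ⟨u, fun a => ?_, hu⟩
  refine h.transpose.pos_of_mulVec_le (fun a b => h0 b a) hu0 ?_ (c := 1) (fun b => ?_) a
  · by_contra hcon
    push Not at hcon
    exact hune (funext fun b => le_antisymm (hcon b) (hu0 b))
  · rw [Matrix.mulVec_transpose, hu, one_mul]

end Perron

/-! ### Exponential tilts and compactness of the feasible set -/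

section Geometry

variable {S : Type*} [Fintype S] [DecidableEq S]

/-- Fredholm alternative by hand: the rank-one correction `(u ⬝ᵥ g) • y` makes `M - 1` injective,
hence surjective, and the correction is zero for the solution because `u ⬝ᵥ D = 0`. -/
theorem MIrr.exists_poisson [Nonempty S] {M : Matrix S S ℝ} (h : MIrr M) (h0 : ∀ a b, 0 ≤ M a b)
    {y u : S → ℝ} (hy : ∀ a, 0 < y a) (hM : M *ᵥ y = y) (hu : ∀ a, 0 < u a) (huM : u ᵥ* M = u)
    {D : S → ℝ} (hD : u ⬝ᵥ D = 0) : ∃ g : S → ℝ, M *ᵥ g - g = D := by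
  have huy : 0 < u ⬝ᵥ y := by
    obtain ⟨a⟩ := ‹Nonempty S›
    exact Finset.sum_pos (fun a _ => mul_pos (hu a) (hy a)) ⟨a, Finset.mem_univ a⟩
  let L : (S → ℝ) →ₗ[ℝ] (S → ℝ) :=
    { toFun := fun g => M *ᵥ g - g + (u ⬝ᵥ g) • y
      map_add' := fun g k => by
        simp only [Matrix.mulVec_add, dotProduct_add, add_smul]; abel
      map_smul' := fun c g => by
        simp only [Matrix.mulVec_smul, dotProduct_smul, smul_eq_mul, RingHom.id_apply, smul_add,
          smul_sub, mul_smul] }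
  have hL : ∀ g, L g = M *ᵥ g - g + (u ⬝ᵥ g) • y := fun _ => rfl
  have huL : ∀ g, u ⬝ᵥ L g = (u ⬝ᵥ g) * (u ⬝ᵥ y) := fun g => by
    rw [hL, dotProduct_add, dotProduct_sub, Matrix.dotProduct_mulVec, huM, sub_self, zero_add,
      dotProduct_smul, smul_eq_mul]
  have hinj : Function.Injective L := by
    rw [← LinearMap.ker_eq_bot, LinearMap.ker_eq_bot']
    intro g hg
    have h1 : u ⬝ᵥ g = 0 := by
      have := huL g
      rw [hg, dotProduct_zero] at this
      exact (mul_eq_zero.1 this.symm).resolve_right huy.ne'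
    rw [hL, h1, zero_smul, add_zero, sub_eq_zero] at hg
    obtain ⟨c, rfl⟩ := h.eq_smul_of_mulVec_eq_real h0 hy hM hg
    rw [dotProduct_smul, smul_eq_mul] at h1
    rw [(mul_eq_zero.1 h1).resolve_right huy.ne', zero_smul]
  obtain ⟨g, hg⟩ := LinearMap.injective_iff_surjective.1 hinj D
  refine ⟨g, ?_⟩
  have h1 : u ⬝ᵥ g = 0 := by
    have := huL g
    rw [hg, hD] at this
    exact (mul_eq_zero.1 this.symm).resolve_right huy.ne'
  rw [hL, h1, zero_smul, add_zero] at hg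
  exact hg

theorem nStep_nonneg {X : Type*} [DecidableEq X] {P : X → X → ℝ} (hP : ∀ x y, 0 ≤ P x y)
    (n : ℕ) (x y : X) : 0 ≤ nStep P n x y := by
  induction n generalizing x with
  | zero => simp only [nStep]; split_ifs <;> norm_num
  | succ n ih => exact tsum_nonneg fun z => mul_nonneg (hP x z) (ih z)

/-- A positive `tsum` has a nonzero summand, so a positive `n`-step probability provides an actual
path; summability plays no role. -/
theorem ChainIrreducible.induction {X : Type*} [DecidableEq X] {P : X → X → ℝ}
    (hirr : ChainIrreducible P) (hP : ∀ x y, 0 ≤ P x y) (Q : X → Prop) {x : X} (hx : Q x)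
    (hstep : ∀ y z, Q y → 0 < P y z → Q z) (y : X) : Q y := by
  obtain ⟨n, hn⟩ := hirr x y
  induction n generalizing x with
  | zero =>
    simp only [nStep] at hn
    split_ifs at hn with hxy
    · exact hxy ▸ hx
    · exact absurd hn (lt_irrefl 0)
  | succ n ih =>
    have : ∃ z, P x z * nStep P n z y ≠ 0 := by
      by_contra hcon
      push Not at hcon
      simp only [nStep, hcon, tsum_zero, lt_irrefl] at hn
    obtain ⟨z, hz⟩ := this
    have h1 := (hP x z).lt_of_ne (fun h => hz (by rw [← h, zero_mul]))
    have h2 := (nStep_nonneg hP n z y).lt_of_ne (fun h => hz (by rw [← h, mul_zero]))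
    exact ih (hstep x z hx h1) h2

/-- The properties of the blocks used below: nonnegativity and irreducibility of the chain on
`ℤ² × S`, the latter as an induction principle. -/
structure Blocks (A : ℤ → ℤ → Matrix S S ℝ) : Prop where
  nonneg : ∀ i ∈ H, ∀ j ∈ H, ∀ a b, 0 ≤ A i j a b
  induction : ∀ (Q : ℤ → ℤ → S → Prop) (m n : ℤ) (a : S), Q m n a →
    (∀ m n a i j b, i ∈ H → j ∈ H → 0 < A i j a b → Q m n a → Q (m + i) (n + j) b) →
    ∀ m' n' b, Q m' n' b

theorem blocks_of_irreducible {A : ℤ → ℤ → Matrix S S ℝ}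
    (hnonneg : ∀ i ∈ H, ∀ j ∈ H, ∀ a b, 0 ≤ A i j a b) (hirr : ChainIrreducible (pTilde A)) :
    Blocks A where
  nonneg := hnonneg
  induction Q m n a hQ hstep m' n' b := by
    refine hirr.induction (fun x y => ?_) (fun x => Q x.1 x.2.1 x.2.2) (x := (m, n, a)) hQ ?_
      (m', n', b)
    · unfold pTilde
      split_ifs with h
      · exact hnonneg _ h.1 _ h.2 _ _
      · exact le_rfl
    · intro y z hy hyz
      unfold pTilde at hyz
      split_ifs at hyz with h
      · have := hstep _ _ _ _ _ _ h.1 h.2 hyz hy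
        simpa using this
      · exact absurd hyz (lt_irrefl 0)

/-- The matrix `C(x, w)` for real arguments. -/
noncomputable def Cr (A : ℤ → ℤ → Matrix S S ℝ) (x w : ℝ) : Matrix S S ℝ :=
  ∑ j ∈ H, ∑ i ∈ H, (w ^ j * x ^ i) • A i j

theorem C_ofReal (A : ℤ → ℤ → Matrix S S ℝ) (x w : ℝ) :
    C A x w = (Cr A x w).map Complex.ofReal := by
  ext a b
  simp [C, Acol, Cr, Matrix.sum_apply, Finset.mul_sum, mul_assoc]

theorem Cr_apply (A : ℤ → ℤ → Matrix S S ℝ) (x w : ℝ) (a b : S) :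
    Cr A x w a b = ∑ j ∈ H, ∑ i ∈ H, w ^ j * x ^ i * A i j a b := by
  simp [Cr, Matrix.sum_apply]

theorem Blocks.Cr_nonneg {A : ℤ → ℤ → Matrix S S ℝ} (hA : Blocks A) {x w : ℝ} (hx : 0 < x)
    (hw : 0 < w) (a b : S) : 0 ≤ Cr A x w a b := by
  rw [Cr_apply]
  exact Finset.sum_nonneg fun j hj => Finset.sum_nonneg fun i hi =>
    mul_nonneg (by positivity) (hA.nonneg i hi j hj a b)

theorem Blocks.Cr_irr {A : ℤ → ℤ → Matrix S S ℝ} (hA : Blocks A) {x w : ℝ} (hx : 0 < x)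
    (hw : 0 < w) : MIrr (Cr A x w) := by
  rintro Q ⟨a, ha⟩ hstep b
  refine hA.induction (fun _ _ a => Q a) 0 0 a ha ?_ 0 0 b
  intro _ _ c i j d hi hj hpos hQ
  refine hstep c d hQ ?_
  rw [Cr_apply]
  have hnn : ∀ j ∈ H, ∀ i ∈ H, 0 ≤ w ^ j * x ^ i * A i j c d := fun j hj i hi =>
    mul_nonneg (by positivity) (hA.nonneg i hi j hj c d)
  calc 0 < w ^ j * x ^ i * A i j c d := by positivity
    _ ≤ ∑ i ∈ H, w ^ j * x ^ i * A i j c d :=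
      Finset.single_le_sum (f := fun i => w ^ j * x ^ i * A i j c d) (hnn j hj) hi
    _ ≤ _ := Finset.single_le_sum (f := fun j => ∑ i ∈ H, w ^ j * x ^ i * A i j c d)
      (fun j hj => Finset.sum_nonneg (hnn j hj)) hj

/-- The one-step transitions out of a phase. -/
def edges : Finset (ℤ × ℤ × S) := H ×ˢ (H ×ˢ Finset.univ)

/-- The weight of the transition `e` out of phase `a`, tilted by `s` and by the function `h`. -/
noncomputable def tilt (A : ℤ → ℤ → Matrix S S ℝ) (s : ℝ × ℝ) (h : S → ℝ) (a : S)
    (e : ℤ × ℤ × S) : ℝ :=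
  A e.1 e.2.1 a e.2.2 * Real.exp (e.1 * s.1 + e.2.1 * s.2 + h e.2.2 - h a)

/-- `exp (-h a) * (C(exp s₁, exp s₂) exp h) a`. -/
noncomputable def tiltSum (A : ℤ → ℤ → Matrix S S ℝ) (s : ℝ × ℝ) (h : S → ℝ) (a : S) : ℝ :=
  ∑ e ∈ edges, tilt A s h a e

theorem mem_edges {e : ℤ × ℤ × S} : e ∈ edges ↔ e.1 ∈ H ∧ e.2.1 ∈ H := by
  simp [edges]

theorem Blocks.tilt_nonneg {A : ℤ → ℤ → Matrix S S ℝ} (hA : Blocks A) (s : ℝ × ℝ) (h : S → ℝ)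
    (a : S) {e : ℤ × ℤ × S} (he : e ∈ edges) : 0 ≤ tilt A s h a e :=
  mul_nonneg (hA.nonneg _ (mem_edges.1 he).1 _ (mem_edges.1 he).2 _ _) (Real.exp_pos _).le

/-- `C(x, w)` with its summands weighted by `c i j`. -/
noncomputable def Crw (A : ℤ → ℤ → Matrix S S ℝ) (c : ℤ → ℤ → ℝ) (x w : ℝ) : Matrix S S ℝ :=
  ∑ j ∈ H, ∑ i ∈ H, (c i j * (w ^ j * x ^ i)) • A i j

theorem Crw_one (A : ℤ → ℤ → Matrix S S ℝ) (x w : ℝ) : Crw A (fun _ _ => 1) x w = Cr A x w := by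
  simp [Crw, Cr]

theorem sum_tilt_mul_mul (A : ℤ → ℤ → Matrix S S ℝ) (s : ℝ × ℝ) (h : S → ℝ) (a : S)
    (c : ℤ → ℤ → ℝ) (F : S → ℝ) :
    ∑ e ∈ edges, tilt A s h a e * (c e.1 e.2.1 * F e.2.2) = Real.exp (-h a) *
      (Crw A c (Real.exp s.1) (Real.exp s.2) *ᵥ fun b => Real.exp (h b) * F b) a := by
  simp only [edges, Finset.sum_product, Matrix.mulVec, dotProduct, Crw, Matrix.sum_apply,
    Matrix.smul_apply, smul_eq_mul, Finset.sum_mul, Finset.mul_sum, tilt]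
  rw [Finset.sum_comm, Finset.sum_comm (s := Finset.univ)]
  refine Finset.sum_congr rfl fun j _ => ?_
  rw [Finset.sum_comm (s := Finset.univ)]
  refine Finset.sum_congr rfl fun i _ => Finset.sum_congr rfl fun b _ => ?_
  rw [← Real.rpow_intCast, ← Real.exp_mul, ← Real.rpow_intCast, ← Real.exp_mul, sub_eq_add_neg,
    Real.exp_add, Real.exp_add, Real.exp_add, mul_comm (i : ℝ), mul_comm (j : ℝ)]
  ring

theorem sum_tilt_mul (A : ℤ → ℤ → Matrix S S ℝ) (s : ℝ × ℝ) (h : S → ℝ) (a : S) (F : S → ℝ) :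
    ∑ e ∈ edges, tilt A s h a e * F e.2.2 = Real.exp (-h a) *
      (Cr A (Real.exp s.1) (Real.exp s.2) *ᵥ fun b => Real.exp (h b) * F b) a := by
  simpa [Crw_one] using sum_tilt_mul_mul A s h a (fun _ _ => 1) F

theorem tiltSum_eq (A : ℤ → ℤ → Matrix S S ℝ) (s : ℝ × ℝ) (h : S → ℝ) (a : S) :
    tiltSum A s h a = Real.exp (-h a) *
      (Cr A (Real.exp s.1) (Real.exp s.2) *ᵥ fun b => Real.exp (h b)) a := by
  simpa [tiltSum] using sum_tilt_mul A s h a (fun _ => 1)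

theorem mulVec_exp (A : ℤ → ℤ → Matrix S S ℝ) (s : ℝ × ℝ) (h : S → ℝ) (a : S) :
    (Cr A (Real.exp s.1) (Real.exp s.2) *ᵥ fun b => Real.exp (h b)) a
      = tiltSum A s h a * Real.exp (h a) := by
  rw [tiltSum_eq, mul_right_comm, ← Real.exp_add, neg_add_cancel, Real.exp_zero, one_mul]

/-- Here `exp h` is the superharmonic vector. In the coordinates `(s, h)` the constraint is a sum of
exponentials of linear forms with nonnegative coefficients, hence jointly convex. -/
theorem Blocks.mem_Gam_iff [Nonempty S] {A : ℤ → ℤ → Matrix S S ℝ} (hA : Blocks A) (s : ℝ × ℝ) :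
    s ∈ Gam A ↔ ∃ h : S → ℝ, ∀ a, tiltSum A s h a ≤ 1 := by
  unfold Gam chi
  rw [Set.mem_ofPred_eq, C_ofReal, spr_le_one_iff (hA.Cr_irr (Real.exp_pos _) (Real.exp_pos _))
    (hA.Cr_nonneg (Real.exp_pos _) (Real.exp_pos _))]
  constructor
  · rintro ⟨y, hy, hM⟩
    refine ⟨fun a => Real.log (y a), fun a => ?_⟩
    have h1 := mulVec_exp A s (fun a => Real.log (y a)) a
    simp only [Real.exp_log (hy _)] at h1
    have h2 := hM a
    rw [show (fun b => y b) = y from rfl] at h1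
    rw [h1] at h2
    exact le_of_mul_le_mul_right (by simpa using h2) (hy a)
  · rintro ⟨h, hh⟩
    refine ⟨fun a => Real.exp (h a), fun a => Real.exp_pos _, fun a => ?_⟩
    rw [mulVec_exp]
    exact mul_le_of_le_one_left (Real.exp_pos _).le (hh a)

theorem Blocks.chi_eq_one_iff [Nonempty S] {A : ℤ → ℤ → Matrix S S ℝ} (hA : Blocks A) {x w : ℝ}
    (hx : 0 < x) (hw : 0 < w) : chi A x w = 1 ↔
      ∃ y : S → ℝ, (∀ a, 0 < y a) ∧ Cr A x w *ᵥ y = y := by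
  rw [chi, C_ofReal, spr_eq_one_iff (hA.Cr_irr hx hw) (hA.Cr_nonneg hx hw)]

/-- Every tilted one-step weight is at most one. Along a path the exponents telescope and the
entries of `A` multiply to `p`, which depends on the path but not on `(s, h)`. -/
theorem Blocks.path_bound {A : ℤ → ℤ → Matrix S S ℝ} (hA : Blocks A) (a : S) (m n : ℤ) (b : S) :
    ∃ p > 0, ∀ (s : ℝ × ℝ) (h : S → ℝ), (∀ a, tiltSum A s h a ≤ 1) →
      p * Real.exp (m * s.1 + n * s.2 + h b - h a) ≤ 1 := by
  refine hA.induction (fun m n b => ∃ p > 0, ∀ (s : ℝ × ℝ) (h : S → ℝ),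
    (∀ a, tiltSum A s h a ≤ 1) → p * Real.exp (m * s.1 + n * s.2 + h b - h a) ≤ 1) 0 0 a
    ⟨1, one_pos, fun s h _ => by simp⟩ ?_ m n b
  rintro m n b i j c hi hj hpos ⟨p, hp, hle⟩
  refine ⟨p * A i j b c, mul_pos hp hpos, fun s h hK => ?_⟩
  have h1 : tilt A s h b (i, j, c) ≤ 1 :=
    (Finset.single_le_sum (f := fun e => tilt A s h b e) (fun e he => hA.tilt_nonneg s h b he)
      (mem_edges.2 ⟨hi, hj⟩)).trans (hK b)
  have h2 := hle s h hK
  have h3 : p * A i j b c * Real.exp (((m + i : ℤ) : ℝ) * s.1 + ((n + j : ℤ) : ℝ) * s.2 + h c - h a)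
      = p * Real.exp (m * s.1 + n * s.2 + h b - h a) * tilt A s h b (i, j, c) := by
    rw [tilt, mul_mul_mul_comm, ← Real.exp_add]
    congr 2
    push_cast
    ring
  rw [h3]
  exact mul_le_one₀ h2 ((hA.tilt_nonneg s h b (mem_edges.2 ⟨hi, hj⟩))) h1

theorem tiltSum_sub_const (A : ℤ → ℤ → Matrix S S ℝ) (s : ℝ × ℝ) (h : S → ℝ) (c : ℝ) (a : S) :
    tiltSum A s (fun b => h b - c) a = tiltSum A s h a := by
  simp only [tiltSum, tilt]
  refine Finset.sum_congr rfl fun e _ => ?_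
  congr 2
  ring

theorem continuous_tiltSum (A : ℤ → ℤ → Matrix S S ℝ) (a : S) :
    Continuous fun q : (ℝ × ℝ) × (S → ℝ) => tiltSum A q.1 q.2 a := by
  unfold tiltSum tilt
  fun_prop

/-- Paths from `a₀` to itself displaced by one unit in each of the four directions bound `s`;
undisplaced paths between `a₀` and `b` bound `h b`. The normalization removes the additive constant
in `h`, which the tilted sums do not see. -/
theorem Blocks.isCompact_normalized {A : ℤ → ℤ → Matrix S S ℝ} (hA : Blocks A) (a₀ : S) :
    IsCompact {q : (ℝ × ℝ) × (S → ℝ) | (∀ a, tiltSum A q.1 q.2 a ≤ 1) ∧ q.2 a₀ = 0} := by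
  have hlog : ∀ (m n : ℤ) (a b : S), ∃ B : ℝ, ∀ (s : ℝ × ℝ) (h : S → ℝ),
      (∀ a, tiltSum A s h a ≤ 1) → m * s.1 + n * s.2 + h b - h a ≤ B := by
    intro m n a b
    obtain ⟨p, hp, hle⟩ := hA.path_bound a m n b
    refine ⟨Real.log p⁻¹, fun s h hK => ?_⟩
    rw [Real.le_log_iff_exp_le (inv_pos.2 hp), le_inv_comm₀ (Real.exp_pos _) hp,
      ← one_div, le_div_iff₀ (Real.exp_pos _)]
    exact hle s h hK
  obtain ⟨B1, h1⟩ := hlog 1 0 a₀ a₀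
  obtain ⟨B2, h2⟩ := hlog (-1) 0 a₀ a₀
  obtain ⟨B3, h3⟩ := hlog 0 1 a₀ a₀
  obtain ⟨B4, h4⟩ := hlog 0 (-1) a₀ a₀
  choose B5 h5 using fun b => hlog 0 0 a₀ b
  choose B6 h6 using fun b => hlog 0 0 b a₀
  have hsub : {q : (ℝ × ℝ) × (S → ℝ) | (∀ a, tiltSum A q.1 q.2 a ≤ 1) ∧ q.2 a₀ = 0} ⊆
      (Set.Icc (-B2) B1 ×ˢ Set.Icc (-B4) B3) ×ˢ Set.univ.pi fun b => Set.Icc (-B6 b) (B5 b) := by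
    rintro ⟨s, h⟩ ⟨hK, h0⟩
    simp only at hK h0
    have e1 := h1 s h hK
    have e2 := h2 s h hK
    have e3 := h3 s h hK
    have e4 := h4 s h hK
    simp only [Int.cast_one, Int.cast_zero, Int.cast_neg, Int.reduceNeg] at e1 e2 e3 e4
    refine ⟨⟨⟨by linarith, by linarith⟩, ⟨by linarith, by linarith⟩⟩, fun b _ => ?_⟩
    have e5 := h5 b s h hK
    have e6 := h6 b s h hK
    simp only [Int.cast_zero, h0] at e5 e6
    exact ⟨by linarith, by linarith⟩
  refine IsCompact.of_isClosed_subset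
    ((isCompact_Icc.prod isCompact_Icc).prod (isCompact_univ_pi fun b => isCompact_Icc)) ?_ hsub
  have : {q : (ℝ × ℝ) × (S → ℝ) | (∀ a, tiltSum A q.1 q.2 a ≤ 1) ∧ q.2 a₀ = 0} =
      (⋂ a, {q | tiltSum A q.1 q.2 a ≤ 1}) ∩ {q | q.2 a₀ = 0} := by
    ext q; simp
  rw [this]
  exact (isClosed_iInter fun a => isClosed_le (continuous_tiltSum A a) continuous_const).inter
    (isClosed_eq (by fun_prop) continuous_const)

theorem Blocks.exists_extrema [Nonempty S] {A : ℤ → ℤ → Matrix S S ℝ} (hA : Blocks A)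
    (hne : ∃ s h, ∀ a, tiltSum A s h a ≤ 1) :
    (∃ s h, (∀ a, tiltSum A s h a ≤ 1) ∧ zMax A = Real.exp s.1 ∧
      ∀ s' h', (∀ a, tiltSum A s' h' a ≤ 1) → s'.1 ≤ s.1) ∧
    (∃ s h, (∀ a, tiltSum A s h a ≤ 1) ∧ zMin A = Real.exp s.1 ∧
      ∀ s' h', (∀ a, tiltSum A s' h' a ≤ 1) → s.1 ≤ s'.1) := by
  obtain ⟨a₀⟩ := ‹Nonempty S›
  have : Nonempty S := ⟨a₀⟩
  have hc := hA.isCompact_normalized a₀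
  have hnorm : ∀ s h, (∀ a, tiltSum A s h a ≤ 1) → (s, fun b => h b - h a₀) ∈
      {q : (ℝ × ℝ) × (S → ℝ) | (∀ a, tiltSum A q.1 q.2 a ≤ 1) ∧ q.2 a₀ = 0} := by
    intro s h hK
    refine ⟨fun a => ?_, sub_self _⟩
    simp only [tiltSum_sub_const]
    exact hK a
  obtain ⟨s₀, h₀, hK₀⟩ := hne
  have hne' := Set.nonempty_of_mem (hnorm s₀ h₀ hK₀)
  have hcont : ContinuousOn (fun q : (ℝ × ℝ) × (S → ℝ) => q.1.1)
      {q | (∀ a, tiltSum A q.1 q.2 a ≤ 1) ∧ q.2 a₀ = 0} := by fun_prop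
  obtain ⟨⟨s, h⟩, ⟨hK, -⟩, hmax⟩ := hc.exists_isMaxOn hne' hcont
  obtain ⟨⟨t, k⟩, ⟨hK', -⟩, hmin⟩ := hc.exists_isMinOn hne' hcont
  have hmax' : ∀ s' h', (∀ a, tiltSum A s' h' a ≤ 1) → s'.1 ≤ s.1 :=
    fun s' h' hh => hmax (hnorm s' h' hh)
  have hmin' : ∀ s' h', (∀ a, tiltSum A s' h' a ≤ 1) → t.1 ≤ s'.1 :=
    fun s' h' hh => hmin (hnorm s' h' hh)
  refine ⟨⟨s, h, hK, ?_, hmax'⟩, ⟨t, k, hK', ?_, hmin'⟩⟩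
  · suffices hg : IsGreatest (Prod.fst '' Gam A) s.1 by rw [zMax, hg.csSup_eq]
    refine ⟨⟨s, (hA.mem_Gam_iff s).2 ⟨h, hK⟩, rfl⟩, ?_⟩
    rintro _ ⟨s', hs', rfl⟩
    obtain ⟨h', hh'⟩ := (hA.mem_Gam_iff s').1 hs'
    exact hmax' s' h' hh'
  · suffices hg : IsLeast (Prod.fst '' Gam A) t.1 by rw [zMin, hg.csInf_eq]
    refine ⟨⟨t, (hA.mem_Gam_iff t).2 ⟨k, hK'⟩, rfl⟩, ?_⟩
    rintro _ ⟨s', hs', rfl⟩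
    obtain ⟨h', hh'⟩ := (hA.mem_Gam_iff s').1 hs'
    exact hmin' s' h' hh'

end Geometry

/-! ### Tilted drifts as outer normals of the feasible set -/

section Critical

variable {S : Type*} [Fintype S] [DecidableEq S]

/-- Mean drift in the direction `d` of the tilted chain with stationary measure `u exp h`. -/
noncomputable def tiltDrift (A : ℤ → ℤ → Matrix S S ℝ) (s : ℝ × ℝ) (h u : S → ℝ) (d : ℝ × ℝ) : ℝ :=
  ∑ a, u a * Real.exp (h a) * ∑ e ∈ edges, tilt A s h a e * (e.1 * d.1 + e.2.1 * d.2)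

theorem tiltDrift_eq (A : ℤ → ℤ → Matrix S S ℝ) (s : ℝ × ℝ) (h u : S → ℝ) (d : ℝ × ℝ) :
    tiltDrift A s h u d = d.1 * tiltDrift A s h u (1, 0) + d.2 * tiltDrift A s h u (0, 1) := by
  simp only [tiltDrift, Finset.mul_sum]
  simp only [← Finset.sum_add_distrib]
  refine Finset.sum_congr rfl fun a _ => Finset.sum_congr rfl fun e _ => ?_
  ring

theorem tiltDrift_eq_dotProduct (A : ℤ → ℤ → Matrix S S ℝ) (s : ℝ × ℝ) (h u : S → ℝ)
    (d : ℝ × ℝ) : tiltDrift A s h u d =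
      u ⬝ᵥ (Crw A (fun i j => i * d.1 + j * d.2) (Real.exp s.1) (Real.exp s.2) *ᵥ
        fun a => Real.exp (h a)) := by
  unfold tiltDrift dotProduct
  refine Finset.sum_congr rfl fun a _ => ?_
  have := sum_tilt_mul_mul A s h a (fun i j => i * d.1 + j * d.2) (fun _ => 1)
  simp only [mul_one] at this
  rw [this, mul_assoc, ← mul_assoc (Real.exp (h a)), ← Real.exp_add, add_neg_cancel, Real.exp_zero,
    one_mul]

theorem tilt_stationary {A : ℤ → ℤ → Matrix S S ℝ} {s : ℝ × ℝ} {h u : S → ℝ}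
    (hu : u ᵥ* Cr A (Real.exp s.1) (Real.exp s.2) = u) (F : S → ℝ) :
    ∑ a, u a * Real.exp (h a) * ∑ e ∈ edges, tilt A s h a e * F e.2.2
      = ∑ a, u a * Real.exp (h a) * F a := by
  have h1 : u ⬝ᵥ (Cr A (Real.exp s.1) (Real.exp s.2) *ᵥ fun b => Real.exp (h b) * F b)
      = u ⬝ᵥ fun b => Real.exp (h b) * F b := by rw [Matrix.dotProduct_mulVec, hu]
  simp only [dotProduct, ← mul_assoc] at h1
  rw [← h1]
  refine Finset.sum_congr rfl fun a _ => ?_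
  rw [sum_tilt_mul, mul_assoc, ← mul_assoc (Real.exp (h a)), ← Real.exp_add, add_neg_cancel,
    Real.exp_zero, one_mul]


/-- Instead of differentiating the Perron eigenvalue, `h` is moved together with `s`, with slope
`g`. The Poisson equation for `g` equalizes the derivatives of all tilted sums at their mean `c`,
the normalized drift, which is negative. -/
theorem Blocks.exists_strict [Nonempty S] {A : ℤ → ℤ → Matrix S S ℝ} (hA : Blocks A) {s : ℝ × ℝ}
    {h u : S → ℝ} (hK : ∀ a, tiltSum A s h a = 1) (hu0 : ∀ a, 0 < u a)
    (hu : u ᵥ* Cr A (Real.exp s.1) (Real.exp s.2) = u) {d : ℝ × ℝ}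
    (hd : tiltDrift A s h u d < 0) :
    ∃ τ : ℝ, 0 < τ ∧ ∃ h' : S → ℝ, ∀ a, tiltSum A (s + τ • d) h' a < 1 := by
  set M := Cr A (Real.exp s.1) (Real.exp s.2) with hM
  have hMy : M *ᵥ (fun a => Real.exp (h a)) = fun a => Real.exp (h a) := by
    ext a; rw [hM, mulVec_exp, hK, one_mul]
  set Z := ∑ a, u a * Real.exp (h a) with hZ
  have hZ0 : 0 < Z := by
    obtain ⟨a⟩ := ‹Nonempty S›
    exact Finset.sum_pos (fun a _ => mul_pos (hu0 a) (Real.exp_pos _)) ⟨a, Finset.mem_univ a⟩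
  set c := tiltDrift A s h u d / Z with hc
  have hc0 : c < 0 := div_neg_of_neg_of_pos hd hZ0
  set k : S → ℝ := fun a => ∑ e ∈ edges, tilt A s h a e * (e.1 * d.1 + e.2.1 * d.2) with hk
  have hD : u ⬝ᵥ (fun a => Real.exp (h a) * (c - k a)) = 0 := by
    have h1 : u ⬝ᵥ (fun a => Real.exp (h a) * (c - k a)) = c * Z - tiltDrift A s h u d := by
      rw [hZ, tiltDrift, dotProduct, Finset.mul_sum, ← Finset.sum_sub_distrib]
      refine Finset.sum_congr rfl fun a _ => ?_
      simp only [hk]; ring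
    rw [h1, hc, div_mul_cancel₀ _ hZ0.ne', sub_self]
  obtain ⟨g₁, hg₁⟩ := (hA.Cr_irr (Real.exp_pos s.1) (Real.exp_pos s.2)).exists_poisson
    (hA.Cr_nonneg (Real.exp_pos _) (Real.exp_pos _)) (fun a => Real.exp_pos (h a)) hMy hu0 hu hD
  set g : S → ℝ := fun a => Real.exp (-h a) * g₁ a with hg
  have hgb : (fun b => Real.exp (h b) * g b) = g₁ := by
    ext b
    rw [hg, ← mul_assoc, ← Real.exp_add, add_neg_cancel, Real.exp_zero, one_mul]
  have hder : ∀ a, HasDerivAt (fun τ : ℝ => tiltSum A (s + τ • d) (fun b => h b + τ * g b) a) c 0 := by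
    intro a
    have h1 : ∀ e ∈ edges, HasDerivAt (fun τ : ℝ => tilt A (s + τ • d) (fun b => h b + τ * g b) a e)
        (tilt A s h a e * (e.1 * d.1 + e.2.1 * d.2 + g e.2.2 - g a)) 0 := by
      intro e _
      have h2 : HasDerivAt (fun τ : ℝ => (e.1 : ℝ) * (s.1 + τ * d.1) + e.2.1 * (s.2 + τ * d.2)
          + (h e.2.2 + τ * g e.2.2) - (h a + τ * g a))
          ((e.1 : ℝ) * d.1 + e.2.1 * d.2 + g e.2.2 - g a) 0 := by
        have hl : ∀ p q : ℝ, HasDerivAt (fun τ : ℝ => p + τ * q) q 0 := fun p q => by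
          simpa using ((hasDerivAt_id (0 : ℝ)).mul_const q).const_add p
        exact ((((hl s.1 d.1).const_mul _).add ((hl s.2 d.2).const_mul _)).add
          (hl (h e.2.2) (g e.2.2))).sub (hl (h a) (g a))
      have h3 := (h2.exp).const_mul (A e.1 e.2.1 a e.2.2)
      simp only [zero_mul, add_zero] at h3
      rw [tilt, mul_assoc]
      exact h3
    have h4 := HasDerivAt.fun_sum h1
    have h5 : ∑ e ∈ edges, tilt A s h a e * (e.1 * d.1 + e.2.1 * d.2 + g e.2.2 - g a) = c := by
      have e1 : ∑ e ∈ edges, tilt A s h a e * (e.1 * d.1 + e.2.1 * d.2 + g e.2.2 - g a)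
          = k a + ∑ e ∈ edges, tilt A s h a e * g e.2.2 - tiltSum A s h a * g a := by
        simp only [hk, tiltSum, Finset.sum_mul, ← Finset.sum_add_distrib, ← Finset.sum_sub_distrib]
        exact Finset.sum_congr rfl fun e _ => by ring
      have e2 : (M *ᵥ g₁) a = g₁ a + Real.exp (h a) * (c - k a) := by
        have := congrFun hg₁ a
        simp only [Pi.sub_apply] at this
        linarith
      rw [e1, sum_tilt_mul, hgb, ← hM, e2, hK, mul_add, ← mul_assoc, ← Real.exp_add,
        neg_add_cancel, Real.exp_zero, hg]
      ring
    rw [h5] at h4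
    exact h4
  have hev : ∀ a, ∀ᶠ τ in 𝓝[>] (0 : ℝ),
      tiltSum A (s + τ • d) (fun b => h b + τ * g b) a < 1 := by
    intro a
    have h1 := (hasDerivAt_iff_tendsto_slope.1 (hder a)).mono_left
      (nhdsWithin_mono (0 : ℝ) (fun x (hx : (0 : ℝ) < x) => ne_of_gt hx))
    filter_upwards [h1.eventually_lt_const hc0, self_mem_nhdsWithin] with τ hτ hτ0
    rw [slope_def_field, div_neg_iff] at hτ
    have hτ0' : (0 : ℝ) < τ := hτ0
    rcases hτ with ⟨_, h2⟩ | ⟨h2, _⟩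
    · linarith
    · simp only [zero_smul, add_zero, zero_mul, hK] at h2
      linarith
  obtain ⟨τ, hτ, hτ0⟩ := ((eventually_all.2 hev).and self_mem_nhdsWithin).exists
  exact ⟨τ, hτ0, _, hτ⟩

theorem tilt_mul_exp (A : ℤ → ℤ → Matrix S S ℝ) (s s' : ℝ × ℝ) (h h' : S → ℝ) (a : S)
    (e : ℤ × ℤ × S) :
    tilt A s h a e * Real.exp (e.1 * (s' - s).1 + e.2.1 * (s' - s).2 + (h' - h) e.2.2 - (h' - h) a)
      = tilt A s' h' a e := by
  rw [tilt, tilt, mul_assoc, ← Real.exp_add]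
  congr 2
  simp only [Prod.fst_sub, Prod.snd_sub, Pi.sub_apply]
  ring

/-- The gap `exp x - 1 - x` is averaged over the stationary tilted chain; stationarity cancels the
terms in `h' - h`, so only the drift remains from the linear part. -/
theorem Blocks.sum_convexity_gap {A : ℤ → ℤ → Matrix S S ℝ} {s : ℝ × ℝ}
    {h u : S → ℝ} (hK : ∀ a, tiltSum A s h a = 1)
    (hu : u ᵥ* Cr A (Real.exp s.1) (Real.exp s.2) = u) (s' : ℝ × ℝ) (h' : S → ℝ) :
    ∑ a, u a * Real.exp (h a) * ∑ e ∈ edges, tilt A s h a e *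
      (Real.exp (e.1 * (s' - s).1 + e.2.1 * (s' - s).2 + (h' - h) e.2.2 - (h' - h) a) - 1 -
        (e.1 * (s' - s).1 + e.2.1 * (s' - s).2 + (h' - h) e.2.2 - (h' - h) a))
      = ∑ a, u a * Real.exp (h a) * (tiltSum A s' h' a - 1) - tiltDrift A s h u (s' - s) := by
  have h1 := tilt_stationary (h := h) hu (h' - h)
  have h2 : ∀ a, ∑ e ∈ edges, tilt A s h a e *
      (Real.exp (e.1 * (s' - s).1 + e.2.1 * (s' - s).2 + (h' - h) e.2.2 - (h' - h) a) - 1 -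
        (e.1 * (s' - s).1 + e.2.1 * (s' - s).2 + (h' - h) e.2.2 - (h' - h) a))
      = tiltSum A s' h' a - 1 - ∑ e ∈ edges, tilt A s h a e * (e.1 * (s' - s).1 + e.2.1 * (s' - s).2)
        - ∑ e ∈ edges, tilt A s h a e * (h' - h) e.2.2 + (h' - h) a := by
    intro a
    have h3 : (h' - h) a = ∑ e ∈ edges, tilt A s h a e * (h' - h) a := by
      rw [← Finset.sum_mul]; exact (by rw [← tiltSum, hK, one_mul])
    have h4 : (1 : ℝ) = ∑ e ∈ edges, tilt A s h a e := (hK a).symm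
    conv_rhs => rw [h4]
    rw [tiltSum]
    conv_rhs => rw [h3]
    simp only [← Finset.sum_add_distrib, ← Finset.sum_sub_distrib]
    refine Finset.sum_congr rfl fun e _ => ?_
    rw [← tilt_mul_exp A s s' h h' a e]
    ring
  simp only [h2, tiltDrift]
  have h5 : ∀ a, u a * Real.exp (h a) * (tiltSum A s' h' a - 1
        - ∑ e ∈ edges, tilt A s h a e * (e.1 * (s' - s).1 + e.2.1 * (s' - s).2)
        - ∑ e ∈ edges, tilt A s h a e * (h' - h) e.2.2 + (h' - h) a)
      = u a * Real.exp (h a) * (tiltSum A s' h' a - 1)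
        - u a * Real.exp (h a) * ∑ e ∈ edges, tilt A s h a e * (e.1 * (s' - s).1 + e.2.1 * (s' - s).2)
        - u a * Real.exp (h a) * ∑ e ∈ edges, tilt A s h a e * (h' - h) e.2.2
        + u a * Real.exp (h a) * (h' - h) a := fun a => by ring
  simp only [h5, Finset.sum_add_distrib, Finset.sum_sub_distrib, h1]
  ring

/-- The averaged convexity gap is nonnegative. In the case of equality each exponent along a
possible transition is zero; adding these up along paths from a phase to itself displaced by `(1,
0)` and by `(0, 1)` gives `s' = s`. -/
theorem Blocks.tiltDrift_nonpos [Nonempty S] {A : ℤ → ℤ → Matrix S S ℝ} (hA : Blocks A)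
    {s : ℝ × ℝ} {h u : S → ℝ} (hK : ∀ a, tiltSum A s h a = 1) (hu0 : ∀ a, 0 < u a)
    (hu : u ᵥ* Cr A (Real.exp s.1) (Real.exp s.2) = u) {s' : ℝ × ℝ} {h' : S → ℝ}
    (hK' : ∀ a, tiltSum A s' h' a ≤ 1) :
    tiltDrift A s h u (s' - s) ≤ 0 ∧ (tiltDrift A s h u (s' - s) = 0 → s' = s) := by
  have hgap := Blocks.sum_convexity_gap hK hu s' h'
  have hterm : ∀ a, ∀ e ∈ edges, 0 ≤ tilt A s h a e *
      (Real.exp (e.1 * (s' - s).1 + e.2.1 * (s' - s).2 + (h' - h) e.2.2 - (h' - h) a) - 1 -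
        (e.1 * (s' - s).1 + e.2.1 * (s' - s).2 + (h' - h) e.2.2 - (h' - h) a)) := fun a e he =>
    mul_nonneg (hA.tilt_nonneg s h a he) (by
      have := Real.add_one_le_exp
        ((e.1 : ℝ) * (s' - s).1 + e.2.1 * (s' - s).2 + (h' - h) e.2.2 - (h' - h) a)
      linarith)
  have hpos : ∀ a, 0 < u a * Real.exp (h a) := fun a => mul_pos (hu0 a) (Real.exp_pos _)
  have hnn := Finset.sum_nonneg fun a (_ : a ∈ Finset.univ) =>
    mul_nonneg (hpos a).le (Finset.sum_nonneg (hterm a))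
  have hle : ∑ a, u a * Real.exp (h a) * (tiltSum A s' h' a - 1) ≤ 0 :=
    Finset.sum_nonpos fun a _ => mul_nonpos_of_nonneg_of_nonpos (hpos a).le (by linarith [hK' a])
  refine ⟨by linarith, fun h0 => ?_⟩
  have hz : ∑ a, u a * Real.exp (h a) * ∑ e ∈ edges, tilt A s h a e *
      (Real.exp (e.1 * (s' - s).1 + e.2.1 * (s' - s).2 + (h' - h) e.2.2 - (h' - h) a) - 1 -
        (e.1 * (s' - s).1 + e.2.1 * (s' - s).2 + (h' - h) e.2.2 - (h' - h) a)) = 0 :=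
    le_antisymm (by linarith) hnn
  have hcoc : ∀ a i j b, i ∈ H → j ∈ H → 0 < A i j a b →
      (i : ℝ) * (s' - s).1 + j * (s' - s).2 + (h' - h) b - (h' - h) a = 0 := by
    intro a i j b hi hj hAp
    have h1 := (mul_eq_zero.1 ((Finset.sum_eq_zero_iff_of_nonneg fun a _ =>
      mul_nonneg (hpos a).le (Finset.sum_nonneg (hterm a))).1 hz a (Finset.mem_univ a))).resolve_left
        (hpos a).ne'
    have h2 := (Finset.sum_eq_zero_iff_of_nonneg (hterm a)).1 h1 (i, j, b) (mem_edges.2 ⟨hi, hj⟩)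
    have h3 := (mul_eq_zero.1 h2).resolve_left (mul_pos hAp (Real.exp_pos _)).ne'
    by_contra hne
    have := Real.add_one_lt_exp hne
    simp only at h3
    linarith
  obtain ⟨a₀⟩ := ‹Nonempty S›
  have hall := hA.induction (fun m n b => (m : ℝ) * (s' - s).1 + n * (s' - s).2 + (h' - h) b
    - (h' - h) a₀ = 0) 0 0 a₀ (by simp) (by
      intro m n a i j b hi hj hAp hQ
      have := hcoc a i j b hi hj hAp
      push_cast
      linarith)
  have h10 := hall 1 0 a₀
  have h01 := hall 0 1 a₀
  simp only [Int.cast_one, Int.cast_zero, Prod.fst_sub, Prod.snd_sub] at h10 h01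
  exact Prod.ext (by linarith) (by linarith)

end Critical

/-! ### The rightmost point of the feasible set -/

section CriticalPoint

variable {S : Type*} [Fintype S] [DecidableEq S]

theorem tiltSum_log (A : ℤ → ℤ → Matrix S S ℝ) {x w : ℝ} (hx : 0 < x) (hw : 0 < w) {y : S → ℝ}
    (hy : ∀ a, 0 < y a) (a : S) :
    tiltSum A (Real.log x, Real.log w) (fun b => Real.log (y b)) a = (Cr A x w *ᵥ y) a / y a := by
  have := mulVec_exp A (Real.log x, Real.log w) (fun b => Real.log (y b)) a
  simp only [Real.exp_log hx, Real.exp_log hw, Real.exp_log (hy _)] at this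
  rw [eq_div_iff (hy a).ne', ← this]

/-- Pairing with the positive left Perron vector turns one strict inequality into a Perron
eigenvalue below one; with the right Perron vector all tilted sums equal that eigenvalue. -/
theorem Blocks.exists_strict_of_lt [Nonempty S] {A : ℤ → ℤ → Matrix S S ℝ} (hA : Blocks A)
    {s : ℝ × ℝ} {h : S → ℝ} (hK : ∀ a, tiltSum A s h a ≤ 1) (hlt : ∃ a, tiltSum A s h a < 1) :
    ∃ h', ∀ a, tiltSum A s h' a < 1 := by
  set M := Cr A (Real.exp s.1) (Real.exp s.2) with hM
  have hirr := hA.Cr_irr (Real.exp_pos s.1) (Real.exp_pos s.2)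
  have hnn := hA.Cr_nonneg (Real.exp_pos s.1) (Real.exp_pos s.2)
  obtain ⟨ρ, hρ, y, hy, hMy⟩ := hirr.exists_perron hnn
  obtain ⟨ρ', hρ', u, hu, hMu⟩ := hirr.transpose.exists_perron fun a b => hnn b a
  rw [Matrix.mulVec_transpose] at hMu
  obtain ⟨a₁, ha₁⟩ := hlt
  have hpos : ∀ z : S → ℝ, (∀ a, 0 < z a) → 0 < u ⬝ᵥ z := fun z hz =>
    Finset.sum_pos (fun a _ => mul_pos (hu a) (hz a)) ⟨a₁, Finset.mem_univ _⟩
  have hρρ : ρ = ρ' := by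
    have h1 : u ⬝ᵥ (M *ᵥ y) = (u ᵥ* M) ⬝ᵥ y := Matrix.dotProduct_mulVec u M y
    rw [hMy, hMu, dotProduct_smul, smul_dotProduct, smul_eq_mul, smul_eq_mul] at h1
    exact mul_right_cancel₀ (hpos y hy).ne' h1
  have hρ1 : ρ < 1 := by
    have h1 : u ⬝ᵥ (M *ᵥ fun a => Real.exp (h a)) = (u ᵥ* M) ⬝ᵥ fun a => Real.exp (h a) :=
      Matrix.dotProduct_mulVec u M _
    rw [hMu, smul_dotProduct, smul_eq_mul, ← hρρ] at h1
    have h2 : u ⬝ᵥ (M *ᵥ fun a => Real.exp (h a)) < u ⬝ᵥ fun a => Real.exp (h a) := by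
      refine Finset.sum_lt_sum (fun a _ => mul_le_mul_of_nonneg_left ?_ (hu a).le)
        ⟨a₁, Finset.mem_univ _, mul_lt_mul_of_pos_left ?_ (hu a₁)⟩
      · rw [hM, mulVec_exp]
        exact mul_le_of_le_one_left (Real.exp_pos _).le (hK a)
      · rw [hM, mulVec_exp]
        exact mul_lt_of_lt_one_left (Real.exp_pos _) ha₁
    rw [h1] at h2
    by_contra hge
    have := mul_le_mul_of_nonneg_right (not_lt.1 hge)
      (hpos (fun a => Real.exp (h a)) fun a => Real.exp_pos _).le
    linarith
  refine ⟨fun a => Real.log (y a), fun a => ?_⟩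
  have := mulVec_exp A s (fun b => Real.log (y b)) a
  simp only [Real.exp_log (hy _)] at this
  rw [← hM, show (fun b => y b) = y from rfl, hMy] at this
  rwa [← mul_right_cancel₀ (hy a).ne' this]

theorem not_strict_of_max [Nonempty S] {A : ℤ → ℤ → Matrix S S ℝ} {s : ℝ × ℝ}
    (hmax : ∀ s' h', (∀ a, tiltSum A s' h' a ≤ 1) → s'.1 ≤ s.1) {s' : ℝ × ℝ} (hs : s'.1 = s.1)
    (h' : S → ℝ) : ¬ ∀ a, tiltSum A s' h' a < 1 := by
  intro hlt
  have hev : ∀ᶠ t in 𝓝 s'.1, ∀ a, tiltSum A (t, s'.2) h' a < 1 := by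
    refine eventually_all.2 fun a => ?_
    have hc : Continuous fun t : ℝ => tiltSum A (t, s'.2) h' a :=
      (continuous_tiltSum A a).comp (f := fun t : ℝ => ((t, s'.2), h')) (by fun_prop)
    exact hc.continuousAt.eventually_lt continuousAt_const (hlt a)
  have h2 := (hev.filter_mono (nhdsWithin_le_nhds (s := Set.Ioi s'.1))).and self_mem_nhdsWithin
  obtain ⟨t, ht, ht'⟩ := h2.exists
  have : t ≤ s.1 := hmax (t, s'.2) h' fun a => (ht a).le
  have ht' : s'.1 < t := ht'
  linarith

/-- The data attached to the point of `Gam A` with the largest first coordinate: `w` is the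
second coordinate (exponentiated), `y` and `u` are the Perron vectors of `C(zMax A, w)`, and `g`
solves the Poisson equation for the second component of the drift. -/
structure Critical (A : ℤ → ℤ → Matrix S S ℝ) (w : ℝ) (y u g : S → ℝ) : Prop where
  w_pos : 0 < w
  y_pos : ∀ a, 0 < y a
  u_pos : ∀ a, 0 < u a
  right : Cr A (zMax A) w *ᵥ y = y
  left : u ᵥ* Cr A (zMax A) w = u
  poisson : Cr A (zMax A) w *ᵥ g - g = -(Crw A (fun _ j => j) (zMax A) w *ᵥ y)
  drift_pos : 0 < u ⬝ᵥ (Crw A (fun i _ => i) (zMax A) w *ᵥ y)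
  zetaLow_eq : zetaLow A (zMax A) = w
  zetaHigh_eq : zetaHigh A (zMax A) = w
  zMin_lt : zMin A < zMax A
  superharmonic_zMin : ∃ (w' : ℝ) (y' : S → ℝ), 0 < w' ∧ (∀ a, 0 < y' a) ∧
    ∀ a, (Cr A (zMin A) w' *ᵥ y') a ≤ y' a
  superharmonic_near : ∃ L : ℝ, ∀ᶠ x in 𝓝[≤] zMax A, ∃ (w' : ℝ) (y' : S → ℝ), 0 < w' ∧
    (∀ a, 0 < y' a) ∧ (∀ a, (Cr A x w' *ᵥ y') a ≤ y' a) ∧ w' ≤ w + L * (zMax A - x)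

theorem Cr_one_one (A : ℤ → ℤ → Matrix S S ℝ) : Cr A 1 1 = Atot A := by
  simp only [Cr, Atot, one_zpow, mul_one, one_smul]
  exact Finset.sum_comm

theorem drift₁_eq (A : ℤ → ℤ → Matrix S S ℝ) (p : S → ℝ) :
    drift₁ A p = tiltDrift A 0 0 p (1, 0) := by
  rw [tiltDrift_eq_dotProduct, drift₁]
  simp [Crw, H, Matrix.add_mulVec, Matrix.neg_mulVec]
  ring_nf

theorem drift₂_eq (A : ℤ → ℤ → Matrix S S ℝ) (p : S → ℝ) :
    drift₂ A p = tiltDrift A 0 0 p (0, 1) := by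
  rw [tiltDrift_eq_dotProduct, drift₂]
  simp [Crw, H, Matrix.add_mulVec, Matrix.neg_mulVec]
  ring_nf

theorem Blocks.superharmonic_of_tiltSum_le {A : ℤ → ℤ → Matrix S S ℝ} {s : ℝ × ℝ} {h : S → ℝ}
    (hK : ∀ a, tiltSum A s h a ≤ 1) (a : S) :
    (Cr A (Real.exp s.1) (Real.exp s.2) *ᵥ fun b => Real.exp (h b)) a ≤ Real.exp (h a) := by
  rw [mulVec_exp]
  exact mul_le_of_le_one_left (Real.exp_pos _).le (hK a)

theorem Blocks.tiltSum_convex {A : ℤ → ℤ → Matrix S S ℝ} (hA : Blocks A) {s s' : ℝ × ℝ}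
    {h h' : S → ℝ} (hK : ∀ a, tiltSum A s h a ≤ 1) (hK' : ∀ a, tiltSum A s' h' a ≤ 1) {θ : ℝ}
    (h0 : 0 ≤ θ) (h1 : θ ≤ 1) (a : S) :
    tiltSum A ((1 - θ) • s + θ • s') ((1 - θ) • h + θ • h') a ≤ 1 := by
  calc tiltSum A ((1 - θ) • s + θ • s') ((1 - θ) • h + θ • h') a
      ≤ ∑ e ∈ edges, ((1 - θ) * tilt A s h a e + θ * tilt A s' h' a e) := by
        refine Finset.sum_le_sum fun e he => ?_
        have hc := convexOn_exp.2 (Set.mem_univ (e.1 * s.1 + e.2.1 * s.2 + h e.2.2 - h a))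
          (Set.mem_univ (e.1 * s'.1 + e.2.1 * s'.2 + h' e.2.2 - h' a))
          (sub_nonneg.2 h1) h0 (by ring)
        simp only [smul_eq_mul] at hc
        have hAe := hA.nonneg _ (mem_edges.1 he).1 _ (mem_edges.1 he).2 a e.2.2
        have := mul_le_mul_of_nonneg_left hc hAe
        simp only [tilt]
        refine le_trans (le_of_eq ?_) (this.trans (le_of_eq ?_))
        · congr 2
          simp only [Prod.fst_add, Prod.snd_add, Prod.smul_fst, Prod.smul_snd, Pi.add_apply,
            Pi.smul_apply, smul_eq_mul]
          ring
        · ring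
    _ = (1 - θ) * tiltSum A s h a + θ * tiltSum A s' h' a := by
        rw [Finset.sum_add_distrib, ← Finset.mul_sum, ← Finset.mul_sum]; rfl
    _ ≤ (1 - θ) * 1 + θ * 1 := add_le_add (mul_le_mul_of_nonneg_left (hK a) (sub_nonneg.2 h1))
        (mul_le_mul_of_nonneg_left (hK' a) h0)
    _ = 1 := by ring

/-- The points come from the chord to a feasible point further left: `θ` is chosen so that the first
coordinate is `log x`, and it is at most linear in `exp s.1 - x`. This one-sided bound later gives
the sign of the Puiseux coefficient. -/
theorem Blocks.superharmonic_near {A : ℤ → ℤ → Matrix S S ℝ} (hA : Blocks A) {s s' : ℝ × ℝ}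
    {h h' : S → ℝ} (hK : ∀ a, tiltSum A s h a ≤ 1) (hK' : ∀ a, tiltSum A s' h' a ≤ 1)
    (hlt : s'.1 < s.1) :
    ∃ L : ℝ, ∀ᶠ x in 𝓝[≤] Real.exp s.1, ∃ (w' : ℝ) (y' : S → ℝ), 0 < w' ∧
    (∀ a, 0 < y' a) ∧ (∀ a, (Cr A x w' *ᵥ y') a ≤ y' a) ∧
      w' ≤ Real.exp s.2 + L * (Real.exp s.1 - x) := by
  refine ⟨Real.exp s'.2 / (Real.exp s'.1 * (s.1 - s'.1)), ?_⟩
  have hd : 0 < s.1 - s'.1 := sub_pos.2 hlt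
  have hev : ∀ᶠ x in 𝓝[≤] Real.exp s.1, Real.exp s'.1 < x :=
    nhdsWithin_le_nhds (lt_mem_nhds (Real.exp_lt_exp.2 hlt))
  filter_upwards [hev, self_mem_nhdsWithin] with x hx hx'
  simp only [Set.mem_Iic] at hx'
  have hx0 : 0 < x := (Real.exp_pos _).trans hx
  have hlx : Real.log x ≤ s.1 := (Real.log_le_iff_le_exp hx0).2 hx'
  have hlx' : s'.1 ≤ Real.log x := (Real.le_log_iff_exp_le hx0).2 hx.le
  set θ := (s.1 - Real.log x) / (s.1 - s'.1) with hθ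
  have h0 : 0 ≤ θ := div_nonneg (by linarith) hd.le
  have h1 : θ ≤ 1 := (div_le_one hd).2 (by linarith)
  have hKθ := hA.tiltSum_convex hK hK' h0 h1
  have hx1 : ((1 - θ) • s + θ • s').1 = Real.log x := by
    simp only [Prod.fst_add, Prod.smul_fst, smul_eq_mul, hθ]
    field_simp
    ring
  have hsup := Blocks.superharmonic_of_tiltSum_le hKθ
  rw [hx1, Real.exp_log hx0] at hsup
  refine ⟨_, _, Real.exp_pos _, fun a => Real.exp_pos _, hsup, ?_⟩
  have hc := convexOn_exp.2 (Set.mem_univ s.2) (Set.mem_univ s'.2) (sub_nonneg.2 h1) h0 (by ring)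
  simp only [smul_eq_mul] at hc
  simp only [Prod.snd_add, Prod.smul_snd, smul_eq_mul]
  refine hc.trans ?_
  have h2 : θ ≤ (Real.exp s.1 - x) / (Real.exp s'.1 * (s.1 - s'.1)) := by
    rw [hθ, ← div_div]
    refine div_le_div_of_nonneg_right ?_ hd.le
    have h3 : s.1 - Real.log x ≤ Real.exp s.1 / x - 1 := by
      have := Real.add_one_le_exp (s.1 - Real.log x)
      rw [Real.exp_sub, Real.exp_log hx0] at this
      linarith
    refine h3.trans ?_
    rw [div_sub_one hx0.ne']
    exact div_le_div_of_nonneg_left (by linarith) (Real.exp_pos _) hx.le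
  have h3 : Real.exp s'.2 * θ ≤ Real.exp s'.2 / (Real.exp s'.1 * (s.1 - s'.1)) * (Real.exp s.1 - x) := by
    have := mul_le_mul_of_nonneg_left h2 (Real.exp_pos s'.2).le
    refine this.trans (le_of_eq ?_)
    ring
  nlinarith [mul_nonneg h0 (Real.exp_pos s.2).le]

/-- No point on the vertical line through the rightmost point is strictly feasible. Hence all tilted
sums there equal one, and the vertical drift is zero, as a drift of either sign would allow a
strictly feasible vertical move. -/
theorem Blocks.exists_critical [Nonempty S] {A : ℤ → ℤ → Matrix S S ℝ} (hA : Blocks A)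
    (hstoch : ∀ a, ∑ b, Atot A a b = 1) {p : S → ℝ} (hp : IsStationaryDist (Atot A) p)
    (hdrift : drift₁ A p < 0 ∨ drift₂ A p < 0) :
    ∃ (w : ℝ) (y u g : S → ℝ), Critical A w y u g := by
  have hC0 : Cr A (Real.exp (0 : ℝ × ℝ).1) (Real.exp (0 : ℝ × ℝ).2) = Atot A := by
    simp [Cr_one_one]
  have hK0 : ∀ a, tiltSum A 0 0 a = 1 := fun a => by
    rw [tiltSum_eq, hC0]
    simp [Matrix.mulVec, dotProduct, hstoch]
  have hp0 : ∀ a, 0 < p a := by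
    have hirr := (hA.Cr_irr (Real.exp_pos (0 : ℝ × ℝ).1) (Real.exp_pos (0 : ℝ × ℝ).2)).transpose
    refine hirr.pos_of_mulVec_le
      (fun a b => hA.Cr_nonneg (Real.exp_pos _) (Real.exp_pos _) b a) hp.1 ?_ (c := 1) ?_
    · by_contra hcon
      push Not at hcon
      have := Finset.sum_nonpos fun a (_ : a ∈ Finset.univ) => hcon a
      linarith [hp.2.1]
    · intro a
      rw [Matrix.mulVec_transpose, hC0, hp.2.2, one_mul]
  have hd : ∃ d : ℝ × ℝ, tiltDrift A 0 0 p d < 0 := by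
    rcases hdrift with h | h
    · exact ⟨(1, 0), by rwa [← drift₁_eq]⟩
    · exact ⟨(0, 1), by rwa [← drift₂_eq]⟩
  obtain ⟨d, hd⟩ := hd
  -- At the origin the chain is stochastic, so all tilted sums are one and the assumed negative
  -- drift gives a strictly feasible point.
  obtain ⟨τ, -, h₀, hK₀⟩ := hA.exists_strict hK0 hp0 (by rw [hC0, hp.2.2]) hd
  set s₀ := (0 : ℝ × ℝ) + τ • d
  obtain ⟨⟨s, h, hK, hzM, hmax⟩, ⟨t, k, hKt, hzm, hmin⟩⟩ :=
    hA.exists_extrema ⟨s₀, h₀, fun a => (hK₀ a).le⟩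
  have hns : ∀ {s' : ℝ × ℝ}, s'.1 = s.1 → ∀ h', ¬ ∀ a, tiltSum A s' h' a < 1 :=
    fun hs h' => not_strict_of_max hmax hs h'
  have hK1 : ∀ a, tiltSum A s h a = 1 := by
    intro a
    by_contra hne
    obtain ⟨h', hh'⟩ := hA.exists_strict_of_lt hK ⟨a, lt_of_le_of_ne (hK a) hne⟩
    exact hns rfl h' hh'
  have hirr := hA.Cr_irr (Real.exp_pos s.1) (Real.exp_pos s.2)
  have hnn := hA.Cr_nonneg (Real.exp_pos s.1) (Real.exp_pos s.2)
  have hMy : Cr A (Real.exp s.1) (Real.exp s.2) *ᵥ (fun a => Real.exp (h a))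
      = fun a => Real.exp (h a) := by
    ext a; rw [mulVec_exp, hK1, one_mul]
  obtain ⟨u, hu0, hu⟩ := hirr.exists_left_fixed hnn (fun a => Real.exp_pos _) hMy
  have hm2 : tiltDrift A s h u (0, 1) = 0 := by
    by_contra hne
    rcases lt_or_gt_of_ne hne with hlt | hgt
    · obtain ⟨τ, -, h', hh'⟩ := hA.exists_strict hK1 hu0 hu hlt
      exact hns (by simp) h' hh'
    · have : tiltDrift A s h u (0, -1) < 0 := by
        rw [tiltDrift_eq]; simpa using hgt
      obtain ⟨τ, -, h', hh'⟩ := hA.exists_strict hK1 hu0 hu this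
      exact hns (by simp) h' hh'
  have hs₀ : s₀.1 ≤ s.1 := hmax s₀ h₀ fun a => (hK₀ a).le
  have hs₀' : s₀.1 < s.1 := lt_of_le_of_ne hs₀ fun he => hns he h₀ hK₀
  -- The drift towards the strictly feasible `s₀` is negative; since the vertical drift is zero,
  -- only the horizontal part counts, and `s₀` lies to the left.
  have hm1 : 0 < tiltDrift A s h u (1, 0) := by
    obtain ⟨h1, h2⟩ := hA.tiltDrift_nonpos hK1 hu0 hu fun a => (hK₀ a).le
    have h3 : tiltDrift A s h u (s₀ - s) < 0 :=
      lt_of_le_of_ne h1 fun he => hs₀'.ne (by rw [h2 he])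
    rw [tiltDrift_eq, hm2, mul_zero, add_zero, Prod.fst_sub] at h3
    exact (pos_iff_pos_of_mul_pos (by nlinarith : 0 < (s.1 - s₀.1) * tiltDrift A s h u (1, 0))).1
      (sub_pos.2 hs₀')
  have hm1' := hm1
  have hm2' := hm2
  rw [tiltDrift_eq_dotProduct] at hm1' hm2'
  simp only [mul_one, mul_zero, add_zero, zero_add] at hm1' hm2'
  -- Another root would be a vertical displacement, along which the drift is zero: the equality case
  -- of `Blocks.tiltDrift_nonpos` excludes it.
  have hzeta : {w : ℝ | 0 < w ∧ chi A (zMax A) w = 1} = {Real.exp s.2} := by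
    rw [hzM]
    ext w
    simp only [Set.mem_ofPred_eq, Set.mem_singleton_iff]
    constructor
    · rintro ⟨hw, hchi⟩
      obtain ⟨y, hy, hyw⟩ := (hA.chi_eq_one_iff (Real.exp_pos _) hw).1 hchi
      have hK' : ∀ a, tiltSum A (s.1, Real.log w) (fun b => Real.log (y b)) a ≤ 1 := fun a => by
        have := tiltSum_log A (Real.exp_pos s.1) hw hy a
        rw [Real.log_exp, hyw, div_self (hy a).ne'] at this
        exact this.le
      obtain ⟨-, h2⟩ := hA.tiltDrift_nonpos hK1 hu0 hu hK'
      have h3 := h2 (by rw [tiltDrift_eq, hm2]; simp)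
      rw [← h3, Real.exp_log hw]
    · rintro rfl
      exact ⟨Real.exp_pos _, (hA.chi_eq_one_iff (Real.exp_pos _) (Real.exp_pos _)).2
        ⟨_, fun a => Real.exp_pos _, hMy⟩⟩
  obtain ⟨g, hg⟩ := hirr.exists_poisson hnn (fun a => Real.exp_pos _) hMy hu0 hu
    (D := -(Crw A (fun _ j => (j : ℝ)) (Real.exp s.1) (Real.exp s.2) *ᵥ fun a => Real.exp (h a)))
    (by rw [dotProduct_neg, hm2', neg_zero])
  refine ⟨Real.exp s.2, fun a => Real.exp (h a), u, g, ?_⟩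
  exact
    { w_pos := Real.exp_pos _
      y_pos := fun a => Real.exp_pos _
      u_pos := hu0
      right := by rw [hzM]; exact hMy
      left := by rw [hzM]; exact hu
      poisson := by rw [hzM]; exact hg
      drift_pos := by rw [hzM]; exact hm1'
      zetaLow_eq := by rw [zetaLow, hzeta, csInf_singleton]
      zetaHigh_eq := by rw [zetaHigh, hzeta, csSup_singleton]
      zMin_lt := by
        rw [hzm, hzM, Real.exp_lt_exp]
        exact (hmin s₀ h₀ fun a => (hK₀ a).le).trans_lt hs₀'
      superharmonic_zMin := by
        rw [hzm]
        exact ⟨_, _, Real.exp_pos _, fun a => Real.exp_pos _,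
          Blocks.superharmonic_of_tiltSum_le hKt⟩
      superharmonic_near := by
        rw [hzM]
        exact hA.superharmonic_near hK (fun a => (hK₀ a).le) hs₀' }

end CriticalPoint

/-! ### Words as paths on the nonnegative levels -/

section Levels

variable {R : Type*} [Ring R]

/-- Sum over the words of length `n` which lead from level `j` to level `k` without leaving the
nonnegative levels, the letter `i` having weight `B i`. -/
def levelSum (B : ℤ → R) : ℕ → ℕ → ℕ → R
  | 0, j, k => if j = k then 1 else 0
  | n + 1, 0, k => B 0 * levelSum B n 0 k + B 1 * levelSum B n 1 k
  | n + 1, j + 1, k => B 0 * levelSum B n (j + 1) k + B 1 * levelSum B n (j + 2) k +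
      B (-1) * levelSum B n j k

theorem levelSum_succ_left_zero (B : ℤ → R) (n k : ℕ) :
    levelSum B (n + 1) 0 k = B 0 * levelSum B n 0 k + B 1 * levelSum B n 1 k := rfl

theorem levelSum_succ_left_succ (B : ℤ → R) (n j k : ℕ) :
    levelSum B (n + 1) (j + 1) k = B 0 * levelSum B n (j + 1) k + B 1 * levelSum B n (j + 2) k +
      B (-1) * levelSum B n j k := rfl

theorem levelSum_succ_right (B : ℤ → R) (n j k : ℕ) :
    levelSum B (n + 1) j k = levelSum B n j k * B 0 + levelSum B n j (k + 1) * B (-1) +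
      if k = 0 then 0 else levelSum B n j (k - 1) * B 1 := by
  induction n generalizing j with
  | zero =>
    rcases j with _ | j <;> rcases k with _ | k <;> simp [levelSum] <;>
      (try split_ifs) <;> simp_all <;> omega
  | succ n ih =>
    rcases j with _ | j
    · conv_lhs => rw [levelSum_succ_left_zero B (n + 1) k, ih, ih]
      simp only [levelSum_succ_left_zero B n]
      split_ifs <;> noncomm_ring
    · conv_lhs => rw [levelSum_succ_left_succ B (n + 1), ih, ih, ih]
      simp only [levelSum_succ_left_succ B n]
      split_ifs <;> noncomm_ring

/-- Cut at the first arrival at level 0. Until the step before it the path stays at levels at least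
one, so after a shift by one it runs from `j` to 0. This convolution is the source of the quadratic
equation. -/
theorem levelSum_succ_zero (B : ℤ → R) (n j : ℕ) :
    levelSum B (n + 1) (j + 1) 0 =
      ∑ q ∈ Finset.HasAntidiagonal.antidiagonal n, levelSum B q.1 j 0 * B (-1) * levelSum B q.2 0 0 := by
  induction n generalizing j with
  | zero =>
    rcases j with _ | j <;> simp [levelSum]
  | succ n ih =>
    rw [levelSum, ih, ih, Finset.Nat.sum_antidiagonal_succ]
    rcases j with _ | j
    · simp only [levelSum, if_true, one_mul, add_mul, Finset.sum_add_distrib, Finset.mul_sum,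
        mul_assoc]
      abel
    · rw [ih]
      simp only [levelSum, Nat.add_eq_zero_iff, one_ne_zero, and_false, if_false, zero_mul,
        zero_add, add_mul, Finset.sum_add_distrib, Finset.mul_sum, mul_assoc]

theorem map_levelSum {R' : Type*} [Ring R'] (f : R →+* R') (B : ℤ → R) (n j k : ℕ) :
    f (levelSum B n j k) = levelSum (fun i => f (B i)) n j k := by
  induction n generalizing j with
  | zero => simp only [levelSum]; split_ifs <;> simp
  | succ n ih => rcases j with _ | j <;> simp [levelSum, ih]

end Levels

/-! ### The index sets of N₁, G₁ and R₁ in terms of levels -/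

section Words

variable {S : Type*} [Fintype S] [DecidableEq S]

theorem psum_zero {n : ℕ} (i : Fin n → ℤ) : psum i 0 = 0 := by simp [psum]

theorem psum_cons_succ {n : ℕ} (h : ℤ) (i : Fin n → ℤ) (k : ℕ) :
    psum (Fin.cons h i : Fin (n + 1) → ℤ) (k + 1) = h + psum i k := by
  simp [psum, Finset.sum_filter, Fin.sum_univ_succ]

theorem psum_of_le {n : ℕ} (i : Fin n → ℤ) {k : ℕ} (hk : n ≤ k) : psum i k = ∑ l, i l := by
  unfold psum
  rw [Finset.filter_true_of_mem]
  exact fun l _ => l.2.trans_le hk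

theorem wordProd_cons (A : ℤ → ℤ → Matrix S S ℝ) (z : ℂ) {n : ℕ} (h : ℤ) (i : Fin n → ℤ) :
    wordProd A z (Fin.cons h i : Fin (n + 1) → ℤ) = Acol A h z * wordProd A z i := by
  simp [wordProd, List.ofFn_succ]

open scoped Classical in
/-- Sum of `wordProd` over the words satisfying `P`. -/
noncomputable def wordSum (A : ℤ → ℤ → Matrix S S ℝ) (z : ℂ) (n : ℕ) (P : (Fin n → ℤ) → Prop) :
    Matrix S S ℂ :=
  ∑ i ∈ (Fintype.piFinset fun _ : Fin n => H) with P i, wordProd A z i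

theorem wordSum_congr (A : ℤ → ℤ → Matrix S S ℝ) (z : ℂ) {n : ℕ} {P Q : (Fin n → ℤ) → Prop}
    (h : ∀ i, P i ↔ Q i) : wordSum A z n P = wordSum A z n Q := by
  rw [show P = Q from funext fun i => propext (h i)]

theorem wordSum_false (A : ℤ → ℤ → Matrix S S ℝ) (z : ℂ) {n : ℕ} {P : (Fin n → ℤ) → Prop}
    (h : ∀ i, ¬ P i) : wordSum A z n P = 0 := by
  simp [wordSum, h]

theorem wordSum_zero (A : ℤ → ℤ → Matrix S S ℝ) (z : ℂ) (P : (Fin 0 → ℤ) → Prop) [Decidable (P default)] :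
    wordSum A z 0 P = if P default then 1 else 0 := by
  classical
  simp only [wordSum, Finset.sum_filter]
  rw [Fintype.piFinset_of_isEmpty, Finset.univ_unique, Finset.sum_singleton]
  by_cases hP : P default
  · rw [if_pos hP]
    exact (if_pos (by convert hP)).trans (by simp [wordProd])
  · rw [if_neg hP]
    exact if_neg fun h => hP (by convert h)

theorem wordSum_succ (A : ℤ → ℤ → Matrix S S ℝ) (z : ℂ) (n : ℕ) (P : (Fin (n + 1) → ℤ) → Prop) :
    wordSum A z (n + 1) P = ∑ h ∈ H, Acol A h z * wordSum A z n fun i => P (Fin.cons h i) := by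
  classical
  simp only [wordSum, Finset.mul_sum, Finset.sum_filter]
  rw [← Finset.sum_product']
  refine Finset.sum_nbij' (fun f => (f 0, Fin.tail f)) (fun q => Fin.cons q.1 q.2) ?_ ?_ ?_ ?_ ?_
  · intro f hf
    simp only [Fintype.mem_piFinset, Finset.mem_product] at hf ⊢
    exact ⟨hf 0, fun a => hf a.succ⟩
  · intro q hq
    simp only [Fintype.mem_piFinset, Finset.mem_product] at hq ⊢
    intro a
    refine Fin.cases ?_ (fun a => ?_) a
    · simpa using hq.1
    · simpa using hq.2 a
  · intro f _; simp
  · intro q _; simp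
  · intro f _
    simp only [Fin.cons_self_tail]
    split_ifs
    · rw [← wordProd_cons, Fin.cons_self_tail]
    · rw [mul_zero]

theorem sum_H {M : Type*} [AddCommMonoid M] (f : ℤ → M) : ∑ i ∈ H, f i = f (-1) + f 0 + f 1 := by
  simp [H, Finset.sum_insert, add_assoc]

/-- The constraint may be imposed for all `m`, because `psum` is constant from `n` on; this is what
makes the induction on the first letter uniform in `n`. -/
theorem wordSum_eq_levelSum (A : ℤ → ℤ → Matrix S S ℝ) (z : ℂ) (n j k : ℕ) :
    wordSum A z n (fun i => (∀ m, 0 ≤ (j : ℤ) + psum i m) ∧ (j : ℤ) + ∑ l, i l = k) =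
      levelSum (fun i => Acol A i z) n j k := by
  classical
  induction n generalizing j with
  | zero =>
    rw [wordSum_zero, levelSum]
    simp only [psum, Finset.univ_eq_empty, Finset.filter_empty, Finset.sum_empty, add_zero,
      Nat.cast_nonneg, implies_true, true_and, Nat.cast_inj]
  | succ n ih =>
    have key : ∀ h : ℤ, wordSum A z n (fun i => (∀ m, 0 ≤ (j : ℤ) +
        psum (Fin.cons h i : Fin (n + 1) → ℤ) m) ∧ (j : ℤ) + ∑ l, (Fin.cons h i : Fin (n + 1) → ℤ) l = k)
        = wordSum A z n (fun i => (∀ m, 0 ≤ ((j : ℤ) + h) + psum i m) ∧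
          ((j : ℤ) + h) + ∑ l, i l = k) := by
      intro h
      refine wordSum_congr A z fun i => ?_
      rw [Fin.sum_univ_succ]
      simp only [Fin.cons_zero, Fin.cons_succ, add_assoc]
      refine and_congr_left fun _ => ⟨fun H m => ?_, fun H m => ?_⟩
      · have := H (m + 1)
        rwa [psum_cons_succ] at this
      · rcases m with _ | m
        · rw [psum_zero]; positivity
        · rw [psum_cons_succ]; exact H m
    rw [wordSum_succ, sum_H]
    simp only [key]
    rcases j with _ | j
    · have h1 : wordSum A z n (fun i => (∀ m, 0 ≤ (((0 : ℕ) : ℤ) + (-1)) + psum i m) ∧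
          (((0 : ℕ) : ℤ) + (-1)) + ∑ l, i l = k) = 0 := wordSum_false A z fun i hi => by
        have := hi.1 0
        simp [psum_zero] at this
      have h2 := ih 0
      have h3 := ih 1
      simp only [Nat.cast_zero, zero_add, add_zero, Nat.cast_one] at h1 h2 h3 ⊢
      rw [h1, h2, h3, levelSum, mul_zero, zero_add]
    · have h1 := ih j
      have h2 := ih (j + 1)
      have h3 := ih (j + 2)
      have e1 : ((j + 1 : ℕ) : ℤ) + (-1) = (j : ℤ) := by push_cast; ring
      have e3 : ((j + 1 : ℕ) : ℤ) + 1 = ((j + 2 : ℕ) : ℤ) := by push_cast; ring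
      simp only [e1, e3, add_zero]
      rw [h1, h2, h3, levelSum]
      abel

/-- Only the final partial sum is negative, so the word goes to level 0 in `n` letters and then
takes the letter `-1`. -/
theorem wordSum_exit (A : ℤ → ℤ → Matrix S S ℝ) (z : ℂ) (n j : ℕ) :
    wordSum A z (n + 1) (fun i => (∀ m, m < n + 1 → 0 ≤ (j : ℤ) + psum i m) ∧
      (j : ℤ) + ∑ l, i l = -1) = levelSum (fun i => Acol A i z) n j 0 * Acol A (-1) z := by
  classical
  have key : ∀ (n : ℕ) (j : ℕ) (h : ℤ), wordSum A z n (fun i => (∀ m, m < n + 1 → 0 ≤ (j : ℤ) +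
      psum (Fin.cons h i : Fin (n + 1) → ℤ) m) ∧
        (j : ℤ) + ∑ l, (Fin.cons h i : Fin (n + 1) → ℤ) l = -1)
      = wordSum A z n (fun i => (∀ m, m < n → 0 ≤ ((j : ℤ) + h) + psum i m) ∧
        ((j : ℤ) + h) + ∑ l, i l = -1) := by
    intro n j h
    refine wordSum_congr A z fun i => ?_
    rw [Fin.sum_univ_succ]
    simp only [Fin.cons_zero, Fin.cons_succ, add_assoc]
    refine and_congr_left fun _ => ⟨fun H m hm => ?_, fun H m hm => ?_⟩
    · have := H (m + 1) (by omega)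
      rwa [psum_cons_succ] at this
    · rcases m with _ | m
      · rw [psum_zero]; positivity
      · rw [psum_cons_succ]; exact H m (by omega)
  induction n generalizing j with
  | zero =>
    rw [wordSum_succ, sum_H]
    simp only [key, wordSum_zero, Finset.univ_eq_empty, Finset.sum_empty, levelSum]
    rcases j with _ | j
    · simp
    · have e0 : ((j + 1 : ℕ) : ℤ) ≠ -1 := by omega
      have e1 : ((j + 1 : ℕ) : ℤ) + 1 ≠ -1 := by omega
      have e2 : ((j + 1 : ℕ) : ℤ) + (-1) ≠ -1 := by omega
      rw [if_neg (by simpa using e2), if_neg (by simpa using e0), if_neg (by simpa using e1)]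
      simp
  | succ n ih =>
    rw [wordSum_succ, sum_H]
    simp only [key]
    rcases j with _ | j
    · have h1 : wordSum A z (n + 1) (fun i => (∀ m, m < n + 1 → 0 ≤ (((0 : ℕ) : ℤ) + (-1)) + psum i m) ∧
          (((0 : ℕ) : ℤ) + (-1)) + ∑ l, i l = -1) = 0 := wordSum_false A z fun i hi => by
        have := hi.1 0 (by omega)
        simp [psum_zero] at this
      have h2 := ih 0
      have h3 := ih 1
      simp only [Nat.cast_zero, zero_add, add_zero, Nat.cast_one] at h1 h2 h3 ⊢
      rw [h1, h2, h3, levelSum, mul_zero, zero_add, add_mul, mul_assoc, mul_assoc]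
    · have h1 := ih j
      have h2 := ih (j + 1)
      have h3 := ih (j + 2)
      have e1 : ((j + 1 : ℕ) : ℤ) + (-1) = (j : ℤ) := by push_cast; ring
      have e3 : ((j + 1 : ℕ) : ℤ) + 1 = ((j + 2 : ℕ) : ℤ) := by push_cast; ring
      simp only [e1, e3, add_zero]
      rw [h1, h2, h3, levelSum]
      noncomm_ring

theorem Qterm_eq (A : ℤ → ℤ → Matrix S S ℝ) (n : ℕ) (z : ℂ) :
    Qterm A n z = levelSum (fun i => Acol A i z) n 0 0 := by
  classical
  rw [← wordSum_eq_levelSum, Qterm, wordSum]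
  refine Finset.sum_congr ?_ fun _ _ => rfl
  ext i
  simp only [seqQ, Finset.mem_filter, Nat.cast_zero, zero_add]
  refine and_congr_right fun _ => and_congr_left fun htot => ⟨fun h m => ?_, fun h k _ _ => h k⟩
  rcases Nat.eq_zero_or_pos m with rfl | hm
  · rw [psum_zero]
  · rcases lt_or_ge m n with hmn | hmn
    · exact h m hmn hm
    · rw [psum_of_le i hmn, htot]

theorem Dterm_zero (A : ℤ → ℤ → Matrix S S ℝ) (z : ℂ) : Dterm A 0 z = 0 := by
  simp [Dterm, seqD]

theorem Uterm_zero (A : ℤ → ℤ → Matrix S S ℝ) (z : ℂ) : Uterm A 0 z = 0 := by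
  simp [Uterm, seqU]

theorem Dterm_succ (A : ℤ → ℤ → Matrix S S ℝ) (n : ℕ) (z : ℂ) :
    Dterm A (n + 1) z = Qterm A n z * Acol A (-1) z := by
  classical
  rw [Qterm_eq, ← wordSum_exit, Dterm, wordSum]
  refine Finset.sum_congr ?_ fun _ _ => rfl
  ext i
  simp only [seqD, Finset.mem_filter, Nat.cast_zero, zero_add]
  refine and_congr_right fun _ => and_congr_left fun _ => ⟨fun h m hm => ?_, fun h k hk _ => h k hk⟩
  rcases Nat.eq_zero_or_pos m with rfl | hm0
  · rw [psum_zero]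
  · exact h m hm hm0

/-- The first letter must be `1`, by the constraint at `k = 1`, or by the total when the word has
length one. Measured from level 1, the rest is a word of N₁. -/
theorem Uterm_succ (A : ℤ → ℤ → Matrix S S ℝ) (n : ℕ) (z : ℂ) :
    Uterm A (n + 1) z = Acol A 1 z * Qterm A n z := by
  classical
  have hU : Uterm A (n + 1) z = wordSum A z (n + 1) (fun i =>
      (∀ k : ℕ, k < n + 1 → 1 ≤ k → 1 ≤ psum i k) ∧ ∑ l, i l = 1) := by
    rw [Uterm, wordSum]
    refine Finset.sum_congr ?_ fun _ _ => rfl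
    ext i; simp [seqU]
  have hQ : Qterm A n z = wordSum A z n (fun i =>
      (∀ k : ℕ, k < n → 1 ≤ k → 0 ≤ psum i k) ∧ ∑ l, i l = 0) := by
    rw [Qterm, wordSum]
    refine Finset.sum_congr ?_ fun _ _ => rfl
    ext i; simp [seqQ]
  have hcons : ∀ (h : ℤ) (i : Fin n → ℤ), h ∈ H →
      (((∀ k : ℕ, k < n + 1 → 1 ≤ k → 1 ≤ psum (Fin.cons h i : Fin (n + 1) → ℤ) k) ∧
        ∑ l, (Fin.cons h i : Fin (n + 1) → ℤ) l = 1) ↔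
      h = 1 ∧ (∀ k : ℕ, k < n → 1 ≤ k → 0 ≤ psum i k) ∧ ∑ l, i l = 0) := by
    intro h i hh
    rw [Fin.sum_univ_succ]
    simp only [Fin.cons_zero, Fin.cons_succ]
    constructor
    · rintro ⟨h1, h2⟩
      have h3 : h = 1 := by
        rcases Nat.eq_zero_or_pos n with rfl | hn
        · simpa using h2
        · have h4 : 1 ≤ psum (Fin.cons h i : Fin (n + 1) → ℤ) (0 + 1) := h1 1 (by omega) le_rfl
          rw [psum_cons_succ, psum_zero] at h4
          simp only [H, Finset.mem_insert, Finset.mem_singleton] at hh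
          omega
      refine ⟨h3, fun k hk hk1 => ?_, by omega⟩
      have := h1 (k + 1) (by omega) (by omega)
      rw [psum_cons_succ] at this
      omega
    · rintro ⟨rfl, h1, h2⟩
      refine ⟨fun k hk hk1 => ?_, by omega⟩
      obtain ⟨k, rfl⟩ : ∃ l, k = l + 1 := ⟨k - 1, by omega⟩
      rw [psum_cons_succ]
      rcases Nat.eq_zero_or_pos k with rfl | hk0
      · rw [psum_zero]; norm_num
      · have := h1 k (by omega) hk0
        omega
  rw [hU, hQ, wordSum_succ, sum_H, wordSum_congr A z (fun i => hcons (-1) i (by simp [H])),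
    wordSum_congr A z (fun i => hcons 0 i (by simp [H])),
    wordSum_congr A z (fun i => hcons 1 i (by simp [H]))]
  rw [wordSum_false A z (fun i hi => by simpa using hi.1),
    wordSum_false A z (fun i hi => by simpa using hi.1)]
  simp

end Words

/-! ### Superharmonic bounds for level sums -/

section LevelBounds

variable {S : Type*} [Fintype S] [DecidableEq S]

theorem mulVec_mono {M : Matrix S S ℝ} (h0 : ∀ a b, 0 ≤ M a b) {x y : S → ℝ} (h : ∀ a, x a ≤ y a)
    (a : S) : (M *ᵥ x) a ≤ (M *ᵥ y) a :=
  Finset.sum_le_sum fun b _ => mul_le_mul_of_nonneg_left (h b) (h0 a b)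

/-- Transposition reverses words, and a reversed path has its increments negated. -/
theorem levelSum_transpose (B : ℤ → Matrix S S ℝ) (n j k : ℕ) :
    (levelSum B n j k)ᵀ = levelSum (fun i => (B (-i))ᵀ) n k j := by
  induction n generalizing j k with
  | zero => simp only [levelSum, eq_comm]; split_ifs <;> simp
  | succ n ih =>
    rw [levelSum_succ_right]
    rcases k with _ | k
    · simp [levelSum_succ_left_zero, ih]
    · simp [levelSum_succ_left_succ, ih]

theorem levelSum_nonneg {B : ℤ → Matrix S S ℝ} (hB : ∀ i ∈ H, ∀ a b, 0 ≤ B i a b) (n j k : ℕ)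
    (a b : S) : 0 ≤ levelSum B n j k a b := by
  have hm : ∀ i ∈ H, ∀ M : Matrix S S ℝ, (∀ a b, 0 ≤ M a b) → ∀ a b, 0 ≤ (B i * M) a b :=
    fun i hi M hM a b => Finset.sum_nonneg fun c _ => mul_nonneg (hB i hi a c) (hM c b)
  induction n generalizing j a b with
  | zero =>
    simp only [levelSum]
    split_ifs
    · rw [Matrix.one_apply]; split_ifs <;> norm_num
    · exact le_rfl
  | succ n ih =>
    rcases j with _ | j
    · exact add_nonneg (hm 0 (by simp [H]) _ (ih _) a b) (hm 1 (by simp [H]) _ (ih _) a b)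
    · exact add_nonneg (add_nonneg (hm 0 (by simp [H]) _ (ih _) a b)
        (hm 1 (by simp [H]) _ (ih _) a b)) (hm (-1) (by simp [H]) _ (ih _) a b)

theorem norm_levelSum_le {B : ℤ → Matrix S S ℂ} {B' : ℤ → Matrix S S ℝ}
    (hB : ∀ i ∈ H, ∀ a b, ‖B i a b‖ ≤ B' i a b) (n j k : ℕ) (a b : S) :
    ‖levelSum B n j k a b‖ ≤ levelSum B' n j k a b := by
  have hm : ∀ i ∈ H, ∀ (M : Matrix S S ℂ) (M' : Matrix S S ℝ), (∀ a b, ‖M a b‖ ≤ M' a b) →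
      ∀ a b, ‖(B i * M) a b‖ ≤ (B' i * M') a b := fun i hi M M' hM a b =>
    (norm_sum_le _ _).trans (Finset.sum_le_sum fun c _ => by
      rw [norm_mul]
      exact mul_le_mul (hB i hi a c) (hM c b) (norm_nonneg _) ((norm_nonneg _).trans (hB i hi a c)))
  induction n generalizing j a b with
  | zero =>
    simp only [levelSum]
    split_ifs
    · rw [Matrix.one_apply, Matrix.one_apply]; split_ifs <;> simp
    · simp
  | succ n ih =>
    rcases j with _ | j
    · exact (norm_add_le _ _).trans (add_le_add (hm 0 (by simp [H]) _ _ (ih _) a b)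
        (hm 1 (by simp [H]) _ _ (ih _) a b))
    · exact (norm_add_le _ _).trans (add_le_add ((norm_add_le _ _).trans
        (add_le_add (hm 0 (by simp [H]) _ _ (ih _) a b) (hm 1 (by simp [H]) _ _ (ih _) a b)))
        (hm (-1) (by simp [H]) _ _ (ih _) a b))

/-- A superharmonic function of the form `w ^ level * y` bounds the weight of the words that
reach level `-1` for the first time. -/
theorem sum_exit_le {B : ℤ → Matrix S S ℝ} (hB : ∀ i ∈ H, ∀ a b, 0 ≤ B i a b) {w : ℝ}
    (hw : 0 < w) {y : S → ℝ} (hy : ∀ a, 0 ≤ y a)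
    (hsup : ∀ a, w⁻¹ * (B (-1) *ᵥ y) a + (B 0 *ᵥ y) a + w * (B 1 *ᵥ y) a ≤ y a) (M j : ℕ) (a : S) :
    (∑ n ∈ Finset.range M, levelSum B n j 0 *ᵥ (B (-1) *ᵥ y)) a ≤ w ^ (j + 1) * y a := by
  have h0 : (0 : ℤ) ∈ H := by simp [H]
  have h1 : (1 : ℤ) ∈ H := by simp [H]
  have hm1 : (-1 : ℤ) ∈ H := by simp [H]
  set f := B (-1) *ᵥ y with hf
  have hf0 : ∀ a, 0 ≤ f a := fun a => Finset.sum_nonneg fun b _ => mul_nonneg (hB _ hm1 a b) (hy b)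
  induction M generalizing j a with
  | zero => simpa using mul_nonneg (pow_nonneg hw.le _) (hy a)
  | succ M ih =>
    have hs : ∀ i ∈ H, ∀ j : ℕ, (B i *ᵥ ∑ n ∈ Finset.range M, levelSum B n j 0 *ᵥ f) a ≤
        w ^ (j + 1) * (B i *ᵥ y) a := by
      intro i hi j
      refine (mulVec_mono (hB i hi) (y := w ^ (j + 1) • y) (fun b => ih j b) a).trans (le_of_eq ?_)
      rw [Matrix.mulVec_smul]; rfl
    have hmul := mul_le_mul_of_nonneg_left (hsup a) (pow_nonneg hw.le (j + 1))
    have hw' : w ^ (j + 1) * w⁻¹ = w ^ j := by rw [pow_succ, mul_assoc, mul_inv_cancel₀ hw.ne', mul_one]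
    have hexp : w ^ (j + 1) * (w⁻¹ * f a + (B 0 *ᵥ y) a + w * (B 1 *ᵥ y) a)
        = w ^ j * f a + w ^ (j + 1) * (B 0 *ᵥ y) a + w ^ (j + 2) * (B 1 *ᵥ y) a := by
      rw [mul_add, mul_add, ← mul_assoc, hw']; ring
    rw [hexp] at hmul
    rw [Finset.sum_range_succ']
    -- At level 0 the letter `-1` is the exit itself and appears as the term `n = 0`; at higher
    -- levels it leads one level down and the term `n = 0` is zero.
    rcases j with _ | j
    · have e : ∑ n ∈ Finset.range M, levelSum B (n + 1) 0 0 *ᵥ f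
          = (B 0 *ᵥ ∑ n ∈ Finset.range M, levelSum B n 0 0 *ᵥ f)
            + B 1 *ᵥ ∑ n ∈ Finset.range M, levelSum B n 1 0 *ᵥ f := by
        simp only [levelSum_succ_left_zero, Matrix.add_mulVec, Finset.sum_add_distrib,
          Matrix.mulVec_sum, Matrix.mulVec_mulVec]
      rw [e]
      have k0 := hs 0 h0 0
      have k1 := hs 1 h1 1
      have e0 : levelSum B 0 0 0 *ᵥ f = f := by simp [levelSum]
      rw [e0]
      simp only [Pi.add_apply] at *
      simp only [pow_zero, one_mul, zero_add, Nat.reduceAdd] at *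
      linarith
    · have e : ∑ n ∈ Finset.range M, levelSum B (n + 1) (j + 1) 0 *ᵥ f
          = (B 0 *ᵥ ∑ n ∈ Finset.range M, levelSum B n (j + 1) 0 *ᵥ f)
            + (B 1 *ᵥ ∑ n ∈ Finset.range M, levelSum B n (j + 2) 0 *ᵥ f)
            + B (-1) *ᵥ ∑ n ∈ Finset.range M, levelSum B n j 0 *ᵥ f := by
        simp only [levelSum_succ_left_succ, Matrix.add_mulVec, Finset.sum_add_distrib,
          Matrix.mulVec_sum, Matrix.mulVec_mulVec]
      rw [e]
      have k0 := hs 0 h0 (j + 1)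
      have k1 := hs 1 h1 (j + 2)
      have k2 := hs (-1) hm1 j
      have e0 : levelSum B 0 (j + 1) 0 *ᵥ f = 0 := by simp [levelSum]
      rw [e0]
      simp only [Pi.add_apply, Pi.zero_apply, add_zero] at *
      linarith

/-- The counterpart of `sum_exit_le` for row vectors. -/
theorem sum_entrance_le {B : ℤ → Matrix S S ℝ} (hB : ∀ i ∈ H, ∀ a b, 0 ≤ B i a b) {w : ℝ}
    (hw : 0 < w) {u : S → ℝ} (hu : ∀ a, 0 ≤ u a)
    (hsup : ∀ a, w⁻¹ * (u ᵥ* B (-1)) a + (u ᵥ* B 0) a + w * (u ᵥ* B 1) a ≤ u a) (M : ℕ) (a : S) :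
    (∑ n ∈ Finset.range M, (u ᵥ* B 1) ᵥ* levelSum B n 0 0) a ≤ w⁻¹ * u a := by
  have hneg : ∀ i ∈ H, -i ∈ H := by decide
  -- Reversal turns upward entrances into downward exits, so the level weight `w` becomes `w⁻¹`.
  have := sum_exit_le (B := fun i => (B (-i))ᵀ) (fun i hi a b => hB (-i) (hneg i hi) b a)
    (inv_pos.2 hw) hu (fun a => by
      simp only [Matrix.mulVec_transpose, neg_neg, inv_inv, neg_zero]
      linarith [hsup a]) M 0 a
  simpa only [← levelSum_transpose, Matrix.mulVec_transpose, neg_neg, zero_add, pow_one] using this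

/-- The left side only counts the words that are at level `k` after `n` letters. -/
theorem levelSum_mul_le {B : ℤ → Matrix S S ℝ} (hB : ∀ i ∈ H, ∀ a b, 0 ≤ B i a b) (n m j k l : ℕ)
    (a b : S) : (levelSum B n j k * levelSum B m k l) a b ≤ levelSum B (n + m) j l a b := by
  have hm : ∀ i ∈ H, ∀ M M' : Matrix S S ℝ, (∀ a b, M a b ≤ M' a b) →
      ∀ a b, (B i * M) a b ≤ (B i * M') a b := fun i hi M M' hM a b =>
    Finset.sum_le_sum fun c _ => mul_le_mul_of_nonneg_left (hM c b) (hB i hi a c)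
  induction n generalizing j a b with
  | zero =>
    rw [levelSum]
    split_ifs with h
    · subst h; simp
    · simpa using levelSum_nonneg hB _ _ _ _ _
  | succ n ih =>
    rw [show n + 1 + m = n + m + 1 by ring]
    rcases j with _ | j
    · rw [levelSum_succ_left_zero, levelSum_succ_left_zero, add_mul, Matrix.mul_assoc,
        Matrix.mul_assoc]
      exact add_le_add (hm 0 (by simp [H]) _ _ (ih _) a b) (hm 1 (by simp [H]) _ _ (ih _) a b)
    · rw [levelSum_succ_left_succ, levelSum_succ_left_succ, add_mul, add_mul, Matrix.mul_assoc,
        Matrix.mul_assoc, Matrix.mul_assoc]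
      exact add_le_add (add_le_add (hm 0 (by simp [H]) _ _ (ih _) a b)
        (hm 1 (by simp [H]) _ _ (ih _) a b)) (hm (-1) (by simp [H]) _ _ (ih _) a b)

end LevelBounds

/-! ### Real columns and convergence of the N₁ series -/

section Columns

variable {S : Type*} [Fintype S] [DecidableEq S]

/-- `A_{*,j}(x)` for real `x`. -/
noncomputable def Ar (A : ℤ → ℤ → Matrix S S ℝ) (j : ℤ) (x : ℝ) : Matrix S S ℝ :=
  ∑ i ∈ H, x ^ i • A i j

theorem Acol_ofReal (A : ℤ → ℤ → Matrix S S ℝ) (j : ℤ) (x : ℝ) :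
    Acol A j x = (Ar A j x).map Complex.ofReal := by
  ext a b
  simp [Acol, Ar, Matrix.sum_apply]

theorem Blocks.Ar_nonneg {A : ℤ → ℤ → Matrix S S ℝ} (hA : Blocks A) {x : ℝ} (hx : 0 < x) :
    ∀ j ∈ H, ∀ a b, 0 ≤ Ar A j x a b := by
  intro j hj a b
  simp only [Ar, Matrix.sum_apply, Matrix.smul_apply, smul_eq_mul]
  exact Finset.sum_nonneg fun i hi => mul_nonneg (by positivity) (hA.nonneg i hi j hj a b)

theorem Blocks.norm_Acol_le {A : ℤ → ℤ → Matrix S S ℝ} (hA : Blocks A) (z : ℂ) :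
    ∀ j ∈ H, ∀ a b, ‖Acol A j z a b‖ ≤ Ar A j ‖z‖ a b := by
  intro j hj a b
  simp only [Ar, Acol, Matrix.sum_apply, Matrix.smul_apply, smul_eq_mul]
  refine (norm_sum_le _ _).trans (Finset.sum_le_sum fun i hi => ?_)
  simp [abs_of_nonneg (hA.nonneg i hi j hj a b)]

theorem Cr_eq (A : ℤ → ℤ → Matrix S S ℝ) (x w : ℝ) :
    Cr A x w = w⁻¹ • Ar A (-1) x + Ar A 0 x + w • Ar A 1 x := by
  simp only [Cr, Ar, mul_smul, ← Finset.smul_sum]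
  rw [sum_H]
  simp

/-- Otherwise the states reachable from `b` at level 0 through nonnegative levels would be closed
under transitions, and level `-1` could never be reached. -/
theorem Blocks.exists_exit {A : ℤ → ℤ → Matrix S S ℝ} (hA : Blocks A) {x : ℝ} (hx : 0 < x) (b : S) :
    ∃ m c d, 0 < levelSum (fun i => Ar A i x) m 0 0 b c ∧ 0 < Ar A (-1) x c d := by
  by_contra hcon
  push Not at hcon
  have hnn := hA.Ar_nonneg hx
  have hAr : ∀ i j c d, i ∈ H → j ∈ H → 0 < A i j c d → 0 < Ar A j x c d := by
    intro i j c d hi hj hpos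
    simp only [Ar, Matrix.sum_apply, Matrix.smul_apply, smul_eq_mul]
    exact lt_of_lt_of_le (by positivity) (Finset.single_le_sum (f := fun i => x ^ i * A i j c d)
      (fun i hi => mul_nonneg (by positivity) (hA.nonneg i hi j hj c d)) hi)
  have hstep : ∀ (m k k' : ℕ) (j : ℤ) (c d : S), 0 < levelSum (fun i => Ar A i x) m 0 k b c → 0 < Ar A j x c d →
      j ∈ H → ((k' : ℤ) = k + j) → 0 < levelSum (fun i => Ar A i x) (m + 1) 0 k' b d := by
    intro m k k' j c d h1 h2 hj hk
    have hle : ∀ (M N : Matrix S S ℝ), (∀ a b, 0 ≤ M a b) → (∀ a b, 0 ≤ N a b) →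
        M b c * N c d ≤ (M * N) b d := fun M N hM hN =>
      Finset.single_le_sum (f := fun e => M b e * N e d)
        (fun e _ => mul_nonneg (hM b e) (hN e d)) (Finset.mem_univ c)
    have hls := levelSum_nonneg (B := fun i => Ar A i x) hnn m 0
    have hpos := mul_pos h1 h2
    have hmn : ∀ (i : ℤ) (k : ℕ), i ∈ H → 0 ≤ (levelSum (fun i => Ar A i x) m 0 k * Ar A i x) b d :=
      fun i k hi => Finset.sum_nonneg fun e _ => mul_nonneg (hls k b e) (hnn i hi e d)
    have hbig := hpos.trans_le (hle _ _ (hls k) (hnn j hj))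
    rw [levelSum_succ_right]
    have g0 := hmn 0 k' (by simp [H])
    have gm := hmn (-1) (k' + 1) (by simp [H])
    have g1 := hmn 1 (k' - 1) (by simp [H])
    simp only [H, Finset.mem_insert, Finset.mem_singleton] at hj
    rcases hj with rfl | rfl | rfl
    · have : k = k' + 1 := by omega
      subst this
      split_ifs
      · simp only [Matrix.add_apply, Matrix.zero_apply]; linarith
      · simp only [Matrix.add_apply]; linarith
    · have : k = k' := by omega
      subst this
      split_ifs
      · simp only [Matrix.add_apply, Matrix.zero_apply]; linarith
      · simp only [Matrix.add_apply]; linarith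
    · have : k = k' - 1 := by omega
      subst this
      rw [if_neg (by omega)]
      simp only [Matrix.add_apply]; linarith
  have hall := hA.induction (fun _ n c => 0 ≤ n ∧ ∃ m, 0 < levelSum (fun i => Ar A i x) m 0 n.toNat b c)
    0 0 b ⟨le_rfl, 0, by simp [levelSum]⟩ (by
      rintro _ n c i j d hi hj hpos ⟨hn, m, hm⟩
      have hpos' := hAr i j c d hi hj hpos
      by_cases hnj : 0 ≤ n + j
      · exact ⟨hnj, m + 1, hstep m n.toNat (n + j).toNat j c d hm hpos' hj (by omega)⟩
      · exfalso
        have hj' := hj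
        simp only [H, Finset.mem_insert, Finset.mem_singleton] at hj'
        have hn0 : n = 0 := by omega
        have hj1 : j = -1 := by omega
        subst hn0 hj1
        exact absurd hpos' (not_lt.2 (hcon m c d hm))) 0 (-1) b
  exact absurd hall.1 (by norm_num)

/-- A word ending at level 0 in phase `b` can be continued by one fixed path that exits, at the cost
of the constant factor `K`; the total exit weight is at most `w * y a`. -/
theorem Blocks.summable_levelSum {A : ℤ → ℤ → Matrix S S ℝ} (hA : Blocks A) {x w : ℝ} (hx : 0 < x)
    (hw : 0 < w) {y : S → ℝ} (hy : ∀ a, 0 < y a) (hsup : ∀ a, (Cr A x w *ᵥ y) a ≤ y a) (a b : S) :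
    Summable fun n => levelSum (fun i => Ar A i x) n 0 0 a b := by
  have hnn := hA.Ar_nonneg hx
  obtain ⟨m, c, d, h1, h2⟩ := hA.exists_exit hx b
  set K := levelSum (fun i => Ar A i x) m 0 0 b c * Ar A (-1) x c d * y d with hK
  have hK0 : 0 < K := mul_pos (mul_pos h1 h2) (hy d)
  have hls := levelSum_nonneg (B := fun i => Ar A i x) hnn
  refine summable_of_sum_range_le (c := w * y a / K) (fun n => hls n 0 0 a b) fun M => ?_
  rw [le_div_iff₀ hK0]
  have hbd := sum_exit_le (B := fun i => Ar A i x) hnn hw (fun a => (hy a).le) (fun a => by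
    have := hsup a
    rw [Cr_eq] at this
    simpa [Matrix.add_mulVec, Matrix.smul_mulVec] using this) (M + m) 0 a
  rw [zero_add, pow_one] at hbd
  refine le_trans ?_ hbd
  have hfy : ∀ c, 0 ≤ (Ar A (-1) x *ᵥ y) c := fun c =>
    Finset.sum_nonneg fun d _ => mul_nonneg (hnn (-1) (by simp [H]) c d) (hy d).le
  have hterm : ∀ n, 0 ≤ (levelSum (fun i => Ar A i x) n 0 0 *ᵥ (Ar A (-1) x *ᵥ y)) a := fun n =>
    Finset.sum_nonneg fun c _ => mul_nonneg (hls n 0 0 a c) (hfy c)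
  have hone : ∀ n, levelSum (fun i => Ar A i x) n 0 0 a b * K ≤
      (levelSum (fun i => Ar A i x) (n + m) 0 0 *ᵥ (Ar A (-1) x *ᵥ y)) a := by
    intro n
    have e1 : Ar A (-1) x c d * y d ≤ (Ar A (-1) x *ᵥ y) c :=
      Finset.single_le_sum (f := fun d => Ar A (-1) x c d * y d)
        (fun d _ => mul_nonneg (hnn (-1) (by simp [H]) c d) (hy d).le) (Finset.mem_univ d)
    have e2 : levelSum (fun i => Ar A i x) n 0 0 a b * levelSum (fun i => Ar A i x) m 0 0 b c ≤
        levelSum (fun i => Ar A i x) (n + m) 0 0 a c :=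
      (Finset.single_le_sum (f := fun e => levelSum (fun i => Ar A i x) n 0 0 a e *
        levelSum (fun i => Ar A i x) m 0 0 e c)
        (fun e _ => mul_nonneg (hls _ _ _ _ _) (hls _ _ _ _ _)) (Finset.mem_univ b)).trans
        (levelSum_mul_le hnn n m 0 0 0 a c)
    have e3 : levelSum (fun i => Ar A i x) (n + m) 0 0 a c * (Ar A (-1) x *ᵥ y) c ≤
        (levelSum (fun i => Ar A i x) (n + m) 0 0 *ᵥ (Ar A (-1) x *ᵥ y)) a :=
      Finset.single_le_sum (f := fun c => levelSum (fun i => Ar A i x) (n + m) 0 0 a c *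
        (Ar A (-1) x *ᵥ y) c) (fun c _ => mul_nonneg (hls _ _ _ _ _) (hfy c)) (Finset.mem_univ c)
    refine le_trans ?_ e3
    calc levelSum (fun i => Ar A i x) n 0 0 a b * K
        = (levelSum (fun i => Ar A i x) n 0 0 a b * levelSum (fun i => Ar A i x) m 0 0 b c) *
          (Ar A (-1) x c d * y d) := by rw [hK]; ring
      _ ≤ _ := mul_le_mul e2 e1 (mul_nonneg h2.le (hy d).le) (hls _ _ _ _ _)
  rw [Finset.sum_mul, Finset.sum_apply, add_comm M m, Finset.sum_range_add]
  refine (Finset.sum_le_sum fun n _ => hone n).trans ?_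
  simp only [add_comm _ m]
  exact le_add_of_nonneg_left (Finset.sum_nonneg fun n _ => hterm n)

/-- Finite sums of monomials `c x ^ k` with `c ≥ 0`, as functions on the positive reals. -/
def PosLaurent (f : ℝ → ℝ) : Prop :=
  ∃ L : List (ℝ × ℤ), (∀ q ∈ L, 0 ≤ q.1) ∧ ∀ x > 0, f x = (L.map fun q => q.1 * x ^ q.2).sum

/-- Each monomial is monotone, hence bounded by its value at one of the end points. In this way
convergence at the two radii controls the whole annulus. -/
theorem PosLaurent.le_add {f : ℝ → ℝ} (hf : PosLaurent f) {r₁ r₂ x : ℝ} (h1 : 0 < r₁)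
    (hx1 : r₁ ≤ x) (hx2 : x ≤ r₂) : f x ≤ f r₁ + f r₂ := by
  obtain ⟨L, hL, hf⟩ := hf
  have hx : 0 < x := h1.trans_le hx1
  have h2 : 0 < r₂ := hx.trans_le hx2
  rw [hf x hx, hf r₁ h1, hf r₂ h2]
  clear hf
  induction L with
  | nil => simp
  | cons q L ih =>
    have hq : 0 ≤ q.1 := hL q (by simp)
    have := ih fun q hq => hL q (by simp [hq])
    have h3 : x ^ q.2 ≤ r₁ ^ q.2 + r₂ ^ q.2 := by
      rcases le_total 0 q.2 with h | h
      · have := zpow_le_zpow_left₀ h hx.le hx2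
        have := zpow_pos h1 q.2
        linarith
      · have e : ∀ t : ℝ, t ^ q.2 = (t ^ (-q.2))⁻¹ := fun t => by rw [zpow_neg, inv_inv]
        have h5 := zpow_le_zpow_left₀ (neg_nonneg.2 h) h1.le hx1
        have h6 : x ^ q.2 ≤ r₁ ^ q.2 := by
          rw [e, e r₁]
          exact inv_anti₀ (zpow_pos h1 _) h5
        have := zpow_pos h2 q.2
        linarith
    have h4 := mul_le_mul_of_nonneg_left h3 hq
    simp only [List.map_cons, List.sum_cons]
    linarith

theorem PosLaurent.const {c : ℝ} (hc : 0 ≤ c) : PosLaurent fun _ => c :=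
  ⟨[(c, 0)], by simpa using hc, fun x _ => by simp⟩

theorem PosLaurent.add {f g : ℝ → ℝ} (hf : PosLaurent f) (hg : PosLaurent g) :
    PosLaurent fun x => f x + g x := by
  obtain ⟨L, hL, hf⟩ := hf
  obtain ⟨L', hL', hg⟩ := hg
  refine ⟨L ++ L', fun q hq => ?_, fun x hx => by simp [hf x hx, hg x hx]⟩
  rcases List.mem_append.1 hq with h | h
  · exact hL q h
  · exact hL' q h

theorem PosLaurent.sum {ι : Type*} {s : Finset ι} {f : ι → ℝ → ℝ} (hf : ∀ i ∈ s, PosLaurent (f i)) :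
    PosLaurent fun x => ∑ i ∈ s, f i x := by
  classical
  induction s using Finset.induction_on with
  | empty => simpa using PosLaurent.const le_rfl
  | insert i s his ih =>
    simp only [Finset.sum_insert his]
    exact (hf i (Finset.mem_insert_self _ _)).add (ih fun j hj => hf j (Finset.mem_insert_of_mem hj))

theorem PosLaurent.monomial_mul {f : ℝ → ℝ} (hf : PosLaurent f) {c : ℝ} (hc : 0 ≤ c) (k : ℤ) :
    PosLaurent fun x => c * x ^ k * f x := by
  obtain ⟨L, hL, hf⟩ := hf
  refine ⟨L.map fun q => (c * q.1, k + q.2), fun q hq => ?_, fun x hx => ?_⟩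
  · obtain ⟨q', hq', rfl⟩ := List.mem_map.1 hq
    exact mul_nonneg hc (hL q' hq')
  · change c * x ^ k * f x = _
    rw [hf x hx, ← List.sum_map_mul_left, List.map_map]
    congr 1
    refine List.map_congr_left fun q _ => ?_
    simp only [Function.comp, zpow_add₀ hx.ne']
    ring

theorem Blocks.posLaurent_levelSum {A : ℤ → ℤ → Matrix S S ℝ} (hA : Blocks A) (n j k : ℕ) (a b : S) :
    PosLaurent fun x => levelSum (fun i => Ar A i x) n j k a b := by
  have hm : ∀ i ∈ H, ∀ M : ℝ → Matrix S S ℝ, (∀ a b, PosLaurent fun x => M x a b) →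
      ∀ a b, PosLaurent fun x => (Ar A i x * M x) a b := by
    intro j hj M hM a b
    simp only [Matrix.mul_apply, Ar, Matrix.sum_apply, Matrix.smul_apply, smul_eq_mul,
      Finset.sum_mul]
    refine PosLaurent.sum fun c _ => PosLaurent.sum fun i hi => ?_
    simp only [mul_comm _ (A i j a c)]
    exact (hM c b).monomial_mul (hA.nonneg i hi j hj a c) i
  induction n generalizing j a b with
  | zero =>
    simp only [levelSum]
    refine PosLaurent.const ?_
    split_ifs
    · rw [Matrix.one_apply]; split_ifs <;> norm_num
    · exact le_rfl
  | succ n ih =>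
    rcases j with _ | j
    · exact (hm 0 (by simp [H]) _ (ih _) a b).add (hm 1 (by simp [H]) _ (ih _) a b)
    · exact ((hm 0 (by simp [H]) _ (ih _) a b).add (hm 1 (by simp [H]) _ (ih _) a b)).add
        (hm (-1) (by simp [H]) _ (ih _) a b)

end Columns

/-! ### The series on the annulus: factorizations, quadratic equation, continuity -/

section Series

variable {S : Type*} [Fintype S] [DecidableEq S] {A : ℤ → ℤ → Matrix S S ℝ} {w : ℝ} {y u g : S → ℝ}

theorem summable_matrix_of_norm {f : ℕ → Matrix S S ℂ}
    (hf : ∀ a b, Summable fun n => ‖f n a b‖) : Summable f :=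
  Pi.summable.2 fun a => Pi.summable.2 fun b => (hf a b).of_norm

theorem tsum_matrix_apply {K : Type*} [NormedField K] {f : ℕ → Matrix S S K} (hf : Summable f) (a b : S) :
    (∑' n, f n) a b = ∑' n, f n a b := by
  have h1 : (∑' n, f n) a = ∑' n, f n a := tsum_apply hf
  rw [h1]
  exact tsum_apply (Pi.summable.1 hf a)

theorem zMin_pos (A : ℤ → ℤ → Matrix S S ℝ) : 0 < zMin A := Real.exp_pos _

theorem zMax_pos (A : ℤ → ℤ → Matrix S S ℝ) : 0 < zMax A := Real.exp_pos _

/-- A summable bound, uniform on the annulus, for the terms of `N₁`. -/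
noncomputable def annulusBound (A : ℤ → ℤ → Matrix S S ℝ) (n : ℕ) (a b : S) : ℝ :=
  levelSum (fun i => Ar A i (zMin A)) n 0 0 a b + levelSum (fun i => Ar A i (zMax A)) n 0 0 a b

theorem summable_annulusBound (hA : Blocks A) (hc : Critical A w y u g) (a b : S) :
    Summable fun n => annulusBound A n a b := by
  obtain ⟨w', y', hw', hy', hsup⟩ := hc.superharmonic_zMin
  exact (hA.summable_levelSum (zMin_pos A) hw' hy' hsup a b).add
    (hA.summable_levelSum (zMax_pos A) hc.w_pos hc.y_pos (fun a => (congrFun hc.right a).le) a b)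

theorem norm_Qterm_le (hA : Blocks A) {z : ℂ} (hz : z ∈ annulus A) (n : ℕ) (a b : S) :
    ‖Qterm A n z a b‖ ≤ annulusBound A n a b := by
  rw [Qterm_eq]
  refine (norm_levelSum_le (hA.norm_Acol_le z) n 0 0 a b).trans ?_
  exact (hA.posLaurent_levelSum n 0 0 a b).le_add (zMin_pos A) hz.1 hz.2

theorem summable_norm_Qterm (hA : Blocks A) (hc : Critical A w y u g) {z : ℂ} (hz : z ∈ annulus A)
    (a b : S) : Summable fun n => ‖Qterm A n z a b‖ :=
  (summable_annulusBound hA hc a b).of_nonneg_of_le (fun _ => norm_nonneg _)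
    fun n => norm_Qterm_le hA hz n a b

theorem summable_Qterm (hA : Blocks A) (hc : Critical A w y u g) {z : ℂ} (hz : z ∈ annulus A) :
    Summable fun n => Qterm A n z :=
  summable_matrix_of_norm (summable_norm_Qterm hA hc hz)

theorem summable_Dterm (hA : Blocks A) (hc : Critical A w y u g) {z : ℂ} (hz : z ∈ annulus A) :
    Summable fun n => Dterm A n z := by
  rw [← summable_nat_add_iff 1]
  simp only [Dterm_succ]
  exact (summable_Qterm hA hc hz).mul_right _

theorem summable_Uterm (hA : Blocks A) (hc : Critical A w y u g) {z : ℂ} (hz : z ∈ annulus A) :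
    Summable fun n => Uterm A n z := by
  rw [← summable_nat_add_iff 1]
  simp only [Uterm_succ]
  exact (summable_Qterm hA hc hz).mul_left _

theorem G₁_eq (hA : Blocks A) (hc : Critical A w y u g) {z : ℂ} (hz : z ∈ annulus A) :
    G₁ A z = N₁ A z * Acol A (-1) z := by
  rw [G₁, (summable_Dterm hA hc hz).tsum_eq_zero_add, Dterm_zero, zero_add]
  simp only [Dterm_succ]
  exact (summable_Qterm hA hc hz).tsum_mul_right _

theorem R₁_eq (hA : Blocks A) (hc : Critical A w y u g) {z : ℂ} (hz : z ∈ annulus A) :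
    R₁ A z = Acol A 1 z * N₁ A z := by
  rw [R₁, (summable_Uterm hA hc hz).tsum_eq_zero_add, Uterm_zero, zero_add]
  simp only [Uterm_succ]
  exact (summable_Qterm hA hc hz).tsum_mul_left _

/-- Split off the first letter. After the letter `1` the convolution of `levelSum_succ_zero` is a
Cauchy product of N₁A_{*,-1} and N₁, justified by absolute convergence. -/
theorem N₁_eq (hA : Blocks A) (hc : Critical A w y u g) {z : ℂ} (hz : z ∈ annulus A) :
    N₁ A z = 1 + Acol A 0 z * N₁ A z + Acol A 1 z * (N₁ A z * Acol A (-1) z * N₁ A z) := by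
  have hQ := summable_Qterm hA hc hz
  have hn := summable_norm_Qterm hA hc hz
  have hpair : Summable fun x : ℕ × ℕ => (Qterm A x.1 z * Acol A (-1) z) * Qterm A x.2 z := by
    refine Pi.summable.2 fun a => Pi.summable.2 fun b => ?_
    simp only [Matrix.mul_apply]
    refine summable_sum fun c _ => ?_
    refine summable_mul_of_summable_norm (f := fun n => ∑ d, Qterm A n z a d * Acol A (-1) z d c)
      (g := fun n => Qterm A n z c b) ?_ (hn c b)
    refine Summable.of_nonneg_of_le (fun _ => norm_nonneg _) (fun n => norm_sum_le _ _) ?_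
    refine summable_sum fun d _ => ?_
    simp only [norm_mul]
    exact (hn a d).mul_right _
  have hprod := Summable.tsum_mul_tsum_eq_tsum_sum_antidiagonal
    (f := fun n => Qterm A n z * Acol A (-1) z) (g := fun n => Qterm A n z)
    (hQ.mul_right (Acol A (-1) z)) hQ hpair
  rw [hQ.tsum_mul_right] at hprod
  have hone : Summable fun n => levelSum (fun i => Acol A i z) (n + 1) 1 0 := by
    have := summable_sum_mul_antidiagonal_of_summable_mul
      (f := fun n => Qterm A n z * Acol A (-1) z) (g := fun n => Qterm A n z) hpair
    refine this.congr fun n => ?_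
    rw [levelSum_succ_zero]
    simp only [Qterm_eq]
  have hone' : Summable fun n => levelSum (fun i => Acol A i z) n 1 0 :=
    (summable_nat_add_iff 1).1 hone
  have h1 : ∑' n, levelSum (fun i => Acol A i z) n 1 0 = N₁ A z * Acol A (-1) z * N₁ A z := by
    rw [hone'.tsum_eq_zero_add, N₁, hprod]
    simp only [levelSum_succ_zero, ← Qterm_eq]
    simp [levelSum]
  rw [← h1, ← hone'.tsum_mul_left]
  conv_lhs => rw [N₁, hQ.tsum_eq_zero_add]
  rw [N₁, ← hQ.tsum_mul_left, add_assoc,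
    ← (hQ.mul_left (Acol A 0 z)).tsum_add (hone'.mul_left (Acol A 1 z))]
  congr 1
  · rw [Qterm_eq]; simp [levelSum]
  · refine tsum_congr fun n => ?_
    rw [Qterm_eq, levelSum_succ_left_zero, Qterm_eq]

theorem continuous_levelSum_entry {X R : Type*} [TopologicalSpace X] [Ring R] [TopologicalSpace R]
    [IsTopologicalRing R] {B : ℤ → X → R} {s : Set X} (hB : ∀ i, ContinuousOn (B i) s) (n j k : ℕ) :
    ContinuousOn (fun z => levelSum (fun i => B i z) n j k) s := by
  induction n generalizing j with
  | zero => simp only [levelSum]; exact continuousOn_const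
  | succ n ih =>
    rcases j with _ | j
    · exact ((hB 0).mul (ih _)).add ((hB 1).mul (ih _))
    · exact (((hB 0).mul (ih _)).add ((hB 1).mul (ih _))).add ((hB (-1)).mul (ih _))

theorem continuousOn_Acol (A : ℤ → ℤ → Matrix S S ℝ) (j : ℤ) :
    ContinuousOn (Acol A j) {z | z ≠ 0} := by
  unfold Acol
  refine continuousOn_finsetSum _ fun i _ => ?_
  have h : ContinuousOn (fun z : ℂ => z ^ i) {z | z ≠ 0} :=
    continuousOn_id.zpow₀ i fun z hz => Or.inl hz
  exact h.smul continuousOn_const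

theorem ne_zero_of_mem_annulus {z : ℂ} (hz : z ∈ annulus A) : z ≠ 0 := by
  rintro rfl
  have := hz.1
  rw [norm_zero] at this
  exact absurd (zMin_pos A) (not_lt.2 this)

theorem continuousOn_N₁ (hA : Blocks A) (hc : Critical A w y u g) :
    ContinuousOn (N₁ A) (annulus A) := by
  refine continuousOn_pi.2 fun a => continuousOn_pi.2 fun b => ?_
  have : ContinuousOn (fun z => ∑' n, Qterm A n z a b) (annulus A) := by
    refine continuousOn_tsum (fun n => ?_) (summable_annulusBound hA hc a b)
      fun n z hz => norm_Qterm_le hA hz n a b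
    have h1 := continuous_levelSum_entry (B := fun i z => Acol A i z) (s := annulus A)
      (fun i => (continuousOn_Acol A i).mono fun z hz => ne_zero_of_mem_annulus hz) n 0 0
    simp only [Qterm_eq]
    exact continuousOn_pi.1 (continuousOn_pi.1 h1 a) b
  refine this.congr fun z hz => ?_
  exact tsum_matrix_apply (summable_Qterm hA hc hz) a b

theorem continuousOn_G₁ (hA : Blocks A) (hc : Critical A w y u g) :
    ContinuousOn (G₁ A) (annulus A) := by
  refine ContinuousOn.congr ?_ fun z hz => G₁_eq hA hc hz
  exact (continuousOn_N₁ hA hc).mul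
    ((continuousOn_Acol A (-1)).mono fun z hz => ne_zero_of_mem_annulus hz)

/-- `N₁` at real arguments. -/
noncomputable def Nr (A : ℤ → ℤ → Matrix S S ℝ) (x : ℝ) : Matrix S S ℝ :=
  ∑' n, levelSum (fun i => Ar A i x) n 0 0

theorem summable_levelSum_real (hA : Blocks A) (hc : Critical A w y u g) {x : ℝ}
    (hx : x ∈ Set.Icc (zMin A) (zMax A)) : Summable fun n => levelSum (fun i => Ar A i x) n 0 0 := by
  refine Pi.summable.2 fun a => Pi.summable.2 fun b => ?_
  refine (summable_annulusBound hA hc a b).of_nonneg_of_le (fun n => ?_) fun n => ?_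
  · exact levelSum_nonneg (B := fun i => Ar A i x)
      (hA.Ar_nonneg ((zMin_pos A).trans_le hx.1)) n 0 0 a b
  · exact (hA.posLaurent_levelSum n 0 0 a b).le_add (zMin_pos A) hx.1 hx.2

theorem ofReal_mem_annulus {x : ℝ} (hx : x ∈ Set.Icc (zMin A) (zMax A)) : (x : ℂ) ∈ annulus A := by
  have h0 : 0 < x := (zMin_pos A).trans_le hx.1
  simpa [annulus, abs_of_pos h0] using hx

theorem Qterm_ofReal (A : ℤ → ℤ → Matrix S S ℝ) (n : ℕ) (x : ℝ) :
    Qterm A n x = (levelSum (fun i => Ar A i x) n 0 0).map Complex.ofReal := by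
  rw [Qterm_eq]
  have := map_levelSum (Complex.ofRealHom.mapMatrix (m := S)) (fun i => Ar A i x) n 0 0
  simp only [RingHom.mapMatrix_apply] at this
  rw [show (fun i => Acol A i (x : ℂ)) = fun i => (Ar A i x).map Complex.ofRealHom from
    funext fun i => Acol_ofReal A i x, ← this]
  rfl

theorem N₁_ofReal (hA : Blocks A) (hc : Critical A w y u g) {x : ℝ}
    (hx : x ∈ Set.Icc (zMin A) (zMax A)) : N₁ A x = (Nr A x).map Complex.ofReal := by
  ext a b
  rw [N₁, tsum_matrix_apply (summable_Qterm hA hc (ofReal_mem_annulus hx)), Matrix.map_apply, Nr,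
    tsum_matrix_apply (summable_levelSum_real hA hc hx), Complex.ofReal_tsum]
  simp only [Qterm_ofReal, Matrix.map_apply]

theorem Nr_nonneg (hA : Blocks A) (hc : Critical A w y u g) {x : ℝ}
    (hx : x ∈ Set.Icc (zMin A) (zMax A)) (a b : S) : 0 ≤ Nr A x a b := by
  rw [Nr, tsum_matrix_apply (summable_levelSum_real hA hc hx)]
  exact tsum_nonneg fun n => levelSum_nonneg (B := fun i => Ar A i x)
      (hA.Ar_nonneg ((zMin_pos A).trans_le hx.1)) n 0 0 a b

/-- Eigenvector form of the minimality of G₁: every superharmonic pair dominates it. It bounds the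
spectrum of G₁ and later singles out the smaller root of χ. -/
theorem Nr_mulVec_le (hA : Blocks A) (hc : Critical A w y u g) {x : ℝ}
    (hx : x ∈ Set.Icc (zMin A) (zMax A)) {w' : ℝ} (hw' : 0 < w') {y' : S → ℝ} (hy' : ∀ a, 0 < y' a)
    (hsup : ∀ a, (Cr A x w' *ᵥ y') a ≤ y' a) (a : S) :
    ((Nr A x * Ar A (-1) x) *ᵥ y') a ≤ w' * y' a := by
  have hs := (summable_levelSum_real hA hc hx).hasSum
  have h1 : HasSum (fun n => (levelSum (fun i => Ar A i x) n 0 0 *ᵥ (Ar A (-1) x *ᵥ y')) a)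
      ((Nr A x *ᵥ (Ar A (-1) x *ᵥ y')) a) := by
    simp only [Matrix.mulVec, dotProduct]
    refine hasSum_sum fun b _ => HasSum.mul_right _ ?_
    exact Pi.hasSum.1 (Pi.hasSum.1 hs a) b
  rw [← Matrix.mulVec_mulVec]
  refine le_of_tendsto h1.tendsto_sum_nat (Eventually.of_forall fun M => ?_)
  have hbd := sum_exit_le (B := fun i => Ar A i x) (hA.Ar_nonneg ((zMin_pos A).trans_le hx.1)) hw'
    (fun a => (hy' a).le) (fun a => by
    have := hsup a
    rw [Cr_eq] at this
    simpa [Matrix.add_mulVec, Matrix.smul_mulVec] using this) M 0 a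
  rw [zero_add, pow_one, Finset.sum_apply] at hbd
  exact hbd

theorem vecMul_Nr_le (hA : Blocks A) (hc : Critical A w y u g) {x : ℝ}
    (hx : x ∈ Set.Icc (zMin A) (zMax A)) {w' : ℝ} (hw' : 0 < w') {u' : S → ℝ} (hu' : ∀ a, 0 < u' a)
    (hsup : ∀ a, (u' ᵥ* Cr A x w') a ≤ u' a) (a : S) :
    (u' ᵥ* (Ar A 1 x * Nr A x)) a ≤ w'⁻¹ * u' a := by
  have hs := (summable_levelSum_real hA hc hx).hasSum
  have h1 : HasSum (fun n => ((u' ᵥ* Ar A 1 x) ᵥ* levelSum (fun i => Ar A i x) n 0 0) a)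
      (((u' ᵥ* Ar A 1 x) ᵥ* Nr A x) a) := by
    change HasSum (fun n => ∑ b, (u' ᵥ* Ar A 1 x) b * levelSum (fun i => Ar A i x) n 0 0 b a)
      (∑ b, (u' ᵥ* Ar A 1 x) b * Nr A x b a)
    refine hasSum_sum fun b _ => HasSum.mul_left _ ?_
    exact Pi.hasSum.1 (Pi.hasSum.1 hs b) a
  rw [← Matrix.vecMul_vecMul]
  refine le_of_tendsto h1.tendsto_sum_nat (Eventually.of_forall fun M => ?_)
  have hbd := sum_entrance_le (B := fun i => Ar A i x) (hA.Ar_nonneg ((zMin_pos A).trans_le hx.1))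
    hw' (fun a => (hu' a).le) (fun a => by
    have := hsup a
    rw [Cr_eq] at this
    simpa [Matrix.vecMul_add, Matrix.vecMul_smul] using this) M a
  rw [Finset.sum_apply] at hbd
  exact hbd

end Series

/-! ### Wiener–Hopf factorization at the branch point -/

section Fold

variable {S : Type*} [Fintype S] [DecidableEq S]

/-- Entrywise coercion of real matrices. -/
abbrev toC (M : Matrix S S ℝ) : Matrix S S ℂ := M.map Complex.ofReal

/-- Entrywise coercion of real vectors. -/
abbrev vecC (x : S → ℝ) : S → ℂ := fun a => (x a : ℂ)

theorem toC_mul (M M' : Matrix S S ℝ) : toC (M * M') = toC M * toC M' :=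
  Matrix.map_mul (f := Complex.ofRealHom)

theorem toC_add (M M' : Matrix S S ℝ) : toC (M + M') = toC M + toC M' := by
  ext; simp

theorem toC_smul (c : ℝ) (M : Matrix S S ℝ) : toC (c • M) = (c : ℂ) • toC M := by
  ext; simp

theorem toC_one : toC (1 : Matrix S S ℝ) = 1 := by
  ext a b
  simp only [Matrix.map_apply, Matrix.one_apply]
  split_ifs <;> simp

theorem toC_mulVec (M : Matrix S S ℝ) (x : S → ℝ) : toC M *ᵥ vecC x = vecC (M *ᵥ x) :=
  map_ofReal_mulVec M x

theorem vecMul_toC (M : Matrix S S ℝ) (x : S → ℝ) : vecC x ᵥ* toC M = vecC (x ᵥ* M) :=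
  vecMul_map_ofReal M x

theorem vecC_dotProduct (x x' : S → ℝ) : vecC x ⬝ᵥ vecC x' = ((x ⬝ᵥ x' : ℝ) : ℂ) := by
  simp [dotProduct]

theorem vecC_smul (c : ℝ) (x : S → ℝ) : vecC (c • x) = (c : ℂ) • vecC x := by
  ext; simp [vecC]

theorem vecC_ne_zero {x : S → ℝ} (hx : x ≠ 0) : vecC x ≠ 0 := fun h =>
  hx (funext fun a => by simpa using congrFun h a)

/-- If the right kernel of a square matrix has dimension at most one, so has the left kernel. -/
theorem left_kernel_unique {M : Matrix S S ℂ} {y : S → ℂ}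
    (h : ∀ x, M *ᵥ x = 0 → ∃ c : ℂ, x = c • y) {ψ φ : S → ℂ} (hψ0 : ψ ≠ 0) (hψ : ψ ᵥ* M = 0)
    (hφ : φ ᵥ* M = 0) : ∃ c : ℂ, φ = c • ψ := by
  have h1 : Module.finrank ℂ (LinearMap.ker M.mulVecLin) ≤ 1 := by
    have hle : LinearMap.ker M.mulVecLin ≤ Submodule.span ℂ {y} := fun x hx => by
      obtain ⟨c, rfl⟩ := h x (by simpa using hx)
      exact Submodule.smul_mem _ _ (Submodule.mem_span_singleton_self y)
    exact (Submodule.finrank_mono hle).trans ((finrank_span_le_card {y}).trans (by simp))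
  have h2 := LinearMap.finrank_range_add_finrank_ker M.mulVecLin
  have h3 := LinearMap.finrank_range_add_finrank_ker Mᵀ.mulVecLin
  have h4 : Module.finrank ℂ (LinearMap.range M.mulVecLin)
      = Module.finrank ℂ (LinearMap.range Mᵀ.mulVecLin) := (Matrix.rank_transpose M).symm
  have h5 : Module.finrank ℂ (LinearMap.ker Mᵀ.mulVecLin) ≤ 1 := by omega
  have hmem : ∀ χ : S → ℂ, χ ᵥ* M = 0 → χ ∈ LinearMap.ker Mᵀ.mulVecLin := fun χ hχ => by
    simp [hχ]
  have h6 : Submodule.span ℂ {ψ} = LinearMap.ker Mᵀ.mulVecLin := by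
    refine Submodule.eq_of_le_of_finrank_le ?_ ?_
    · rw [Submodule.span_singleton_le_iff_mem]; exact hmem ψ hψ
    · rw [finrank_span_singleton hψ0]; exact h5
  have h7 := hmem φ hφ
  rw [← h6, Submodule.mem_span_singleton] at h7
  obtain ⟨c, hc⟩ := h7
  exact ⟨c, hc.symm⟩

theorem right_kernel_unique {M : Matrix S S ℂ} {u : S → ℂ}
    (h : ∀ φ, φ ᵥ* M = 0 → ∃ c : ℂ, φ = c • u) {v x : S → ℂ} (hv0 : v ≠ 0) (hv : M *ᵥ v = 0)
    (hx : M *ᵥ x = 0) : ∃ c : ℂ, x = c • v := by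
  refine left_kernel_unique (M := Mᵀ) (y := u) (fun φ hφ => h φ ?_) hv0 ?_ ?_
  · rwa [Matrix.mulVec_transpose] at hφ
  · rwa [Matrix.vecMul_transpose]
  · rwa [Matrix.vecMul_transpose]

/-- The matrices and vectors at the branch point: `Bm`, `B0`, `Bp` are the columns `A_{*,j}` and
`N` is `N₁`. -/
structure Fold (Bm B0 Bp N : Matrix S S ℝ) (w : ℝ) (y u g : S → ℝ) : Prop where
  Bm_nonneg : ∀ a b, 0 ≤ Bm a b
  Bp_nonneg : ∀ a b, 0 ≤ Bp a b
  N_nonneg : ∀ a b, 0 ≤ N a b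
  w_pos : 0 < w
  y_pos : ∀ a, 0 < y a
  u_pos : ∀ a, 0 < u a
  N_eq : N = 1 + B0 * N + Bp * (N * Bm * N)
  right : (w⁻¹ • Bm + B0 + w • Bp) *ᵥ y = y
  left : u ᵥ* (w⁻¹ • Bm + B0 + w • Bp) = u
  poisson : (w⁻¹ • Bm + B0 + w • Bp) *ᵥ g - g = -((-(w⁻¹ • Bm) + w • Bp) *ᵥ y)
  G_le : ∀ a, ((N * Bm) *ᵥ y) a ≤ w * y a
  R_le : ∀ a, (u ᵥ* (Bp * N)) a ≤ w⁻¹ * u a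
  right_unique : ∀ x : S → ℂ, toC (w⁻¹ • Bm + B0 + w • Bp) *ᵥ x = x → ∃ c : ℂ, x = c • vecC y
  left_unique : ∀ x : S → ℂ, x ᵥ* toC (w⁻¹ • Bm + B0 + w • Bp) = x → ∃ c : ℂ, x = c • vecC u
  circle : ∀ (μ : ℂ) (x : S → ℂ), x ≠ 0 → ‖μ‖ = w →
    (μ⁻¹ • toC Bm + toC B0 + μ • toC Bp) *ᵥ x = x → μ = w

namespace Fold

variable {Bm B0 Bp N : Matrix S S ℝ} {w : ℝ} {y u g : S → ℝ}

/-- This matrix is the middle factor V in 1 - C(w) = (1 - wR) V (1 - w⁻¹G), with `G = N * Bm` and `R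
= Bp * N`; `mul_G` and `R_mul` are the two products needed for the factorization. -/
theorem left_inv (h : Fold Bm B0 Bp N w y u g) : (1 - (B0 + Bp * N * Bm)) * N = 1 := by
  have := h.N_eq
  calc (1 - (B0 + Bp * N * Bm)) * N = N - (B0 * N + Bp * (N * Bm * N)) := by noncomm_ring
    _ = 1 := by
      rw [sub_eq_iff_eq_add, ← add_assoc]
      exact this

theorem right_inv (h : Fold Bm B0 Bp N w y u g) : N * (1 - (B0 + Bp * N * Bm)) = 1 :=
  mul_eq_one_comm.1 h.left_inv

theorem mul_G (h : Fold Bm B0 Bp N w y u g) : (1 - (B0 + Bp * N * Bm)) * (N * Bm) = Bm := by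
  rw [← Matrix.mul_assoc, h.left_inv, Matrix.one_mul]

theorem R_mul (h : Fold Bm B0 Bp N w y u g) : (Bp * N) * (1 - (B0 + Bp * N * Bm)) = Bp := by
  rw [Matrix.mul_assoc, h.right_inv, Matrix.mul_one]

/-- Since `u R ≤ w⁻¹ u`, the operator `w R` does not increase the ℓ¹ norm weighted by `u`. -/
theorem bounded (h : Fold Bm B0 Bp N w y u g) (x : S → ℝ) :
    u ⬝ᵥ (fun a => |(w • ((Bp * N) *ᵥ x)) a|) ≤ u ⬝ᵥ fun a => |x a| := by
  have hR : ∀ a b, 0 ≤ (Bp * N) a b := fun a b =>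
    Finset.sum_nonneg fun c _ => mul_nonneg (h.Bp_nonneg a c) (h.N_nonneg c b)
  have h1 : ∀ a, |(w • ((Bp * N) *ᵥ x)) a| ≤ w * ((Bp * N) *ᵥ fun b => |x b|) a := by
    intro a
    rw [Pi.smul_apply, smul_eq_mul, abs_mul, abs_of_pos h.w_pos]
    refine mul_le_mul_of_nonneg_left ?_ h.w_pos.le
    refine (Finset.abs_sum_le_sum_abs _ _).trans (Finset.sum_le_sum fun b _ => ?_)
    rw [abs_mul, abs_of_nonneg (hR a b)]
  calc u ⬝ᵥ (fun a => |(w • ((Bp * N) *ᵥ x)) a|)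
      ≤ u ⬝ᵥ fun a => w * ((Bp * N) *ᵥ fun b => |x b|) a :=
        Finset.sum_le_sum fun a _ => mul_le_mul_of_nonneg_left (h1 a) (h.u_pos a).le
    _ = w * ((u ᵥ* (Bp * N)) ⬝ᵥ fun b => |x b|) := by
        rw [← Matrix.dotProduct_mulVec]
        simp only [dotProduct, Finset.mul_sum]
        exact Finset.sum_congr rfl fun a _ => by ring
    _ ≤ w * ((w⁻¹ • u) ⬝ᵥ fun b => |x b|) :=
        mul_le_mul_of_nonneg_left (Finset.sum_le_sum fun a _ =>
          mul_le_mul_of_nonneg_right (h.R_le a) (abs_nonneg _)) h.w_pos.le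
    _ = u ⬝ᵥ fun a => |x a| := by
        rw [smul_dotProduct, smul_eq_mul, ← mul_assoc, mul_inv_cancel₀ h.w_pos.ne', one_mul]

/-- The second vector of the Jordan chain of `w R₁`. -/
noncomputable def chain (Bm B0 Bp N : Matrix S S ℝ) (w : ℝ) (y g : S → ℝ) : S → ℝ :=
  (1 - (B0 + Bp * N * Bm)) *ᵥ (g - w⁻¹ • ((N * Bm) *ᵥ g) + w⁻¹ • ((N * Bm) *ᵥ y))

theorem mulVec_defect (h : Fold Bm B0 Bp N w y u g) :
    (1 - (B0 + Bp * N * Bm)) *ᵥ (y - w⁻¹ • ((N * Bm) *ᵥ y))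
      = y - B0 *ᵥ y - Bp *ᵥ ((N * Bm) *ᵥ y) - w⁻¹ • (Bm *ᵥ y) := by
  rw [Matrix.mulVec_sub, Matrix.mulVec_smul, Matrix.mulVec_mulVec, h.mul_G, Matrix.sub_mulVec,
    Matrix.add_mulVec, Matrix.one_mulVec, Matrix.mulVec_mulVec, Matrix.mul_assoc]
  abel

/-- This is the Poisson equation for `g` read through the factorization: differentiating 1 - C in
log w also differentiates the factor 1 - w⁻¹G, whence the term `w⁻¹ G y` in `chain`. -/
theorem R_chain (h : Fold Bm B0 Bp N w y u g) :
    w • ((Bp * N) *ᵥ chain Bm B0 Bp N w y g) = chain Bm B0 Bp N w y g -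
      (1 - (B0 + Bp * N * Bm)) *ᵥ (y - w⁻¹ • ((N * Bm) *ᵥ y)) := by
  have hp := h.poisson
  have hr := h.right
  have hw := h.w_pos.ne'
  have e1 : (Bp * N) *ᵥ chain Bm B0 Bp N w y g =
      Bp *ᵥ (g - w⁻¹ • ((N * Bm) *ᵥ g) + w⁻¹ • ((N * Bm) *ᵥ y)) := by
    rw [chain, Matrix.mulVec_mulVec, h.R_mul]
  have e2 : chain Bm B0 Bp N w y g = (g - B0 *ᵥ g - Bp *ᵥ ((N * Bm) *ᵥ g)) - w⁻¹ • (Bm *ᵥ g)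
      + w⁻¹ • (Bm *ᵥ y) := by
    rw [chain, Matrix.mulVec_add, Matrix.mulVec_sub, Matrix.mulVec_smul, Matrix.mulVec_smul,
      Matrix.mulVec_mulVec, Matrix.mulVec_mulVec, h.mul_G, Matrix.sub_mulVec, Matrix.add_mulVec,
      Matrix.one_mulVec, Matrix.mulVec_mulVec, Matrix.mul_assoc]
    abel
  rw [e1, e2, h.mulVec_defect]
  ext a
  have hpa := congrFun hp a
  have hra := congrFun hr a
  simp only [Matrix.add_mulVec, Matrix.smul_mulVec, Matrix.neg_mulVec, Matrix.mulVec_add,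
    Matrix.mulVec_sub, Matrix.mulVec_smul, Pi.add_apply, Pi.sub_apply, Pi.smul_apply, Pi.neg_apply,
    smul_eq_mul] at hpa hra ⊢
  field_simp
  field_simp at hpa hra
  linarith

/-- With `E = V (y - w⁻¹ G y)`, the factorization gives `w R E = E`, and the Poisson equation gives
`w R e1 = e1 - E`. If `E` were nonzero, the iterates `e1 - n E` would grow linearly, although `w R`
is nonexpansive. Thus zero drift rules out a strict inequality in `G y ≤ w y`. -/
theorem G_mulVec (h : Fold Bm B0 Bp N w y u g) : (N * Bm) *ᵥ y = w • y := by
  set E := (1 - (B0 + Bp * N * Bm)) *ᵥ (y - w⁻¹ • ((N * Bm) *ᵥ y)) with hE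
  set e1 := chain Bm B0 Bp N w y g with he1
  have hRe : w • ((Bp * N) *ᵥ E) = E := by
    rw [hE, Matrix.mulVec_mulVec, h.R_mul]
    rw [h.mulVec_defect]
    ext a
    have hra := congrFun h.right a
    have hw := h.w_pos.ne'
    simp only [Matrix.add_mulVec, Matrix.smul_mulVec, Matrix.mulVec_sub, Matrix.mulVec_smul,
      Pi.add_apply, Pi.sub_apply, Pi.smul_apply, smul_eq_mul] at hra ⊢
    field_simp
    field_simp at hra
    linarith
  have hiter : ∀ n : ℕ, u ⬝ᵥ (fun a => |(e1 - (n : ℝ) • E) a|) ≤ u ⬝ᵥ fun a => |e1 a| := by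
    intro n
    induction n with
    | zero => simp
    | succ n ih =>
      refine le_trans (le_of_eq ?_) ((h.bounded _).trans ih)
      rw [Matrix.mulVec_sub, smul_sub, Matrix.mulVec_smul, smul_comm w, hRe, he1, h.R_chain, ← hE]
      congr 1
      ext a
      congr 1
      simp only [Pi.sub_apply, Pi.smul_apply, smul_eq_mul]
      push_cast
      ring
  have hE0 : E = 0 := by
    by_contra hne
    have hpos : 0 < u ⬝ᵥ fun a => |E a| := by
      obtain ⟨a, ha⟩ := Function.ne_iff.1 hne
      exact Finset.sum_pos' (fun b _ => mul_nonneg (h.u_pos b).le (abs_nonneg _))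
        ⟨a, Finset.mem_univ a, mul_pos (h.u_pos a) (abs_pos.2 ha)⟩
    obtain ⟨n, hn⟩ := exists_nat_gt (2 * (u ⬝ᵥ fun a => |e1 a|) / u ⬝ᵥ fun a => |E a|)
    rw [div_lt_iff₀ hpos] at hn
    have h1 : (n : ℝ) * (u ⬝ᵥ fun a => |E a|) ≤
        (u ⬝ᵥ fun a => |(e1 - (n : ℝ) • E) a|) + u ⬝ᵥ fun a => |e1 a| := by
      simp only [dotProduct, Finset.mul_sum, ← Finset.sum_add_distrib]
      refine Finset.sum_le_sum fun a _ => ?_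
      rw [← mul_add, mul_left_comm]
      refine mul_le_mul_of_nonneg_left ?_ (h.u_pos a).le
      have h2 : (n : ℝ) * |E a| = |e1 a - (e1 - (n : ℝ) • E) a| := by
        simp only [Pi.sub_apply, Pi.smul_apply, smul_eq_mul, sub_sub_cancel, abs_mul, Nat.abs_cast]
      rw [h2, add_comm]
      exact abs_sub _ _
    linarith [hiter n]
  have hd : y - w⁻¹ • ((N * Bm) *ᵥ y) = 0 := by
    have := congrArg (N *ᵥ ·) hE0
    simp only [hE, Matrix.mulVec_mulVec, h.right_inv, Matrix.one_mulVec, Matrix.mulVec_zero] at this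
    exact this
  rw [sub_eq_zero] at hd
  conv_rhs => rw [hd]
  rw [smul_smul, mul_inv_cancel₀ h.w_pos.ne', one_smul]

/-- The defect `f = u - w u R` is nonnegative. Zero drift makes `f V` orthogonal to `y`, so the
nonnegative vector `f Bm = f V G` is orthogonal to `y` as well and vanishes. The factorization then
yields `f V = w⁻¹ f Bm = 0`, and V is invertible. -/
theorem vecMul_R (h : Fold Bm B0 Bp N w y u g) : u ᵥ* (Bp * N) = w⁻¹ • u := by
  have hw := h.w_pos.ne'
  set f := u - w • (u ᵥ* (Bp * N)) with hf
  set V := 1 - (B0 + Bp * N * Bm) with hV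
  have hf0 : ∀ a, 0 ≤ f a := fun a => by
    have := mul_le_mul_of_nonneg_left (h.R_le a) h.w_pos.le
    rw [← mul_assoc, mul_inv_cancel₀ hw, one_mul] at this
    simpa [hf] using this
  have hfV : f ᵥ* V = u ᵥ* V - w • (u ᵥ* Bp) := by
    rw [hf, Matrix.sub_vecMul, Matrix.smul_vecMul, Matrix.vecMul_vecMul, h.R_mul]
  have hV1 : V *ᵥ y = w⁻¹ • (Bm *ᵥ y) := by
    have h1 : V *ᵥ ((N * Bm) *ᵥ y) = Bm *ᵥ y := by rw [Matrix.mulVec_mulVec, h.mul_G]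
    rw [h.G_mulVec, Matrix.mulVec_smul] at h1
    rw [← h1, smul_smul, inv_mul_cancel₀ hw, one_smul]
  have hdrift : u ⬝ᵥ ((-(w⁻¹ • Bm) + w • Bp) *ᵥ y) = 0 := by
    have h1 : u ⬝ᵥ ((w⁻¹ • Bm + B0 + w • Bp) *ᵥ g - g) = 0 := by
      rw [dotProduct_sub, Matrix.dotProduct_mulVec, h.left, sub_self]
    rw [h.poisson, dotProduct_neg, neg_eq_zero] at h1
    exact h1
  have hfVy : (f ᵥ* V) ⬝ᵥ y = 0 := by
    rw [hfV, sub_dotProduct, ← Matrix.dotProduct_mulVec, hV1, smul_dotProduct,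
      ← Matrix.dotProduct_mulVec]
    rw [Matrix.add_mulVec, Matrix.neg_mulVec, Matrix.smul_mulVec, Matrix.smul_mulVec,
      dotProduct_add, dotProduct_neg, dotProduct_smul, dotProduct_smul] at hdrift
    rw [dotProduct_smul]
    linarith
  have hfBm : (f ᵥ* Bm) ⬝ᵥ y = 0 := by
    rw [← h.mul_G, ← Matrix.vecMul_vecMul, ← Matrix.dotProduct_mulVec, h.G_mulVec,
      dotProduct_smul, hfVy, smul_zero]
  have hfBm0 : f ᵥ* Bm = 0 := by
    have hnn : ∀ b, 0 ≤ (f ᵥ* Bm) b := fun b =>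
      Finset.sum_nonneg fun a _ => mul_nonneg (hf0 a) (h.Bm_nonneg a b)
    ext b
    exact (mul_eq_zero.1 ((Finset.sum_eq_zero_iff_of_nonneg fun b _ =>
      mul_nonneg (hnn b) (h.y_pos b).le).1 hfBm b (Finset.mem_univ b))).resolve_right (h.y_pos b).ne'
  have hfact : f ᵥ* V = w⁻¹ • (f ᵥ* Bm) := by
    have h1 : V - w • Bp - w⁻¹ • Bm + Bp * (N * Bm) = 1 - (w⁻¹ • Bm + B0 + w • Bp) := by
      rw [hV, Matrix.mul_assoc]; abel
    have h2 : u ᵥ* (V - w • Bp - w⁻¹ • Bm + Bp * (N * Bm)) = 0 := by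
      rw [h1, Matrix.vecMul_sub, Matrix.vecMul_one, h.left, sub_self]
    rw [Matrix.vecMul_add, Matrix.vecMul_sub, Matrix.vecMul_sub, Matrix.vecMul_smul,
      Matrix.vecMul_smul, ← hfV] at h2
    have h3 : f ᵥ* Bm = u ᵥ* Bm - w • (u ᵥ* (Bp * (N * Bm))) := by
      rw [hf, Matrix.sub_vecMul, Matrix.smul_vecMul, Matrix.vecMul_vecMul, Matrix.mul_assoc]
    rw [h3, smul_sub, smul_smul, inv_mul_cancel₀ hw, one_smul]
    have h4 : f ᵥ* V - (w⁻¹ • (u ᵥ* Bm) - u ᵥ* (Bp * (N * Bm))) = 0 := by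
      rw [← h2]; abel
    exact sub_eq_zero.1 h4
  have hf1 : f = 0 := by
    rw [hfBm0, smul_zero] at hfact
    have := congrArg (· ᵥ* N) hfact
    simpa only [Matrix.vecMul_vecMul, hV, h.left_inv, Matrix.vecMul_one, Matrix.zero_vecMul]
      using this
  rw [hf, sub_eq_zero] at hf1
  conv_rhs => rw [hf1]
  rw [smul_smul, inv_mul_cancel₀ hw, one_smul]

end Fold

end Fold

/-! ### Eigenvectors of G and R, and the kernel of the linearization -/

section FoldComplex

variable {S : Type*} [Fintype S] [DecidableEq S]

namespace Fold

variable {Bm B0 Bp N : Matrix S S ℝ} {w : ℝ} {y u g : S → ℝ}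

theorem toC_sub (M M' : Matrix S S ℝ) : toC (M - M') = toC M - toC M' := by
  ext; simp

theorem toC_one_sub (Bm B0 Bp N : Matrix S S ℝ) :
    toC (1 - (B0 + Bp * N * Bm)) = 1 - (toC B0 + toC Bp * toC N * toC Bm) := by
  rw [toC_sub, toC_one, toC_add, toC_mul, toC_mul]

theorem wC_ne_zero (h : Fold Bm B0 Bp N w y u g) : (w : ℂ) ≠ 0 := by
  exact_mod_cast h.w_pos.ne'

theorem mul_G_complex (h : Fold Bm B0 Bp N w y u g) :
    (1 - (toC B0 + toC Bp * toC N * toC Bm)) * (toC N * toC Bm) = toC Bm := by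
  rw [← toC_one_sub, ← toC_mul, ← toC_mul, h.mul_G]

theorem R_mul_complex (h : Fold Bm B0 Bp N w y u g) :
    (toC Bp * toC N) * (1 - (toC B0 + toC Bp * toC N * toC Bm)) = toC Bp := by
  rw [← toC_one_sub, ← toC_mul, ← toC_mul, h.R_mul]

theorem right_inv_complex (h : Fold Bm B0 Bp N w y u g) :
    toC N * (1 - (toC B0 + toC Bp * toC N * toC Bm)) = 1 := by
  rw [← toC_one_sub, ← toC_mul, h.right_inv, toC_one]

/-- The factorization of 1 - C(μ) has 1 - μ⁻¹G as its rightmost factor. This transfers uniqueness of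
eigenvectors from the irreducible C to G, which need not be irreducible. -/
theorem C_mulVec_of_G (h : Fold Bm B0 Bp N w y u g) {μ : ℂ} (hμ : μ ≠ 0) {x : S → ℂ}
    (hx : (toC N * toC Bm) *ᵥ x = μ • x) :
    (μ⁻¹ • toC Bm + toC B0 + μ • toC Bp) *ᵥ x = x := by
  have h1 : (1 - (toC B0 + toC Bp * toC N * toC Bm)) *ᵥ ((toC N * toC Bm) *ᵥ x) = toC Bm *ᵥ x := by
    rw [Matrix.mulVec_mulVec, h.mul_G_complex]
  have h2 : (toC Bp * toC N * toC Bm) *ᵥ x = μ • (toC Bp *ᵥ x) := by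
    rw [Matrix.mul_assoc, ← Matrix.mulVec_mulVec, hx, Matrix.mulVec_smul]
  rw [hx, Matrix.mulVec_smul, Matrix.sub_mulVec, Matrix.add_mulVec, Matrix.one_mulVec, h2] at h1
  rw [Matrix.add_mulVec, Matrix.add_mulVec, Matrix.smul_mulVec, Matrix.smul_mulVec, ← h1, smul_smul,
    inv_mul_cancel₀ hμ, one_smul]
  abel

theorem vecMul_C_of_R (h : Fold Bm B0 Bp N w y u g) {φ : S → ℂ}
    (hφ : φ ᵥ* (toC Bp * toC N) = (w : ℂ)⁻¹ • φ) :
    φ ᵥ* ((w : ℂ)⁻¹ • toC Bm + toC B0 + (w : ℂ) • toC Bp) = φ := by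
  have h1 : (φ ᵥ* (toC Bp * toC N)) ᵥ* (1 - (toC B0 + toC Bp * toC N * toC Bm)) = φ ᵥ* toC Bp := by
    rw [Matrix.vecMul_vecMul, h.R_mul_complex]
  have h2 : φ ᵥ* (toC Bp * toC N * toC Bm) = (w : ℂ)⁻¹ • (φ ᵥ* toC Bm) := by
    rw [← Matrix.vecMul_vecMul, hφ, Matrix.smul_vecMul]
  rw [hφ, Matrix.smul_vecMul, Matrix.vecMul_sub, Matrix.vecMul_add, Matrix.vecMul_one, h2] at h1
  rw [Matrix.vecMul_add, Matrix.vecMul_add, Matrix.vecMul_smul, Matrix.vecMul_smul, ← h1, smul_smul,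
    mul_inv_cancel₀ h.wC_ne_zero, one_smul]
  abel

theorem toC_C (Bm B0 Bp : Matrix S S ℝ) (w : ℝ) : toC (w⁻¹ • Bm + B0 + w • Bp)
    = (w : ℂ)⁻¹ • toC Bm + toC B0 + (w : ℂ) • toC Bp := by
  rw [toC_add, toC_add, toC_smul, toC_smul, Complex.ofReal_inv]

theorem G_mulVec_complex (h : Fold Bm B0 Bp N w y u g) :
    (toC N * toC Bm) *ᵥ vecC y = (w : ℂ) • vecC y := by
  rw [← toC_mul, toC_mulVec, h.G_mulVec, vecC_smul]

theorem vecMul_R_complex (h : Fold Bm B0 Bp N w y u g) :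
    vecC u ᵥ* (toC Bp * toC N) = (w : ℂ)⁻¹ • vecC u := by
  rw [← toC_mul, vecMul_toC, h.vecMul_R, vecC_smul, Complex.ofReal_inv]

theorem G_right_unique (h : Fold Bm B0 Bp N w y u g) {x : S → ℂ}
    (hx : (toC N * toC Bm) *ᵥ x = (w : ℂ) • x) : ∃ c : ℂ, x = c • vecC y :=
  h.right_unique x (by rw [toC_C]; exact h.C_mulVec_of_G h.wC_ne_zero hx)

theorem G_left_unique (h : Fold Bm B0 Bp N w y u g) {ψ φ : S → ℂ} (hψ0 : ψ ≠ 0)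
    (hψ : ψ ᵥ* (toC N * toC Bm) = (w : ℂ) • ψ) (hφ : φ ᵥ* (toC N * toC Bm) = (w : ℂ) • φ) :
    ∃ c : ℂ, φ = c • ψ := by
  refine left_kernel_unique (M := toC N * toC Bm - (w : ℂ) • 1) (y := vecC y) (fun x hx => ?_) hψ0 ?_ ?_
  · rw [Matrix.sub_mulVec, Matrix.smul_mulVec, Matrix.one_mulVec, sub_eq_zero] at hx
    exact h.G_right_unique hx
  · rw [Matrix.vecMul_sub, Matrix.vecMul_smul, Matrix.vecMul_one, hψ, sub_self]
  · rw [Matrix.vecMul_sub, Matrix.vecMul_smul, Matrix.vecMul_one, hφ, sub_self]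

theorem R_right_unique (h : Fold Bm B0 Bp N w y u g) {v x : S → ℂ} (hv0 : v ≠ 0)
    (hv : (toC Bp * toC N) *ᵥ v = (w : ℂ)⁻¹ • v) (hx : (toC Bp * toC N) *ᵥ x = (w : ℂ)⁻¹ • x) :
    ∃ c : ℂ, x = c • v := by
  refine right_kernel_unique (M := toC Bp * toC N - (w : ℂ)⁻¹ • 1) (u := vecC u) (fun φ hφ => ?_)
    hv0 ?_ ?_
  · rw [Matrix.vecMul_sub, Matrix.vecMul_smul, Matrix.vecMul_one, sub_eq_zero] at hφ
    exact h.left_unique φ (by rw [toC_C]; exact h.vecMul_C_of_R hφ)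
  · rw [Matrix.sub_mulVec, Matrix.smul_mulVec, Matrix.one_mulVec, hv, sub_self]
  · rw [Matrix.sub_mulVec, Matrix.smul_mulVec, Matrix.one_mulVec, hx, sub_self]

theorem mul_nonneg' {M M' : Matrix S S ℝ} (h : ∀ a b, 0 ≤ M a b) (h' : ∀ a b, 0 ≤ M' a b) (a b : S) :
    0 ≤ (M * M') a b :=
  Finset.sum_nonneg fun c _ => mul_nonneg (h a c) (h' c b)

theorem exists_left_G [Nonempty S] (h : Fold Bm B0 Bp N w y u g) :
    ∃ ψ : S → ℝ, (∀ a, 0 ≤ ψ a) ∧ ψ ≠ 0 ∧ ψ ᵥ* (N * Bm) = w • ψ :=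
  exists_left_fixed_nonneg (mul_nonneg' h.N_nonneg h.Bm_nonneg) h.y_pos h.G_mulVec

theorem exists_right_R [Nonempty S] (h : Fold Bm B0 Bp N w y u g) :
    ∃ v : S → ℝ, (∀ a, 0 ≤ v a) ∧ v ≠ 0 ∧ (Bp * N) *ᵥ v = w⁻¹ • v := by
  obtain ⟨v, h1, h2, h3⟩ := exists_left_fixed_nonneg (M := (Bp * N)ᵀ)
    (fun a b => mul_nonneg' h.Bp_nonneg h.N_nonneg b a) h.u_pos
    (by rw [Matrix.mulVec_transpose]; exact h.vecMul_R)
  exact ⟨v, h1, h2, by rwa [Matrix.vecMul_transpose] at h3⟩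

theorem dotProduct_pos_of {x z : S → ℝ} (hx : ∀ a, 0 < x a) (hz : ∀ a, 0 ≤ z a) (hz0 : z ≠ 0) :
    0 < x ⬝ᵥ z := by
  obtain ⟨a, ha⟩ := Function.ne_iff.1 hz0
  exact Finset.sum_pos' (fun b _ => mul_nonneg (hx b).le (hz b))
    ⟨a, Finset.mem_univ a, mul_pos (hx a) ((hz a).lt_of_ne' ha)⟩

theorem left_G_dotProduct_ne_zero [Nonempty S] (h : Fold Bm B0 Bp N w y u g) {ψ : S → ℂ} (hψ0 : ψ ≠ 0)
    (hψ : ψ ᵥ* (toC N * toC Bm) = (w : ℂ) • ψ) : ψ ⬝ᵥ vecC y ≠ 0 := by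
  obtain ⟨ψ₀, h1, h2, h3⟩ := h.exists_left_G
  obtain ⟨c, rfl⟩ := h.G_left_unique (vecC_ne_zero h2)
    (by rw [← toC_mul, vecMul_toC, h3, vecC_smul]) hψ
  have hc : c ≠ 0 := fun hc => hψ0 (by rw [hc, zero_smul])
  rw [smul_dotProduct, vecC_dotProduct, smul_eq_mul, dotProduct_comm]
  refine mul_ne_zero hc ?_
  exact_mod_cast (dotProduct_pos_of h.y_pos h1 h2).ne'

theorem dotProduct_right_R_ne_zero [Nonempty S] (h : Fold Bm B0 Bp N w y u g) {v : S → ℂ} (hv0 : v ≠ 0)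
    (hv : (toC Bp * toC N) *ᵥ v = (w : ℂ)⁻¹ • v) : vecC u ⬝ᵥ v ≠ 0 := by
  obtain ⟨v₀, h1, h2, h3⟩ := h.exists_right_R
  obtain ⟨c, rfl⟩ := h.R_right_unique (vecC_ne_zero h2)
    (by rw [← toC_mul, toC_mulVec, h3, vecC_smul, Complex.ofReal_inv]) hv
  have hc : c ≠ 0 := fun hc => hv0 (by rw [hc, zero_smul])
  rw [dotProduct_smul, vecC_dotProduct, smul_eq_mul]
  refine mul_ne_zero hc ?_
  exact_mod_cast (dotProduct_pos_of h.u_pos h1 h2).ne'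

/-- Since now `G y = w y`, the vector `chain` satisfies the eigenvector equation of R and is
therefore a multiple of `v`. Applying `N` to it gives `g - w⁻¹ G g + y`; `ψ` kills the first two
terms together and is nonzero on `y`. -/
theorem left_N_right_ne_zero [Nonempty S] (h : Fold Bm B0 Bp N w y u g) {ψ v : S → ℂ} (hψ0 : ψ ≠ 0)
    (hψ : ψ ᵥ* (toC N * toC Bm) = (w : ℂ) • ψ) (hv0 : v ≠ 0)
    (hv : (toC Bp * toC N) *ᵥ v = (w : ℂ)⁻¹ • v) : ψ ⬝ᵥ (toC N *ᵥ v) ≠ 0 := by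
  have hw := h.w_pos.ne'
  have h1 : (Bp * N) *ᵥ chain Bm B0 Bp N w y g = w⁻¹ • chain Bm B0 Bp N w y g := by
    have := h.R_chain
    rw [h.G_mulVec, smul_smul, inv_mul_cancel₀ hw, one_smul, sub_self, Matrix.mulVec_zero,
      sub_zero] at this
    conv_rhs => rw [← this]
    rw [smul_smul, inv_mul_cancel₀ hw, one_smul]
  have h2 : N *ᵥ chain Bm B0 Bp N w y g = g - w⁻¹ • ((N * Bm) *ᵥ g) + y := by
    rw [chain, Matrix.mulVec_mulVec, h.right_inv, Matrix.one_mulVec, h.G_mulVec, smul_smul,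
      inv_mul_cancel₀ hw, one_smul]
  obtain ⟨c, hc⟩ := h.R_right_unique hv0 hv
    (by rw [← toC_mul, toC_mulVec, h1, vecC_smul, Complex.ofReal_inv] :
      (toC Bp * toC N) *ᵥ vecC (chain Bm B0 Bp N w y g) = (w : ℂ)⁻¹ • vecC (chain Bm B0 Bp N w y g))
  have h3 : ψ ⬝ᵥ (toC N *ᵥ vecC (chain Bm B0 Bp N w y g)) = ψ ⬝ᵥ vecC y := by
    have h4 : vecC (N *ᵥ chain Bm B0 Bp N w y g)
        = vecC g - (w : ℂ)⁻¹ • ((toC N * toC Bm) *ᵥ vecC g) + vecC y := by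
      rw [h2, ← toC_mul, toC_mulVec]
      ext a
      simp [vecC]
    rw [toC_mulVec, h4, dotProduct_add, dotProduct_sub, dotProduct_smul, Matrix.dotProduct_mulVec,
      hψ, smul_dotProduct, smul_smul, inv_mul_cancel₀ h.wC_ne_zero, one_smul, sub_self, zero_add]
  intro h0
  rw [hc, Matrix.mulVec_smul, dotProduct_smul, h0, smul_zero] at h3
  exact h.left_G_dotProduct_ne_zero hψ0 hψ h3.symm

theorem norm_G_eigenvalue_le (h : Fold Bm B0 Bp N w y u g) {x : S → ℂ} (hx : x ≠ 0) {μ : ℂ}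
    (hμ : (toC N * toC Bm) *ᵥ x = μ • x) : ‖μ‖ ≤ w := by
  refine norm_eigenvalue_le (M := N * Bm) (Z := toC N * toC Bm) (fun a b => ?_) h.y_pos h.G_le hx hμ
  rw [← toC_mul]
  simp [abs_of_nonneg (mul_nonneg' h.N_nonneg h.Bm_nonneg a b)]

theorem norm_R_eigenvalue_le (h : Fold Bm B0 Bp N w y u g) {x : S → ℂ} (hx : x ≠ 0) {μ : ℂ}
    (hμ : (toC Bp * toC N) *ᵥ x = μ • x) : ‖μ‖ ≤ w⁻¹ := by
  have hmem : μ ∈ spectrum ℂ (toC Bp * toC N)ᵀ := by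
    rw [spectrum.mem_iff, Matrix.isUnit_iff_isUnit_det, isUnit_iff_ne_zero, not_not]
    have : (algebraMap ℂ (Matrix S S ℂ)) μ - (toC Bp * toC N)ᵀ
        = ((algebraMap ℂ (Matrix S S ℂ)) μ - (toC Bp * toC N))ᵀ := by
      rw [Matrix.transpose_sub, Algebra.algebraMap_eq_smul_one, Matrix.transpose_smul,
        Matrix.transpose_one]
    rw [this, Matrix.det_transpose, ← Matrix.exists_mulVec_eq_zero_iff]
    refine ⟨x, hx, ?_⟩
    rw [Matrix.sub_mulVec, hμ, Algebra.algebraMap_eq_smul_one, Matrix.smul_mulVec,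
      Matrix.one_mulVec, sub_self]
  obtain ⟨φ, hφ0, hφ⟩ := mem_spectrum_iff_exists_mulVec.1 hmem
  refine norm_eigenvalue_le (M := (Bp * N)ᵀ) (Z := (toC Bp * toC N)ᵀ) (fun a b => ?_) h.u_pos
    (fun a => by rw [Matrix.mulVec_transpose]; exact h.R_le a) hφ0 hφ
  rw [← toC_mul]
  simp [abs_of_nonneg (mul_nonneg' h.Bp_nonneg h.N_nonneg b a)]

/-- The kernel of the linearized matrix quadratic equation is one-dimensional. -/
theorem kernel [Nonempty S] (h : Fold Bm B0 Bp N w y u g) {ψ v : S → ℂ} (hψ0 : ψ ≠ 0)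
    (hψ : ψ ᵥ* (toC N * toC Bm) = (w : ℂ) • ψ) (hv0 : v ≠ 0)
    (hv : (toC Bp * toC N) *ᵥ v = (w : ℂ)⁻¹ • v) {X : Matrix S S ℂ}
    (hX : toC N * toC Bp * X * (toC N * toC Bm) = X) :
    ∃ κ : ℂ, X = κ • Matrix.vecMulVec (toC N *ᵥ v) ψ := by
  have hw := h.wC_ne_zero
  set G := toC N * toC Bm with hG
  set B := toC N * toC Bp with hB
  have hψy := h.left_G_dotProduct_ne_zero hψ0 hψ
  have hGy : G *ᵥ vecC y = (w : ℂ) • vecC y := h.G_mulVec_complex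
  -- an eigenvector of `B` comes from one of `R₁`
  have hBR : ∀ (q : S → ℂ) (ν : ℂ), B *ᵥ q = ν • q →
      (toC Bp * toC N) *ᵥ (toC Bp *ᵥ q) = ν • (toC Bp *ᵥ q) := by
    intro q ν hq
    rw [Matrix.mulVec_mulVec, Matrix.mul_assoc, ← hB, ← Matrix.mulVec_mulVec, hq, Matrix.mulVec_smul]
  have hBq : ∀ (q : S → ℂ), B *ᵥ q = toC N *ᵥ (toC Bp *ᵥ q) := fun q => by
    rw [Matrix.mulVec_mulVec]
  -- Right multiplication by `G` preserves the space of such `X`, so a nonzero space contains `Y`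
  -- with `Y G = μ Y`. Its rows force `‖μ‖ ≤ w`, and its columns, sent to R by `Bp`, force `‖μ‖ ≥
  -- w`. Then `circle` gives `μ = w`, the rows are multiples of `ψ`, and `Y y = 0` kills them.
  have hzero : ∀ X : Matrix S S ℂ, B * X * G = X → X *ᵥ vecC y = 0 → X = 0 := by
    by_contra hcon
    push Not at hcon
    obtain ⟨X, hX, hXy, hX0⟩ := hcon
    let W : Submodule ℂ (Matrix S S ℂ) :=
      { carrier := {X | B * X * G = X ∧ X *ᵥ vecC y = 0}
        add_mem' := by
          rintro X Y ⟨h1, h2⟩ ⟨h3, h4⟩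
          refine ⟨?_, ?_⟩
          · rw [Matrix.mul_add, Matrix.add_mul, h1, h3]
          · rw [Matrix.add_mulVec, h2, h4, add_zero]
        zero_mem' := by simp
        smul_mem' := by
          rintro c X ⟨h1, h2⟩
          refine ⟨?_, ?_⟩
          · rw [Matrix.mul_smul, Matrix.smul_mul, h1]
          · rw [Matrix.smul_mulVec, h2, smul_zero] }
    have hWG : ∀ X ∈ W, X * G ∈ W := by
      rintro X ⟨h1, h2⟩
      refine ⟨?_, ?_⟩
      · rw [← Matrix.mul_assoc B X G, h1]
      · rw [← Matrix.mulVec_mulVec, hGy, Matrix.mulVec_smul, h2, smul_zero]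
    let T : W →ₗ[ℂ] W := ((LinearMap.mulRight ℂ G).restrict hWG)
    have : Nontrivial W := ⟨⟨⟨X, hX, hXy⟩, 0, fun he => hX0 (congrArg Subtype.val he)⟩⟩
    obtain ⟨μ, hμ⟩ := Module.End.exists_eigenvalue T
    obtain ⟨⟨Y, hY1, hY2⟩, hYe, hY0⟩ := hμ.exists_hasEigenvector
    have hYG : Y * G = μ • Y := congrArg Subtype.val (Module.End.mem_eigenspace_iff.1 hYe)
    have hYne : Y ≠ 0 := fun he => hY0 (Subtype.ext he)
    have hBY : μ • (B * Y) = Y := by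
      rw [← Matrix.mul_smul, ← hYG, ← Matrix.mul_assoc, hY1]
    have hμ0 : μ ≠ 0 := by
      rintro rfl
      rw [zero_smul] at hBY
      exact hYne hBY.symm
    obtain ⟨a, b, hab⟩ : ∃ a b, Y a b ≠ 0 := by
      by_contra hc
      push Not at hc
      exact hYne (Matrix.ext hc)
    -- a row of `Y` is a left eigenvector of `G`
    have hrow : ∀ a, (fun b => Y a b) ᵥ* G = μ • fun b => Y a b := fun a => by
      ext b; exact congrFun (congrFun hYG a) b
    have hrow0 : (fun b => Y a b) ≠ 0 := fun he => hab (congrFun he b)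
    obtain ⟨x, hx0, hx⟩ : ∃ x : S → ℂ, x ≠ 0 ∧ G *ᵥ x = μ • x := by
      have hdet : (G - μ • (1 : Matrix S S ℂ)).det = 0 := by
        rw [← Matrix.exists_vecMul_eq_zero_iff]
        exact ⟨_, hrow0, by
          rw [Matrix.vecMul_sub, hrow, Matrix.vecMul_smul, Matrix.vecMul_one, sub_self]⟩
      obtain ⟨x, hx0, hx⟩ := Matrix.exists_mulVec_eq_zero_iff.2 hdet
      rw [Matrix.sub_mulVec, Matrix.smul_mulVec, Matrix.one_mulVec, sub_eq_zero] at hx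
      exact ⟨x, hx0, hx⟩
    have hle := h.norm_G_eigenvalue_le hx0 hx
    -- a column of `Y` is an eigenvector of `B`
    have hcol : B *ᵥ (fun a => Y a b) = μ⁻¹ • fun a => Y a b := by
      ext a
      have := congrFun (congrFun hBY a) b
      rw [Matrix.smul_apply, smul_eq_mul] at this
      simp only [Pi.smul_apply, smul_eq_mul]
      rw [← this, ← mul_assoc, inv_mul_cancel₀ hμ0, one_mul]
      rfl
    have hcol0 : toC Bp *ᵥ (fun a => Y a b) ≠ 0 := by
      intro he
      have h1 := hBq fun a => Y a b
      rw [he, Matrix.mulVec_zero, hcol] at h1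
      have := congrFun h1 a
      simp only [Pi.smul_apply, smul_eq_mul, Pi.zero_apply] at this
      exact mul_ne_zero (inv_ne_zero hμ0) hab this
    have hge := h.norm_R_eigenvalue_le hcol0 (hBR _ _ hcol)
    rw [norm_inv] at hge
    have hnorm : ‖μ‖ = w :=
      le_antisymm hle ((inv_le_inv₀ (norm_pos_iff.2 hμ0) h.w_pos).1 hge)
    have hμw := h.circle μ x hx0 hnorm (h.C_mulVec_of_G hμ0 hx)
    subst hμw
    obtain ⟨c, hc⟩ := h.G_left_unique hψ0 hψ (hrow a)
    have h5 := congrFun hY2 a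
    have h6 : (fun b => Y a b) ⬝ᵥ vecC y = 0 := h5
    rw [hc, smul_dotProduct, smul_eq_mul] at h6
    have hc0 := (mul_eq_zero.1 h6).resolve_right hψy
    rw [hc0, zero_smul] at hc
    exact hrow0 hc
  have hq : B *ᵥ (X *ᵥ vecC y) = (w : ℂ)⁻¹ • (X *ᵥ vecC y) := by
    have h1 := congrArg (· *ᵥ vecC y) hX
    simp only [← Matrix.mulVec_mulVec, hGy, Matrix.mulVec_smul] at h1
    conv_rhs => rw [← h1]
    rw [smul_smul, inv_mul_cancel₀ hw, one_smul]
  obtain ⟨c, hc⟩ := h.R_right_unique hv0 hv (hBR _ _ hq)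
  have hXy : X *ᵥ vecC y = ((w : ℂ) * c) • (toC N *ᵥ v) := by
    rw [hBq, hc, Matrix.mulVec_smul] at hq
    rw [mul_smul, hq, smul_smul, mul_inv_cancel₀ hw, one_smul]
  have hker : B * Matrix.vecMulVec (toC N *ᵥ v) ψ * G = Matrix.vecMulVec (toC N *ᵥ v) ψ := by
    rw [Matrix.mul_vecMulVec, Matrix.vecMulVec_mul, hψ, hBq, Matrix.mulVec_mulVec,
      Matrix.mulVec_mulVec, Matrix.mul_assoc, ← Matrix.mulVec_mulVec, hv, Matrix.mulVec_smul]
    ext a b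
    simp only [Matrix.vecMulVec_apply, Pi.smul_apply, smul_eq_mul]
    field_simp
  -- The scalar is chosen so that both sides agree on `y`.
  refine ⟨(w : ℂ) * c / (ψ ⬝ᵥ vecC y), sub_eq_zero.1 (hzero _ ?_ ?_)⟩
  · rw [Matrix.mul_sub, Matrix.sub_mul, hX, Matrix.mul_smul, Matrix.smul_mul, hker]
  · rw [Matrix.sub_mulVec, Matrix.smul_mulVec, hXy, Matrix.vecMulVec_mulVec]
    ext a
    simp only [Pi.sub_apply, Pi.smul_apply, smul_eq_mul, Pi.zero_apply, MulOpposite.smul_eq_mul_unop, MulOpposite.unop_op]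
    field_simp
    ring

end Fold

end FoldComplex

/-! ### The fold data of the chain; phases on the critical circle -/

section BranchPoint

variable {S : Type*} [Fintype S] [DecidableEq S] {A : ℤ → ℤ → Matrix S S ℝ} {w : ℝ} {y u g : S → ℝ}

theorem Blocks.Ar_pos (hA : Blocks A) {x : ℝ} (hx : 0 < x) {i j : ℤ} (hi : i ∈ H) (hj : j ∈ H)
    {a b : S} (hpos : 0 < A i j a b) : 0 < Ar A j x a b := by
  simp only [Ar, Matrix.sum_apply, Matrix.smul_apply, smul_eq_mul]
  exact Finset.sum_pos' (fun i hi => mul_nonneg (zpow_pos hx _).le (hA.nonneg i hi j hj a b))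
    ⟨i, hi, mul_pos (zpow_pos hx _) hpos⟩

theorem Critical.right_unique [Nonempty S] (hc : Critical A w y u g) (hA : Blocks A) {x : S → ℂ}
    (hx : toC (Cr A (zMax A) w) *ᵥ x = x) : ∃ c : ℂ, x = c • vecC y :=
  (hA.Cr_irr (zMax_pos A) hc.w_pos).eq_smul_of_mulVec_eq
    (hA.Cr_nonneg (zMax_pos A) hc.w_pos) hc.y_pos hc.right hx

theorem Critical.left_unique [Nonempty S] (hc : Critical A w y u g) (hA : Blocks A) {x : S → ℂ}
    (hx : x ᵥ* toC (Cr A (zMax A) w) = x) : ∃ c : ℂ, x = c • vecC u := by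
  refine (hA.Cr_irr (zMax_pos A) hc.w_pos).transpose.eq_smul_of_mulVec_eq
    (fun a b => hA.Cr_nonneg (zMax_pos A) hc.w_pos b a) hc.u_pos ?_ ?_
  · rw [Matrix.mulVec_transpose]; exact hc.left
  · rw [Matrix.transpose_map, Matrix.mulVec_transpose]; exact hx

theorem Complex.eq_norm_of_re_eq {z : ℂ} (h : z.re = ‖z‖) : z = ‖z‖ :=
  Complex.eq_coe_norm_of_nonneg (Complex.re_eq_norm.1 h)

/-- On the circle of radius `w` the only `μ` for which `C(z̄, μ)` has the eigenvalue one is `w`. -/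
theorem Critical.circle [Nonempty S] (hc : Critical A w y u g) (hA : Blocks A) {μ : ℂ} {x : S → ℂ}
    (hx0 : x ≠ 0) (hμ : ‖μ‖ = w)
    (hx : (μ⁻¹ • toC (Ar A (-1) (zMax A)) + toC (Ar A 0 (zMax A)) + μ • toC (Ar A 1 (zMax A))) *ᵥ x
      = x) : μ = w := by
  have hw := hc.w_pos
  have hz := zMax_pos A
  set D := fun j => Ar A j (zMax A) with hD
  have hD0 : ∀ j ∈ H, ∀ a b, 0 ≤ D j a b := hA.Ar_nonneg hz
  have hμ0 : μ ≠ 0 := norm_pos_iff.1 (hμ ▸ hw)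
  have hxa : ∀ a, x a = ∑ b, ∑ j ∈ H, μ ^ j * D j a b * x b := fun a => by
    conv_lhs => rw [← hx]
    simp only [Matrix.mulVec, dotProduct, Matrix.add_apply, Matrix.smul_apply, Matrix.map_apply,
      smul_eq_mul, sum_H, zpow_neg_one, zpow_zero, zpow_one, one_mul, add_mul]
    rfl
  have hCr : ∀ (f : S → ℝ) (a : S), (Cr A (zMax A) w *ᵥ f) a = ∑ b, ∑ j ∈ H, w ^ j * D j a b * f b :=
    fun f a => by
    simp only [Cr_eq, Matrix.mulVec, dotProduct, Matrix.add_apply, Matrix.smul_apply,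
      smul_eq_mul, sum_H, zpow_neg_one, zpow_zero, zpow_one, one_mul, add_mul]
    rfl
  have hle : ∀ a, ‖x a‖ ≤ (Cr A (zMax A) w *ᵥ fun b => ‖x b‖) a := fun a => by
    rw [hCr]
    conv_lhs => rw [hxa]
    refine (norm_sum_le _ _).trans (Finset.sum_le_sum fun b _ => (norm_sum_le _ _).trans
      (Finset.sum_le_sum fun j hj => le_of_eq ?_))
    rw [norm_mul, norm_mul, norm_zpow, hμ, Complex.norm_real, Real.norm_of_nonneg (hD0 j hj a b)]
  -- The moduli are subharmonic; pairing with the positive left fixed vector `u` leaves no slack.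
  have heq : (Cr A (zMax A) w *ᵥ fun b => ‖x b‖) = fun b => ‖x b‖ := by
    have h1 : ∑ a, u a * ((Cr A (zMax A) w *ᵥ fun b => ‖x b‖) a - ‖x a‖) = 0 := by
      have h2 : u ⬝ᵥ ((Cr A (zMax A) w *ᵥ fun b => ‖x b‖) - fun b => ‖x b‖) = 0 := by
        rw [dotProduct_sub, Matrix.dotProduct_mulVec, hc.left, sub_self]
      exact h2
    ext a
    have h3 := (Finset.sum_eq_zero_iff_of_nonneg fun a _ =>
      mul_nonneg (hc.u_pos a).le (sub_nonneg.2 (hle a))).1 h1 a (Finset.mem_univ a)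
    exact sub_eq_zero.1 ((mul_eq_zero.1 h3).resolve_left (hc.u_pos a).ne')
  obtain ⟨c, hcy⟩ := (hA.Cr_irr hz hw).eq_smul_of_mulVec_eq_real (hA.Cr_nonneg hz hw) hc.y_pos
    hc.right heq
  have hxne : ∀ a, x a ≠ 0 := by
    obtain ⟨a₁, ha₁⟩ := Function.ne_iff.1 hx0
    have hc0 : c ≠ 0 := by
      rintro rfl
      rw [zero_smul] at hcy
      exact ha₁ (norm_eq_zero.1 (congrFun hcy a₁))
    intro a ha
    have := congrFun hcy a
    simp only [ha, norm_zero, Pi.smul_apply, smul_eq_mul] at this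
    exact mul_ne_zero hc0 (hc.y_pos a).ne' this.symm
  -- Equality in the triangle inequality aligns the arguments of all summands with positive weight.
  have hedge : ∀ a b, ∀ j ∈ H, 0 < D j a b →
      (μ / w) ^ j * (x b / ‖x b‖) = x a / ‖x a‖ := by
    intro a b j hj hpos
    have hterm : ∀ b, ∀ j ∈ H, 0 ≤ w ^ j * D j a b * ‖x b‖ * ‖x a‖
        - (μ ^ j * D j a b * x b * (starRingEnd ℂ) (x a)).re := fun b j hj => by
      rw [sub_nonneg]
      refine (Complex.re_le_norm _).trans (le_of_eq ?_)
      rw [norm_mul, norm_mul, norm_mul, norm_zpow, hμ, Complex.norm_real,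
        Real.norm_of_nonneg (hD0 j hj a b), RCLike.norm_conj]
    have hsum : ∑ b, ∑ j ∈ H, (w ^ j * D j a b * ‖x b‖ * ‖x a‖
        - (μ ^ j * D j a b * x b * (starRingEnd ℂ) (x a)).re) = 0 := by
      have h1 : ∑ b, ∑ j ∈ H, w ^ j * D j a b * ‖x b‖ * ‖x a‖ = ‖x a‖ * ‖x a‖ := by
        have : ∑ b, ∑ j ∈ H, w ^ j * D j a b * ‖x b‖ = ‖x a‖ :=
          (hCr (fun b => ‖x b‖) a).symm.trans (congrFun heq a)
        conv_rhs => enter [1]; rw [← this]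
        simp only [Finset.sum_mul]
      have h2 : ∑ b, ∑ j ∈ H, μ ^ j * D j a b * x b * (starRingEnd ℂ) (x a)
          = x a * (starRingEnd ℂ) (x a) := by
        conv_rhs => enter [1]; rw [hxa a]
        simp only [Finset.sum_mul]
      simp only [Finset.sum_sub_distrib, ← Complex.re_sum]
      rw [h1, h2, Complex.mul_conj, Complex.ofReal_re, Complex.normSq_eq_norm_sq]
      ring
    have h1 := (Finset.sum_eq_zero_iff_of_nonneg fun b _ => Finset.sum_nonneg (hterm b)).1 hsum b
      (Finset.mem_univ b)
    have h2 := (Finset.sum_eq_zero_iff_of_nonneg (hterm b)).1 h1 j hj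
    rw [sub_eq_zero] at h2
    have h3 : ‖μ ^ j * D j a b * x b * (starRingEnd ℂ) (x a)‖ = w ^ j * D j a b * ‖x b‖ * ‖x a‖ := by
      rw [norm_mul, norm_mul, norm_mul, norm_zpow, hμ, Complex.norm_real,
        Real.norm_of_nonneg (hD0 j hj a b), RCLike.norm_conj]
    have h4 := Complex.eq_norm_of_re_eq (h2.symm.trans h3.symm)
    rw [h3] at h4
    push_cast at h4
    have hDne : (D j a b : ℂ) ≠ 0 := by exact_mod_cast hpos.ne'
    have hwne : (w : ℂ) ≠ 0 := by exact_mod_cast hw.ne'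
    have hbn : (‖x b‖ : ℂ) ≠ 0 := by exact_mod_cast norm_ne_zero_iff.2 (hxne b)
    have han : (‖x a‖ : ℂ) ≠ 0 := by exact_mod_cast norm_ne_zero_iff.2 (hxne a)
    have h5 : μ ^ j * x b * (starRingEnd ℂ) (x a) = (w : ℂ) ^ j * ‖x b‖ * ‖x a‖ := by
      apply mul_left_cancel₀ hDne
      linear_combination h4
    have h6 : x a * (starRingEnd ℂ) (x a) = (‖x a‖ : ℂ) ^ 2 := Complex.mul_conj' _
    have hca : (starRingEnd ℂ) (x a) ≠ 0 := (map_ne_zero _).2 (hxne a)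
    have hwj : (w : ℂ) ^ j ≠ 0 := zpow_ne_zero _ hwne
    rw [div_zpow]
    field_simp
    apply mul_right_cancel₀ hca
    linear_combination (‖x a‖ : ℂ) * h5 - ((w : ℂ) ^ j * ‖x b‖) * h6
  obtain ⟨a₀⟩ := ‹Nonempty S›
  have hwne : (w : ℂ) ≠ 0 := by exact_mod_cast hw.ne'
  have hν : μ / w ≠ 0 := div_ne_zero hμ0 hwne
  -- The phase relation is carried along a path that returns to `a₀` one level higher, which leaves
  -- a single factor `μ / w`.
  have hall := hA.induction
    (fun _ n b => (μ / w) ^ n * (x b / ‖x b‖) = x a₀ / ‖x a₀‖) 0 0 a₀ (by simp)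
    (fun m n a i j b hi hj hpos hQ => by
      rw [zpow_add₀ hν, mul_assoc, hedge a b j hj (hA.Ar_pos hz hi hj hpos), hQ]) 0 1 a₀
  rw [zpow_one] at hall
  have han : (‖x a₀‖ : ℂ) ≠ 0 := by exact_mod_cast norm_ne_zero_iff.2 (hxne a₀)
  have h1 := (mul_eq_right₀ (div_ne_zero (hxne a₀) han)).1 hall
  rwa [div_eq_one_iff_eq hwne] at h1

theorem Crw_snd (A : ℤ → ℤ → Matrix S S ℝ) (x w : ℝ) :
    Crw A (fun _ j => j) x w = -(w⁻¹ • Ar A (-1) x) + w • Ar A 1 x := by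
  simp [Crw, Ar, sum_H, smul_smul]
  abel

theorem Critical.fold [Nonempty S] (hc : Critical A w y u g) (hA : Blocks A) :
    Fold (Ar A (-1) (zMax A)) (Ar A 0 (zMax A)) (Ar A 1 (zMax A)) (Nr A (zMax A)) w y u g := by
  have hz := zMax_pos A
  have hI : zMax A ∈ Set.Icc (zMin A) (zMax A) := ⟨hc.zMin_lt.le, le_rfl⟩
  exact
  { Bm_nonneg := hA.Ar_nonneg hz _ (by simp [H])
    Bp_nonneg := hA.Ar_nonneg hz _ (by simp [H])
    N_nonneg := Nr_nonneg hA hc hI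
    w_pos := hc.w_pos
    y_pos := hc.y_pos
    u_pos := hc.u_pos
    N_eq := by
      have h1 := N₁_eq hA hc (ofReal_mem_annulus hI)
      rw [N₁_ofReal hA hc hI, Acol_ofReal, Acol_ofReal, Acol_ofReal] at h1
      refine Matrix.map_injective Complex.ofReal_injective ?_
      change toC _ = toC _
      rw [toC_add, toC_add, toC_one, toC_mul, toC_mul, toC_mul, toC_mul]
      exact h1
    right := by rw [← Cr_eq]; exact hc.right
    left := by rw [← Cr_eq]; exact hc.left
    poisson := by rw [← Cr_eq, ← Crw_snd]; exact hc.poisson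
    G_le := Nr_mulVec_le hA hc hI hc.w_pos hc.y_pos fun a => (congrFun hc.right a).le
    R_le := vecMul_Nr_le hA hc hI hc.w_pos hc.u_pos fun a => (congrFun hc.left a).le
    right_unique := fun x hx => hc.right_unique hA (by rwa [Cr_eq])
    left_unique := fun x hx => hc.left_unique hA (by rwa [Cr_eq])
    circle := fun μ x hx0 hμ hx => hc.circle hA hx0 hμ hx }

end BranchPoint

/-! ### Analytic inverses and square roots -/

section LocalInverse

/-- The inverse function theorem for analytic maps between spaces of the same finite dimension,
with the injectivity of the derivative tested along lines. -/
theorem exists_analytic_local_inverse {E F : Type*} [NormedAddCommGroup E] [NormedSpace ℂ E]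
    [FiniteDimensional ℂ E] [NormedAddCommGroup F] [NormedSpace ℂ F] [FiniteDimensional ℂ F]
    (hdim : Module.finrank ℂ E = Module.finrank ℂ F) {f : E → F} {p : E}
    (hf : AnalyticAt ℂ f p)
    (hinj : ∀ v, HasDerivAt (fun t : ℂ => f (p + t • v)) 0 0 → v = 0) :
    ∃ g : F → E, AnalyticAt ℂ g (f p) ∧ g (f p) = p ∧ (∀ᶠ q in 𝓝 (f p), f (g q) = q) ∧
      ∀ᶠ x in 𝓝 p, g (f x) = x := by
  have : CompleteSpace E := FiniteDimensional.complete ℂ E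
  have : CompleteSpace F := FiniteDimensional.complete ℂ F
  have hd := hf.differentiableAt.hasFDerivAt
  have hker : ∀ v, fderiv ℂ f p v = 0 → v = 0 := fun v hv => hinj v <| by
    have h1 : HasDerivAt (fun t : ℂ => p + t • v) ((1 : ℂ) • v) 0 :=
      ((hasDerivAt_id (0 : ℂ)).smul_const v).const_add p
    have h2 : HasFDerivAt f (fderiv ℂ f p) (p + (0 : ℂ) • v) := by simpa using hd
    have h3 := h2.comp_hasDerivAt (0 : ℂ) h1
    rw [one_smul, hv] at h3
    exact h3
  let L : E ≃ₗ[ℂ] F := LinearEquiv.ofInjectiveOfFinrankEq (fderiv ℂ f p : E →ₗ[ℂ] F)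
    ((injective_iff_map_eq_zero _).2 hker) hdim
  have hL : ((L.toContinuousLinearEquiv : E ≃L[ℂ] F) : E →L[ℂ] F) = fderiv ℂ f p := by
    ext v; rfl
  have hf' : HasFDerivAt f ((L.toContinuousLinearEquiv : E ≃L[ℂ] F) : E →L[ℂ] F) p := by
    rw [hL]; exact hd
  have hc : ContDiffAt ℂ ⊤ f p := hf.contDiffAt
  have hs := hc.hasStrictFDerivAt' hf' (by simp)
  exact ⟨hc.localInverse hf' (by simp), (hc.to_localInverse hf' (by simp)).analyticAt,
    hc.localInverse_apply_image hf' (by simp), hs.eventually_right_inverse,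
    hs.eventually_left_inverse⟩

theorem exists_analytic_local_inverse_one {f : ℂ → ℂ} {p f' : ℂ} (hf : AnalyticAt ℂ f p)
    (hd : HasDerivAt f f' p) (hne : f' ≠ 0) :
    ∃ g : ℂ → ℂ, AnalyticAt ℂ g (f p) ∧ g (f p) = p ∧ (∀ᶠ q in 𝓝 (f p), f (g q) = q) ∧
      (∀ᶠ x in 𝓝 p, g (f x) = x) ∧ HasDerivAt g f'⁻¹ (f p) := by
  obtain ⟨g, hg, hgp, hr, hl⟩ := exists_analytic_local_inverse rfl hf fun v hv => by
    have h1 : HasDerivAt (fun t : ℂ => p + t • v) ((1 : ℂ) • v) 0 :=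
      ((hasDerivAt_id (0 : ℂ)).smul_const v).const_add p
    have h2 : HasDerivAt f f' (p + (0 : ℂ) • v) := by simpa using hd
    have h3 := (h2.comp (0 : ℂ) h1).unique hv
    simpa [hne] using h3
  refine ⟨g, hg, hgp, hr, hl, ?_⟩
  have h2 : HasDerivAt f f' (g (f p)) := by rwa [hgp]
  exact h2.of_local_left_inverse hg.continuousAt hne hr

/-- The quotient by `(s - s₀) ^ 2` has a removable singularity with value `c`. Dividing by `c`
brings it near 1, where the principal root is analytic, and a root of `c` is put back as a constant
factor. -/
theorem exists_analytic_sqrt {p : ℂ → ℂ} {s₀ c : ℂ} (hp : AnalyticAt ℂ p s₀) (hp0 : p s₀ = 0)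
    (hc : c ≠ 0) (hlim : Tendsto (fun s => p s / (s - s₀) ^ 2) (𝓝[≠] s₀) (𝓝 c)) :
    ∃ φ : ℂ → ℂ, AnalyticAt ℂ φ s₀ ∧ φ s₀ = 0 ∧ (∃ φ', φ' ≠ 0 ∧ HasDerivAt φ φ' s₀) ∧
      ∀ᶠ s in 𝓝 s₀, p s = φ s ^ 2 := by
  set h := Function.update (fun s => p s / (s - s₀) ^ 2) s₀ c with hh
  have hne : ∀ s, s ≠ s₀ → h s = p s / (s - s₀) ^ 2 := fun s hs => by
    rw [hh, Function.update_of_ne hs]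
  have hs0 : h s₀ = c := by rw [hh, Function.update_self]
  have hcont : ContinuousAt h s₀ := continuousAt_update_same.2 hlim
  have han : AnalyticAt ℂ h s₀ := by
    refine Complex.analyticAt_of_differentiable_on_punctured_nhds_of_continuousAt ?_ hcont
    have h1 : ∀ᶠ s in 𝓝[≠] s₀, DifferentiableAt ℂ p s :=
      (hp.eventually_analyticAt.mono fun s hs => hs.differentiableAt).filter_mono nhdsWithin_le_nhds
    filter_upwards [h1, self_mem_nhdsWithin] with s hs hs'
    have h2 : (fun s => p s / (s - s₀) ^ 2) =ᶠ[𝓝 s] h := by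
      filter_upwards [isOpen_ne.mem_nhds hs'] with t ht using (hne t ht).symm
    refine DifferentiableAt.congr_of_eventuallyEq ?_ h2.symm
    exact hs.div (by fun_prop) (pow_ne_zero 2 (sub_ne_zero.2 hs'))
  have hph : ∀ s, p s = (s - s₀) ^ 2 * h s := fun s => by
    by_cases hs : s = s₀
    · rw [hs, hp0]; simp
    · rw [hne s hs, mul_div_cancel₀ _ (pow_ne_zero 2 (sub_ne_zero.2 hs))]
  set r := fun s => (h s / c) ^ (1 / 2 : ℂ) with hr
  have hr1 : h s₀ / c = 1 := by rw [hs0, div_self hc]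
  have hran : AnalyticAt ℂ r s₀ := by
    refine AnalyticAt.cpow (han.div analyticAt_const hc) analyticAt_const ?_
    rw [hr1]; exact Complex.one_mem_slitPlane
  have hr2 : ∀ s, r s ^ 2 = h s / c := fun s => by
    simp [hr]
  have hrs0 : r s₀ = 1 := by rw [hr]; simp only [hr1, Complex.one_cpow]
  set k := c ^ (1 / 2 : ℂ) with hk
  have hk2 : k ^ 2 = c := by
    simp [hk]
  have hk0 : k ≠ 0 := fun h0 => hc (by rw [← hk2, h0]; simp)
  refine ⟨fun s => (s - s₀) * (k * r s), (analyticAt_id.sub analyticAt_const).mul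
    (analyticAt_const.mul hran), by simp, ⟨k, hk0, ?_⟩, Eventually.of_forall fun s => ?_⟩
  · have h1 := ((hasDerivAt_id s₀).sub_const s₀).mul
      (hran.differentiableAt.hasDerivAt.const_mul k)
    simp only [id, hrs0, sub_self, zero_mul, add_zero, one_mul, mul_one] at h1
    exact h1
  · rw [hph, mul_pow, mul_pow, hr2, hk2, mul_div_cancel₀ _ hc]

end LocalInverse

/-! ### A disc without its rightmost point -/

section PuncturedDisc

theorem Complex.re_lt_of_norm_le {z : ℂ} {r : ℝ} (hz : ‖z‖ ≤ r) (hne : z ≠ r) : z.re < r := by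
  refine lt_of_le_of_ne ((Complex.re_le_norm z).trans hz) fun h => hne ?_
  have hr : 0 ≤ r := (norm_nonneg z).trans hz
  have h1 : ‖z‖ ^ 2 ≤ r ^ 2 := pow_le_pow_left₀ (norm_nonneg z) hz 2
  rw [← Complex.normSq_eq_norm_sq, Complex.normSq_apply, h] at h1
  have h2 : z.im = 0 := by
    have : z.im * z.im ≤ 0 := by nlinarith
    exact mul_self_eq_zero.1 (le_antisymm this (mul_self_nonneg _))
  exact Complex.ext (by simpa using h) (by simpa using h2)

/-- Removing the boundary point `r` from the disc amounts to intersecting with the open half-plane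
to the left of it. The resulting connectedness fixes the sign of a square root later. -/
theorem convex_punctured_closedBall (r δ : ℝ) :
    Convex ℝ {z : ℂ | ‖z‖ ≤ r ∧ z ≠ r ∧ z ∈ Metric.ball (r : ℂ) δ} := by
  have h : {z : ℂ | ‖z‖ ≤ r ∧ z ≠ r ∧ z ∈ Metric.ball (r : ℂ) δ}
      = (Metric.closedBall 0 r ∩ {z : ℂ | z.re < r}) ∩ Metric.ball (r : ℂ) δ := by
    ext z
    simp only [Set.mem_ofPred_eq, Set.mem_inter_iff, mem_closedBall_zero_iff]
    constructor
    · rintro ⟨h1, h2, h3⟩; exact ⟨⟨h1, Complex.re_lt_of_norm_le h1 h2⟩, h3⟩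
    · rintro ⟨⟨h1, h2⟩, h3⟩
      exact ⟨h1, fun h => by rw [h, Complex.ofReal_re] at h2; exact lt_irrefl _ h2, h3⟩
  rw [h]
  exact ((convex_closedBall _ _).inter (convex_halfSpace_re_lt r)).inter (convex_ball _ _)

end PuncturedDisc

/-! ### Calculus for matrix-valued maps -/

section MatrixCalculus

variable {S : Type*} [Fintype S] [DecidableEq S]

attribute [local instance] Matrix.linftyOpNormedRing Matrix.linftyOpNormedAlgebra

/-- The entry of a matrix as a continuous linear map. -/
noncomputable def entryL (a b : S) : Matrix S S ℂ →L[ℂ] ℂ :=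
  LinearMap.toContinuousLinearMap (Matrix.entryLinearMap ℂ ℂ a b)

theorem analyticAt_entry {E : Type*} [NormedAddCommGroup E] [NormedSpace ℂ E]
    {M : E → Matrix S S ℂ} {p : E} (hM : AnalyticAt ℂ M p) (a b : S) :
    AnalyticAt ℂ (fun q => M q a b) p :=
  ((entryL a b).analyticAt (M p)).comp hM

theorem analyticAt_mulVec {E : Type*} [NormedAddCommGroup E] [NormedSpace ℂ E]
    {M : E → Matrix S S ℂ} {x : E → S → ℂ} {p : E} (hM : AnalyticAt ℂ M p)
    (hx : AnalyticAt ℂ x p) : AnalyticAt ℂ (fun q => M q *ᵥ x q) p := by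
  refine AnalyticAt.pi fun a => ?_
  have : (fun q => (M q *ᵥ x q) a) = fun q => ∑ b, M q a b * x q b := rfl
  rw [this]
  exact Finset.analyticAt_fun_sum _ fun b _ => (analyticAt_entry hM a b).mul
    ((analyticAt_pi_iff.1 hx) b)

theorem analyticAt_dotProduct {E : Type*} [NormedAddCommGroup E] [NormedSpace ℂ E]
    (ψ : S → ℂ) {x : E → S → ℂ} {p : E}
    (hx : AnalyticAt ℂ x p) : AnalyticAt ℂ (fun q => ψ ⬝ᵥ x q) p := by
  have : (fun q => ψ ⬝ᵥ x q) = fun q => ∑ b, ψ b * x q b := rfl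
  rw [this]
  exact Finset.analyticAt_fun_sum _ fun b _ => analyticAt_const.mul ((analyticAt_pi_iff.1 hx) b)

theorem hasDerivAt_entry {M : ℂ → Matrix S S ℂ} {M' : Matrix S S ℂ} {t : ℂ}
    (hM : HasDerivAt M M' t) (a b : S) : HasDerivAt (fun q => M q a b) (M' a b) t :=
  (entryL a b).hasFDerivAt.comp_hasDerivAt t hM

theorem hasDerivAt_mulVec {M : ℂ → Matrix S S ℂ} {M' : Matrix S S ℂ} {x : ℂ → S → ℂ} {x' : S → ℂ}
    {t : ℂ} (hM : HasDerivAt M M' t) (hx : HasDerivAt x x' t) :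
    HasDerivAt (fun q => M q *ᵥ x q) (M' *ᵥ x t + M t *ᵥ x') t := by
  refine hasDerivAt_pi.2 fun a => ?_
  have h : HasDerivAt (fun q => ∑ b, M q a b * x q b) (∑ b, (M' a b * x t b + M t a b * x' b)) t :=
    HasDerivAt.fun_sum fun b _ => (hasDerivAt_entry hM a b).mul ((hasDerivAt_pi.1 hx) b)
  rw [Finset.sum_add_distrib] at h
  exact h

theorem hasDerivAt_dotProduct (ψ : S → ℂ) {x : ℂ → S → ℂ} {x' : S → ℂ}
    {t : ℂ} (hx : HasDerivAt x x' t) : HasDerivAt (fun q => ψ ⬝ᵥ x q) (ψ ⬝ᵥ x') t :=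
  HasDerivAt.fun_sum fun b _ => ((hasDerivAt_pi.1 hx) b).const_mul (ψ b)

theorem hasDerivAt_fst {E F : Type*} [NormedAddCommGroup E] [NormedSpace ℂ E]
    [NormedAddCommGroup F] [NormedSpace ℂ F] {f : ℂ → E × F} {f' : E × F} {t : ℂ}
    (h : HasDerivAt f f' t) : HasDerivAt (fun q => (f q).1) f'.1 t :=
  (ContinuousLinearMap.fst ℂ E F).hasFDerivAt.comp_hasDerivAt t h

theorem hasDerivAt_snd {E F : Type*} [NormedAddCommGroup E] [NormedSpace ℂ E]
    [NormedAddCommGroup F] [NormedSpace ℂ F] {f : ℂ → E × F} {f' : E × F} {t : ℂ}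
    (h : HasDerivAt f f' t) : HasDerivAt (fun q => (f q).2) f'.2 t :=
  (ContinuousLinearMap.snd ℂ E F).hasFDerivAt.comp_hasDerivAt t h

theorem hasDerivAt_line {E : Type*} [NormedAddCommGroup E] [NormedSpace ℂ E] (p v : E) :
    HasDerivAt (fun t : ℂ => p + t • v) v 0 := by
  simpa using ((hasDerivAt_id (0 : ℂ)).smul_const v).const_add p

end MatrixCalculus

/-! ### Analytic perturbation of a simple eigenvalue -/

section Eigenpair

variable {S : Type*} [Fintype S] [DecidableEq S]

attribute [local instance] Matrix.linftyOpNormedRing Matrix.linftyOpNormedAlgebra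

/-- Analytic dependence of a simple eigenvalue and of its eigenvector on the matrix. -/
theorem exists_eigenpair {G : Matrix S S ℂ} {w : ℂ} {y ψ : S → ℂ} (hy : G *ᵥ y = w • y)
    (huniq : ∀ x, G *ᵥ x = w • x → ∃ c : ℂ, x = c • y) (hψ : ψ ᵥ* G = w • ψ) (hψy : ψ ⬝ᵥ y ≠ 0) :
    ∃ (x : Matrix S S ℂ → S → ℂ) (α : Matrix S S ℂ → ℂ), AnalyticAt ℂ x G ∧ AnalyticAt ℂ α G ∧
      x G = y ∧ α G = w ∧
      (∀ᶠ M in 𝓝 G, M *ᵥ x M = α M • x M ∧ ψ ⬝ᵥ x M = ψ ⬝ᵥ y) ∧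
      ∀ᶠ q : Matrix S S ℂ × (S → ℂ) × ℂ in 𝓝 (G, y, w), q.1 *ᵥ q.2.1 = q.2.2 • q.2.1 →
        ψ ⬝ᵥ q.2.1 = ψ ⬝ᵥ y → q.2.1 = x q.1 ∧ q.2.2 = α q.1 := by
  -- Eigenpairs with the normalization by `ψ` are the points over `(M, 0, ψ ⬝ᵥ y)`; carrying `M`
  -- along reduces the parametric problem to the inverse function theorem.
  let Θ : Matrix S S ℂ × (S → ℂ) × ℂ → Matrix S S ℂ × (S → ℂ) × ℂ :=
    fun q => (q.1, q.1 *ᵥ q.2.1 - q.2.2 • q.2.1, ψ ⬝ᵥ q.2.1)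
  have hΘ : AnalyticAt ℂ Θ (G, y, w) := by
    have h1 : AnalyticAt ℂ (fun q : Matrix S S ℂ × (S → ℂ) × ℂ => q.1) (G, y, w) := analyticAt_fst
    have h2 : AnalyticAt ℂ (fun q : Matrix S S ℂ × (S → ℂ) × ℂ => q.2) (G, y, w) := analyticAt_snd
    have h3 : AnalyticAt ℂ (fun q : Matrix S S ℂ × (S → ℂ) × ℂ => q.2.1) (G, y, w) :=
      AnalyticAt.comp analyticAt_fst h2
    have h4 : AnalyticAt ℂ (fun q : Matrix S S ℂ × (S → ℂ) × ℂ => q.2.2) (G, y, w) :=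
      AnalyticAt.comp analyticAt_snd h2
    exact h1.prod (((analyticAt_mulVec h1 h3).sub (h4.smul h3)).prod (analyticAt_dotProduct ψ h3))
  have hΘ0 : Θ (G, y, w) = (G, 0, ψ ⬝ᵥ y) := by simp only [Θ, hy, sub_self]
  obtain ⟨k, hk, hk0, hr, hl⟩ := exists_analytic_local_inverse rfl hΘ (by
    rintro ⟨M, ξ, σ⟩ hv
    have hline := hasDerivAt_line (G, y, w) (M, ξ, σ)
    have hM := hasDerivAt_fst hline
    have hξ := hasDerivAt_fst (hasDerivAt_snd hline)
    have hσ := hasDerivAt_snd (hasDerivAt_snd hline)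
    have e1 : M = 0 := hM.unique (hasDerivAt_fst hv)
    have e2 := ((hasDerivAt_mulVec hM hξ).sub (hσ.smul hξ)).unique
      (hasDerivAt_fst (hasDerivAt_snd hv))
    have e3 : ψ ⬝ᵥ ξ = 0 := (hasDerivAt_dotProduct ψ hξ).unique (hasDerivAt_snd (hasDerivAt_snd hv))
    subst e1
    simp only [zero_smul, add_zero, Matrix.zero_mulVec, zero_add, Prod.fst_zero, Prod.snd_zero]
      at e2
    -- Pairing with the left eigenvector removes the variation of the eigenvector and leaves `σ`
    -- times `ψ ⬝ᵥ y`.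
    have e4 := congrArg (ψ ⬝ᵥ ·) e2
    simp only [dotProduct_sub, dotProduct_add, dotProduct_smul, Matrix.dotProduct_mulVec, hψ,
      smul_dotProduct, e3, zero_add, zero_sub, dotProduct_zero, neg_eq_zero,
      smul_eq_mul, mul_zero] at e4
    have hσ0 : σ = 0 := (mul_eq_zero.1 e4).resolve_right hψy
    subst hσ0
    rw [zero_smul, add_zero, sub_eq_zero] at e2
    obtain ⟨c, rfl⟩ := huniq ξ e2
    rw [dotProduct_smul, smul_eq_mul] at e3
    have hc : c = 0 := (mul_eq_zero.1 e3).resolve_right hψy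
    simp [hc])
  rw [hΘ0] at hk hk0 hr
  have hins : AnalyticAt ℂ (fun M : Matrix S S ℂ => ((M, 0, ψ ⬝ᵥ y) : Matrix S S ℂ × (S → ℂ) × ℂ)) G :=
    analyticAt_id.prod analyticAt_const
  have hcomp : AnalyticAt ℂ (fun M => k (M, 0, ψ ⬝ᵥ y)) G := AnalyticAt.comp (f := fun M : Matrix S S ℂ => ((M, 0, ψ ⬝ᵥ y) : Matrix S S ℂ × (S → ℂ) × ℂ)) hk hins
  have hcomp2 : AnalyticAt ℂ (fun M => (k (M, 0, ψ ⬝ᵥ y)).2) G := AnalyticAt.comp analyticAt_snd hcomp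
  refine ⟨fun M => (k (M, 0, ψ ⬝ᵥ y)).2.1, fun M => (k (M, 0, ψ ⬝ᵥ y)).2.2,
    AnalyticAt.comp analyticAt_fst hcomp2, AnalyticAt.comp analyticAt_snd hcomp2, by simp only [hk0],
    by simp only [hk0], ?_, ?_⟩
  · filter_upwards [hins.continuousAt.eventually hr] with M hM
    simp only [Θ, Prod.mk.injEq] at hM
    obtain ⟨h1, h2, h3⟩ := hM
    rw [h1, sub_eq_zero] at h2
    exact ⟨h2, h3⟩
  · filter_upwards [hl] with q hq h1 h2
    have : Θ q = (q.1, 0, ψ ⬝ᵥ y) := by simp only [Θ, h1, sub_self, h2]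
    rw [this] at hq
    rw [hq]
    exact ⟨rfl, rfl⟩

end Eigenpair

/-! ### The curve of solutions, parametrized by the eigenvalue -/

section FoldCurve

variable {S : Type*} [Fintype S] [DecidableEq S]

attribute [local instance] Matrix.linftyOpNormedRing Matrix.linftyOpNormedAlgebra

/-- An analytic family of matrix quadratic equations with a fold at `zb`. -/
structure FoldFamily (am a0 ap : ℂ → Matrix S S ℂ) (zb : ℂ) (Bm B0 Bp N : Matrix S S ℝ) (w : ℝ)
    (y u g : S → ℝ) : Prop where
  fold : Fold Bm B0 Bp N w y u g
  am_analytic : AnalyticAt ℂ am zb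
  a0_analytic : AnalyticAt ℂ a0 zb
  ap_analytic : AnalyticAt ℂ ap zb
  am_eq : am zb = toC Bm
  a0_eq : a0 zb = toC B0
  ap_eq : ap zb = toC Bp
  transversal : vecC u ⬝ᵥ ((deriv am zb + (w : ℂ) • deriv a0 zb + (w : ℂ) ^ 2 • deriv ap zb) *ᵥ vecC y)
    ≠ 0

/-- The matrix quadratic polynomial whose zero is `G₁`. -/
def quad (Cm C0 Cp X : Matrix S S ℂ) : Matrix S S ℂ := Cm + C0 * X + Cp * (X * X) - X

namespace Fold

variable {Bm B0 Bp N : Matrix S S ℝ} {w : ℝ} {y u g : S → ℝ}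

theorem quad_eq_zero (h : Fold Bm B0 Bp N w y u g) :
    quad (toC Bm) (toC B0) (toC Bp) (toC N * toC Bm) = 0 := by
  have := h.mul_G_complex
  rw [quad]
  nth_rewrite 1 [← this]
  noncomm_ring

/-- The functional `D ↦ u D y` kills the range of the X-derivative: `u R = w⁻¹ u` gives `w u Bp = u
V`, and `G y = w y` turns the factor `G` on the right into `w`. -/
theorem pair_linear (h : Fold Bm B0 Bp N w y u g) (D : Matrix S S ℂ) :
    vecC u ⬝ᵥ ((toC B0 * D + toC Bp * (D * (toC N * toC Bm) + (toC N * toC Bm) * D) - D) *ᵥ vecC y)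
      = 0 := by
  have h1 : (vecC u ᵥ* (toC Bp * toC N)) ᵥ* (1 - (toC B0 + toC Bp * toC N * toC Bm))
      = vecC u ᵥ* toC Bp := by
    rw [Matrix.vecMul_vecMul, h.R_mul_complex]
  rw [h.vecMul_R_complex, Matrix.smul_vecMul] at h1
  have h2 := congrArg (fun q => (w : ℂ) * (q ⬝ᵥ (D *ᵥ vecC y))) h1
  simp only [smul_dotProduct, smul_eq_mul, mul_inv_cancel_left₀ h.wC_ne_zero, Matrix.vecMul_sub,
    Matrix.vecMul_one, Matrix.vecMul_add, sub_dotProduct, add_dotProduct,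
    ← Matrix.dotProduct_mulVec] at h2
  simp only [Matrix.sub_mulVec, Matrix.add_mulVec, Matrix.mul_add, dotProduct_sub, dotProduct_add,
    ← Matrix.mulVec_mulVec, h.G_mulVec_complex, Matrix.mulVec_smul, dotProduct_smul, smul_eq_mul]
    at h2 ⊢
  linear_combination (-1 : ℂ) * h2

end Fold

namespace FoldFamily

variable {am a0 ap : ℂ → Matrix S S ℂ} {zb : ℂ} {Bm B0 Bp N : Matrix S S ℝ} {w : ℝ}
  {y u g : S → ℝ}

/-- The derivative of the quadratic equation at the branch point. -/
noncomputable def linearization (am a0 ap : ℂ → Matrix S S ℂ) (zb : ℂ) (G : Matrix S S ℂ) (ζ : ℂ) (Y : Matrix S S ℂ) :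
    Matrix S S ℂ :=
  ζ • deriv am zb + (ζ • deriv a0 zb * G + a0 zb * Y) +
    (ζ • deriv ap zb * (G * G) + ap zb * (Y * G + G * Y)) - Y

theorem hasDerivAt_quad (h : FoldFamily am a0 ap zb Bm B0 Bp N w y u g) {Z : ℂ → ℂ}
    {X : ℂ → Matrix S S ℂ} {ζ : ℂ} {Y G : Matrix S S ℂ} {t : ℂ} (hZ : HasDerivAt Z ζ t)
    (hX : HasDerivAt X Y t) (hZt : Z t = zb) (hXt : X t = G) :
    HasDerivAt (fun s => quad (am (Z s)) (a0 (Z s)) (ap (Z s)) (X s))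
      (linearization am a0 ap zb G ζ Y) t := by
  subst hXt
  have hm : HasDerivAt (fun s => am (Z s)) (ζ • deriv am zb) t :=
    (hZt ▸ h.am_analytic.differentiableAt.hasDerivAt : HasDerivAt am (deriv am zb) (Z t)).scomp t hZ
  have h0 : HasDerivAt (fun s => a0 (Z s)) (ζ • deriv a0 zb) t :=
    (hZt ▸ h.a0_analytic.differentiableAt.hasDerivAt : HasDerivAt a0 (deriv a0 zb) (Z t)).scomp t hZ
  have hp : HasDerivAt (fun s => ap (Z s)) (ζ • deriv ap zb) t :=
    (hZt ▸ h.ap_analytic.differentiableAt.hasDerivAt : HasDerivAt ap (deriv ap zb) (Z t)).scomp t hZ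
  have := ((hm.add (h0.mul hX)).add (hp.mul (hX.mul hX))).sub hX
  rw [hZt] at this
  exact this

/-- Pairing with `u` and `y` leaves `ζ` times the transversality number, so `ζ = 0`. What remains,
multiplied by `N`, is the fixed point equation treated in `Fold.kernel`. -/
theorem linearization_eq_zero [Nonempty S] (h : FoldFamily am a0 ap zb Bm B0 Bp N w y u g)
    {ψ v : S → ℂ} (hψ0 : ψ ≠ 0)
    (hψ : ψ ᵥ* (toC N * toC Bm) = (w : ℂ) • ψ) (hv0 : v ≠ 0)
    (hv : (toC Bp * toC N) *ᵥ v = (w : ℂ)⁻¹ • v) {ζ : ℂ} {Y : Matrix S S ℂ}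
    (h0 : linearization am a0 ap zb (toC N * toC Bm) ζ Y = 0) :
    ζ = 0 ∧ ∃ κ : ℂ, Y = κ • Matrix.vecMulVec (toC N *ᵥ v) ψ := by
  set G := toC N * toC Bm with hG
  have hGy : G *ᵥ vecC y = (w : ℂ) • vecC y := h.fold.G_mulVec_complex
  have hsplit : linearization am a0 ap zb G ζ Y =
      ζ • (deriv am zb + deriv a0 zb * G + deriv ap zb * (G * G)) +
        (toC B0 * Y + toC Bp * (Y * G + G * Y) - Y) := by
    rw [linearization, h.a0_eq, h.ap_eq, Matrix.smul_mul, Matrix.smul_mul, smul_add, smul_add]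
    abel
  have hζ : ζ = 0 := by
    have h1 := congrArg (fun M => vecC u ⬝ᵥ (M *ᵥ vecC y)) (hsplit.symm.trans h0)
    rw [Matrix.add_mulVec, dotProduct_add, hG, h.fold.pair_linear, ← hG, Matrix.smul_mulVec,
      dotProduct_smul, smul_eq_mul, add_zero, Matrix.zero_mulVec, dotProduct_zero] at h1
    have h2 : (deriv am zb + deriv a0 zb * G + deriv ap zb * (G * G)) *ᵥ vecC y
        = (deriv am zb + (w : ℂ) • deriv a0 zb + (w : ℂ) ^ 2 • deriv ap zb) *ᵥ vecC y := by
      simp only [Matrix.add_mulVec, ← Matrix.mulVec_mulVec, hGy, Matrix.mulVec_smul,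
        Matrix.smul_mulVec, smul_smul, sq]
    rw [h2] at h1
    exact (mul_eq_zero.1 h1).resolve_right h.transversal
  refine ⟨hζ, h.fold.kernel hψ0 hψ hv0 hv ?_⟩
  rw [hsplit, hζ, zero_smul, zero_add] at h0
  have h1 : (1 - (toC B0 + toC Bp * toC N * toC Bm)) * Y = toC Bp * Y * G := by
    rw [← sub_eq_zero, ← neg_eq_zero, ← h0, hG]
    noncomm_ring
  have h2 := congrArg (toC N * ·) h1
  simp only [← Matrix.mul_assoc, h.fold.right_inv_complex, Matrix.one_mul] at h2
  exact h2.symm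

/-- The solutions of the quadratic equation near the branch point form an analytic curve,
parametrized by the eigenvalue. -/
theorem exists_curve [Nonempty S] (h : FoldFamily am a0 ap zb Bm B0 Bp N w y u g)
    {ψ : S → ℂ} (hψ0 : ψ ≠ 0) (hψ : ψ ᵥ* (toC N * toC Bm) = (w : ℂ) • ψ) :
    ∃ (Z : ℂ → ℂ) (X : ℂ → Matrix S S ℂ) (x : ℂ → S → ℂ), AnalyticAt ℂ Z w ∧ AnalyticAt ℂ X w ∧
      AnalyticAt ℂ x w ∧ Z w = zb ∧ X w = toC N * toC Bm ∧ x w = vecC y ∧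
      (∀ᶠ s in 𝓝 (w : ℂ), quad (am (Z s)) (a0 (Z s)) (ap (Z s)) (X s) = 0 ∧
        X s *ᵥ x s = s • x s ∧ ψ ⬝ᵥ x s = ψ ⬝ᵥ vecC y) ∧
      ∀ᶠ q : ℂ × Matrix S S ℂ × (S → ℂ) × ℂ in 𝓝 (zb, toC N * toC Bm, vecC y, (w : ℂ)),
        quad (am q.1) (a0 q.1) (ap q.1) q.2.1 = 0 → q.2.1 *ᵥ q.2.2.1 = q.2.2.2 • q.2.2.1 →
        ψ ⬝ᵥ q.2.2.1 = ψ ⬝ᵥ vecC y → q.1 = Z q.2.2.2 ∧ q.2.1 = X q.2.2.2 := by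
  set G := toC N * toC Bm with hG
  have hGy : G *ᵥ vecC y = (w : ℂ) • vecC y := h.fold.G_mulVec_complex
  have hψy := h.fold.left_G_dotProduct_ne_zero hψ0 hψ
  obtain ⟨v, hv0, hv⟩ : ∃ v : S → ℂ, v ≠ 0 ∧ (toC Bp * toC N) *ᵥ v = (w : ℂ)⁻¹ • v := by
    obtain ⟨v, -, h2, h3⟩ := h.fold.exists_right_R
    exact ⟨vecC v, vecC_ne_zero h2, by rw [← toC_mul, toC_mulVec, h3, vecC_smul, Complex.ofReal_inv]⟩
  have hψv := h.fold.left_N_right_ne_zero hψ0 hψ hv0 hv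
  -- The quadratic equation by itself is degenerate along the kernel direction. Adjoining the
  -- eigenvalue as a coordinate removes this, because it moves along that direction at a speed
  -- proportional to `ψ N v`, which is nonzero.
  let Φ : ℂ × Matrix S S ℂ × (S → ℂ) × ℂ → Matrix S S ℂ × (S → ℂ) × ℂ × ℂ :=
    fun q => (quad (am q.1) (a0 q.1) (ap q.1) q.2.1, q.2.1 *ᵥ q.2.2.1 - q.2.2.2 • q.2.2.1,
      ψ ⬝ᵥ q.2.2.1, q.2.2.2)
  set p : ℂ × Matrix S S ℂ × (S → ℂ) × ℂ := (zb, G, vecC y, (w : ℂ)) with hp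
  have hΦ : AnalyticAt ℂ Φ p := by
    have h1 : AnalyticAt ℂ (fun q : ℂ × Matrix S S ℂ × (S → ℂ) × ℂ => q.1) p := analyticAt_fst
    have h2 : AnalyticAt ℂ (fun q : ℂ × Matrix S S ℂ × (S → ℂ) × ℂ => q.2) p := analyticAt_snd
    have h3 : AnalyticAt ℂ (fun q : ℂ × Matrix S S ℂ × (S → ℂ) × ℂ => q.2.1) p :=
      AnalyticAt.comp analyticAt_fst h2
    have h4 : AnalyticAt ℂ (fun q : ℂ × Matrix S S ℂ × (S → ℂ) × ℂ => q.2.2) p :=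
      AnalyticAt.comp analyticAt_snd h2
    have h5 : AnalyticAt ℂ (fun q : ℂ × Matrix S S ℂ × (S → ℂ) × ℂ => q.2.2.1) p :=
      AnalyticAt.comp analyticAt_fst h4
    have h6 : AnalyticAt ℂ (fun q : ℂ × Matrix S S ℂ × (S → ℂ) × ℂ => q.2.2.2) p :=
      AnalyticAt.comp analyticAt_snd h4
    have hm : AnalyticAt ℂ (fun q : ℂ × Matrix S S ℂ × (S → ℂ) × ℂ => am q.1) p :=
      AnalyticAt.comp (x := p) (f := fun q : ℂ × Matrix S S ℂ × (S → ℂ) × ℂ => q.1)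
        h.am_analytic h1
    have h0 : AnalyticAt ℂ (fun q : ℂ × Matrix S S ℂ × (S → ℂ) × ℂ => a0 q.1) p :=
      AnalyticAt.comp (x := p) (f := fun q : ℂ × Matrix S S ℂ × (S → ℂ) × ℂ => q.1)
        h.a0_analytic h1
    have hpp : AnalyticAt ℂ (fun q : ℂ × Matrix S S ℂ × (S → ℂ) × ℂ => ap q.1) p :=
      AnalyticAt.comp (x := p) (f := fun q : ℂ × Matrix S S ℂ × (S → ℂ) × ℂ => q.1)
        h.ap_analytic h1
    exact (((hm.add (h0.mul h3)).add (hpp.mul (h3.mul h3))).sub h3).prod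
      (((analyticAt_mulVec h3 h5).sub (h6.smul h5)).prod ((analyticAt_dotProduct ψ h5).prod h6))
  have hΦp : Φ p = (0, 0, ψ ⬝ᵥ vecC y, (w : ℂ)) := by
    simp only [Φ, hp, hGy, sub_self, h.am_eq, h.a0_eq, h.ap_eq]
    rw [hG, h.fold.quad_eq_zero]
  obtain ⟨k, hk, hk0, hr, hl⟩ := exists_analytic_local_inverse (by
      simp only [Module.finrank_prod]; ring) hΦ (by
    rintro ⟨ζ, Y, ξ, σ⟩ hv'
    have hline := hasDerivAt_line p (ζ, Y, ξ, σ)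
    have hζ := hasDerivAt_fst hline
    have hY := hasDerivAt_fst (hasDerivAt_snd hline)
    have hξ := hasDerivAt_fst (hasDerivAt_snd (hasDerivAt_snd hline))
    have hσ := hasDerivAt_snd (hasDerivAt_snd (hasDerivAt_snd hline))
    have e1 : linearization am a0 ap zb G ζ Y = 0 :=
      (h.hasDerivAt_quad hζ hY (by simp [hp]) (by simp [hp])).unique (hasDerivAt_fst hv')
    have e2 := ((hasDerivAt_mulVec hY hξ).sub (hσ.smul hξ)).unique
      (hasDerivAt_fst (hasDerivAt_snd hv'))
    have e3 : ψ ⬝ᵥ ξ = 0 := (hasDerivAt_dotProduct ψ hξ).unique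
      (hasDerivAt_fst (hasDerivAt_snd (hasDerivAt_snd hv')))
    have e4 : σ = 0 := hσ.unique (hasDerivAt_snd (hasDerivAt_snd (hasDerivAt_snd hv')))
    obtain ⟨rfl, κ, rfl⟩ := h.linearization_eq_zero hψ0 hψ hv0 hv e1
    subst e4
    simp only [zero_smul, add_zero, Prod.fst_zero, Prod.snd_zero, hp] at e2
    have e5 := congrArg (ψ ⬝ᵥ ·) e2
    simp only [dotProduct_sub, dotProduct_add, dotProduct_smul, Matrix.dotProduct_mulVec, hψ,
      smul_dotProduct, e3, dotProduct_zero, smul_eq_mul, mul_zero, add_zero, sub_zero,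
      Matrix.vecMul_smul, Matrix.vecMul_vecMulVec] at e5
    have hκ : κ = 0 := (mul_eq_zero.1 e5).resolve_right (mul_ne_zero (by
      rwa [← Matrix.dotProduct_mulVec]) hψy)
    subst hκ
    rw [zero_smul, Matrix.zero_mulVec, zero_add, sub_eq_zero] at e2
    obtain ⟨c, rfl⟩ := h.fold.G_right_unique e2
    rw [dotProduct_smul, smul_eq_mul] at e3
    have hc : c = 0 := (mul_eq_zero.1 e3).resolve_right hψy
    simp [hc])
  rw [hΦp] at hk hk0 hr
  have hins : AnalyticAt ℂ (fun s : ℂ =>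
      ((0, 0, ψ ⬝ᵥ vecC y, s) : Matrix S S ℂ × (S → ℂ) × ℂ × ℂ)) w :=
    analyticAt_const.prod (analyticAt_const.prod (analyticAt_const.prod analyticAt_id))
  have hcomp : AnalyticAt ℂ (fun s => k (0, 0, ψ ⬝ᵥ vecC y, s)) w :=
    AnalyticAt.comp (f := fun s : ℂ =>
      ((0, 0, ψ ⬝ᵥ vecC y, s) : Matrix S S ℂ × (S → ℂ) × ℂ × ℂ)) hk hins
  have hcomp2 : AnalyticAt ℂ (fun s => (k (0, 0, ψ ⬝ᵥ vecC y, s)).2) w :=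
    AnalyticAt.comp analyticAt_snd hcomp
  have hcomp3 : AnalyticAt ℂ (fun s => (k (0, 0, ψ ⬝ᵥ vecC y, s)).2.2) w :=
    AnalyticAt.comp analyticAt_snd hcomp2
  refine ⟨fun s => (k (0, 0, ψ ⬝ᵥ vecC y, s)).1, fun s => (k (0, 0, ψ ⬝ᵥ vecC y, s)).2.1,
    fun s => (k (0, 0, ψ ⬝ᵥ vecC y, s)).2.2.1,
    AnalyticAt.comp analyticAt_fst hcomp, AnalyticAt.comp analyticAt_fst hcomp2,
    AnalyticAt.comp analyticAt_fst hcomp3, by simp only [hk0, hp], by simp only [hk0, hp],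
    by simp only [hk0, hp], ?_, ?_⟩
  · filter_upwards [hins.continuousAt.eventually hr] with s hs
    simp only [Φ, Prod.mk.injEq] at hs
    obtain ⟨h1, h2, h3, h4⟩ := hs
    rw [h4, sub_eq_zero] at h2
    exact ⟨h1, h2, h3⟩
  · filter_upwards [hl] with q hq h1 h2 h3
    have : Φ q = (0, 0, ψ ⬝ᵥ vecC y, q.2.2.2) := by simp only [Φ, h1, h2, sub_self, h3]
    rw [this] at hq
    rw [hq]
    exact ⟨rfl, rfl⟩

end FoldFamily

end FoldCurve

/-! ### Second-order contact of the curve with `z = zb` -/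

section Puiseux

variable {S : Type*} [Fintype S] [DecidableEq S]

attribute [local instance] Matrix.linftyOpNormedRing Matrix.linftyOpNormedAlgebra

namespace FoldFamily

variable {am a0 ap : ℂ → Matrix S S ℂ} {zb : ℂ} {Bm B0 Bp N : Matrix S S ℝ} {w : ℝ}
  {y u g : S → ℝ}

theorem continuous_pair (u y : S → ℂ) : Continuous fun M : Matrix S S ℂ => u ⬝ᵥ (M *ᵥ y) := by
  have : (fun M : Matrix S S ℂ => u ⬝ᵥ (M *ᵥ y)) = fun M => ∑ a, u a * ∑ b, M a b * y b := rfl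
  rw [this]
  exact continuous_finsetSum _ fun a _ => continuous_const.mul (continuous_finsetSum _ fun b _ =>
    ((entryL a b).continuous.mul continuous_const))

/-- The derivative is a multiple of the kernel element; differentiating `X x = s x` and pairing with
`ψ` determines the multiple. -/
theorem hasDerivAt_curve [Nonempty S] (h : FoldFamily am a0 ap zb Bm B0 Bp N w y u g)
    {ψ v : S → ℂ} (hψ0 : ψ ≠ 0) (hψ : ψ ᵥ* (toC N * toC Bm) = (w : ℂ) • ψ) (hv0 : v ≠ 0)
    (hv : (toC Bp * toC N) *ᵥ v = (w : ℂ)⁻¹ • v) {Z : ℂ → ℂ} {X : ℂ → Matrix S S ℂ}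
    {x : ℂ → S → ℂ} (hZ : AnalyticAt ℂ Z w) (hX : AnalyticAt ℂ X w) (hx : AnalyticAt ℂ x w)
    (hZw : Z w = zb) (hXw : X w = toC N * toC Bm) (hxw : x w = vecC y)
    (heq : ∀ᶠ s in 𝓝 (w : ℂ), quad (am (Z s)) (a0 (Z s)) (ap (Z s)) (X s) = 0 ∧
        X s *ᵥ x s = s • x s ∧ ψ ⬝ᵥ x s = ψ ⬝ᵥ vecC y) :
    HasDerivAt X ((ψ ⬝ᵥ (toC N *ᵥ v))⁻¹ • Matrix.vecMulVec (toC N *ᵥ v) ψ) w := by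
  have hψy := h.fold.left_G_dotProduct_ne_zero hψ0 hψ
  have hψv := h.fold.left_N_right_ne_zero hψ0 hψ hv0 hv
  have dZ := hZ.differentiableAt.hasDerivAt
  obtain ⟨Xd, dX⟩ : ∃ Xd, HasDerivAt X Xd w := ⟨_, hX.differentiableAt.hasDerivAt⟩
  have dx := hx.differentiableAt.hasDerivAt
  have e1 : linearization am a0 ap zb (toC N * toC Bm) (deriv Z w) Xd = 0 :=
    (h.hasDerivAt_quad dZ dX hZw hXw).unique ((hasDerivAt_const (w : ℂ) (0 : Matrix S S ℂ)).congr_of_eventuallyEq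
      (heq.mono fun s hs => hs.1))
  obtain ⟨-, κ, hκ⟩ := h.linearization_eq_zero hψ0 hψ hv0 hv e1
  have e2 := ((hasDerivAt_mulVec dX dx).sub ((hasDerivAt_id (w : ℂ)).smul dx)).unique
    ((hasDerivAt_const (w : ℂ) (0 : S → ℂ)).congr_of_eventuallyEq
      (heq.mono fun s hs => by simpa [sub_eq_zero] using hs.2.1))
  rw [hXw, hxw, hκ] at e2
  have e5 := congrArg (ψ ⬝ᵥ ·) e2
  simp only [dotProduct_sub, dotProduct_add, dotProduct_smul, Matrix.dotProduct_mulVec, hψ, id,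
    smul_dotProduct, dotProduct_zero, smul_eq_mul, one_mul,
    Matrix.vecMul_smul, Matrix.vecMul_vecMulVec] at e5
  rw [← Matrix.dotProduct_mulVec] at e5
  have hκ1 : κ = (ψ ⬝ᵥ (toC N *ᵥ v))⁻¹ := by
    refine eq_inv_of_mul_eq_one_left ?_
    apply mul_right_cancel₀ hψy
    linear_combination e5
  rw [← hκ1, ← hκ]
  exact dX

/-- The expansion about the branch point is exact: the equation is quadratic in `X` and `dslope`
absorbs the dependence on `z`. The part linear in `X - G` disappears by `pair_linear`. -/
theorem quad_expand (h : FoldFamily am a0 ap zb Bm B0 Bp N w y u g) {z : ℂ} {X : Matrix S S ℂ}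
    (hq : quad (am z) (a0 z) (ap z) X = 0) :
    (zb - z) * (vecC u ⬝ᵥ ((dslope am zb z + dslope a0 zb z * X + dslope ap zb z * (X * X)) *ᵥ vecC y))
      = vecC u ⬝ᵥ ((toC Bp * ((X - toC N * toC Bm) * (X - toC N * toC Bm))) *ᵥ vecC y) := by
  set G := toC N * toC Bm with hG
  have h1 : (z - zb) • (dslope am zb z + dslope a0 zb z * X + dslope ap zb z * (X * X))
      = (am z - toC Bm) + (a0 z - toC B0) * X + (ap z - toC Bp) * (X * X) := by
    rw [← h.am_eq, ← h.a0_eq, ← h.ap_eq, ← sub_smul_dslope am, ← sub_smul_dslope a0,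
      ← sub_smul_dslope ap, smul_add, smul_add, Matrix.smul_mul, Matrix.smul_mul]
  have h2 : (z - zb) • (dslope am zb z + dslope a0 zb z * X + dslope ap zb z * (X * X))
      + (toC B0 * (X - G) + toC Bp * ((X - G) * G + G * (X - G)) - (X - G))
      + toC Bp * ((X - G) * (X - G)) = 0 := by
    have h3 := h.fold.quad_eq_zero
    rw [← hG] at h3
    rw [h1, ← hq, ← sub_zero (quad (am z) (a0 z) (ap z) X), ← h3, quad, quad]
    noncomm_ring
  have h4 := congrArg (fun M => vecC u ⬝ᵥ (M *ᵥ vecC y)) h2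
  beta_reduce at h4
  rw [Matrix.add_mulVec, Matrix.add_mulVec, dotProduct_add, dotProduct_add, h.fold.pair_linear,
    Matrix.smul_mulVec, dotProduct_smul, smul_eq_mul, Matrix.zero_mulVec, dotProduct_zero] at h4
  linear_combination -h4

/-- Along the curve the parameter `z` has a nondegenerate quadratic fold. -/
theorem exists_fold_limit [Nonempty S] (h : FoldFamily am a0 ap zb Bm B0 Bp N w y u g)
    {ψ v : S → ℂ} (hψ0 : ψ ≠ 0) (hψ : ψ ᵥ* (toC N * toC Bm) = (w : ℂ) • ψ) (hv0 : v ≠ 0)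
    (hv : (toC Bp * toC N) *ᵥ v = (w : ℂ)⁻¹ • v) {Z : ℂ → ℂ} {X : ℂ → Matrix S S ℂ}
    (hZ : AnalyticAt ℂ Z w) (hX : HasDerivAt X ((ψ ⬝ᵥ (toC N *ᵥ v))⁻¹ • Matrix.vecMulVec (toC N *ᵥ v) ψ) w)
    (hZw : Z w = zb) (hXw : X w = toC N * toC Bm)
    (heq : ∀ᶠ s in 𝓝 (w : ℂ), quad (am (Z s)) (a0 (Z s)) (ap (Z s)) (X s) = 0) :
    ∃ c : ℂ, c ≠ 0 ∧ Tendsto (fun s => (zb - Z s) / (s - w) ^ 2) (𝓝[≠] (w : ℂ)) (𝓝 c) := by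
  have hψy := h.fold.left_G_dotProduct_ne_zero hψ0 hψ
  have hψv := h.fold.left_N_right_ne_zero hψ0 hψ hv0 hv
  have huv := h.fold.dotProduct_right_R_ne_zero hv0 hv
  set G := toC N * toC Bm with hG
  have hGy : G *ᵥ vecC y = (w : ℂ) • vecC y := h.fold.G_mulVec_complex
  set X' := (ψ ⬝ᵥ (toC N *ᵥ v))⁻¹ • Matrix.vecMulVec (toC N *ᵥ v) ψ with hX'
  set K : ℂ → ℂ := fun s => vecC u ⬝ᵥ ((dslope am zb (Z s) + dslope a0 zb (Z s) * X s +
    dslope ap zb (Z s) * (X s * X s)) *ᵥ vecC y) with hK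
  set d := vecC u ⬝ᵥ ((deriv am zb + (w : ℂ) • deriv a0 zb + (w : ℂ) ^ 2 • deriv ap zb) *ᵥ vecC y)
    with hd
  have hcK : Tendsto K (𝓝 (w : ℂ)) (𝓝 d) := by
    have hc : ∀ a : ℂ → Matrix S S ℂ, AnalyticAt ℂ a zb →
        Tendsto (fun s => dslope a zb (Z s)) (𝓝 (w : ℂ)) (𝓝 (deriv a zb)) := fun a ha => by
      have h1 : ContinuousAt (dslope a zb) zb := continuousAt_dslope_same.2 ha.differentiableAt
      have h2 : Tendsto Z (𝓝 (w : ℂ)) (𝓝 zb) := hZw ▸ hZ.continuousAt.tendsto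
      have h3 := h1.tendsto.comp h2
      rwa [dslope_same] at h3
    have hXt : Tendsto X (𝓝 (w : ℂ)) (𝓝 G) := hXw ▸ hX.continuousAt.tendsto
    have h1 := ((hc am h.am_analytic).add ((hc a0 h.a0_analytic).mul hXt)).add
      ((hc ap h.ap_analytic).mul (hXt.mul hXt))
    have h2 := ((continuous_pair (vecC u) (vecC y)).tendsto _).comp h1
    have h3 : (deriv am zb + deriv a0 zb * G + deriv ap zb * (G * G)) *ᵥ vecC y
        = (deriv am zb + (w : ℂ) • deriv a0 zb + (w : ℂ) ^ 2 • deriv ap zb) *ᵥ vecC y := by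
      simp only [Matrix.add_mulVec, ← Matrix.mulVec_mulVec, hGy, Matrix.mulVec_smul,
        Matrix.smul_mulVec, smul_smul, sq]
    rw [h3] at h2
    exact h2
  have hd0 : d ≠ 0 := h.transversal
  have hslope : Tendsto (slope X (w : ℂ)) (𝓝[≠] (w : ℂ)) (𝓝 X') := hX.tendsto_slope
  have hlim : Tendsto (fun s => (vecC u ⬝ᵥ ((toC Bp * (slope X w s * slope X w s)) *ᵥ vecC y)) / K s)
      (𝓝[≠] (w : ℂ)) (𝓝 ((vecC u ⬝ᵥ ((toC Bp * (X' * X')) *ᵥ vecC y)) / d)) :=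
    (((continuous_pair (vecC u) (vecC y)).tendsto _).comp
      ((hslope.mul hslope).const_mul (toC Bp))).div (hcK.mono_left nhdsWithin_le_nhds) hd0
  refine ⟨_, ?_, hlim.congr' ?_⟩
  -- As the derivative of the curve has rank one, the numerator is `w⁻¹ (u ⬝ v) (ψ ⬝ y) / (ψ N v)`,
  -- and no factor is zero.
  · refine div_ne_zero ?_ hd0
    have h1 : vecC u ᵥ* toC Bp ⬝ᵥ (toC N *ᵥ v) = (w : ℂ)⁻¹ * (vecC u ⬝ᵥ v) := by
      rw [← Matrix.dotProduct_mulVec, Matrix.mulVec_mulVec, hv, dotProduct_smul, smul_eq_mul]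
    have h2 : vecC u ⬝ᵥ ((toC Bp * (X' * X')) *ᵥ vecC y)
        = (ψ ⬝ᵥ (toC N *ᵥ v))⁻¹ * ((ψ ⬝ᵥ (toC N *ᵥ v))⁻¹ * ((ψ ⬝ᵥ (toC N *ᵥ v)) *
          ((w : ℂ)⁻¹ * (vecC u ⬝ᵥ v)) * (ψ ⬝ᵥ vecC y))) := by
      rw [Matrix.dotProduct_mulVec, ← Matrix.vecMul_vecMul, ← Matrix.vecMul_vecMul, hX',
        Matrix.vecMul_smul, Matrix.vecMul_smul, Matrix.vecMul_vecMulVec,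
        Matrix.vecMul_vecMulVec]
      simp only [smul_dotProduct, smul_eq_mul, h1]
      ring
    rw [h2]
    have := h.fold.wC_ne_zero
    exact mul_ne_zero (inv_ne_zero hψv) (mul_ne_zero (inv_ne_zero hψv) (mul_ne_zero
      (mul_ne_zero hψv (mul_ne_zero (inv_ne_zero this) huv)) hψy))
  · have hKne : ∀ᶠ s in 𝓝[≠] (w : ℂ), K s ≠ 0 :=
      (hcK.eventually_ne hd0).filter_mono nhdsWithin_le_nhds
    filter_upwards [hKne, heq.filter_mono nhdsWithin_le_nhds, self_mem_nhdsWithin] with s h1 h2 h3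
    have h4 : s - (w : ℂ) ≠ 0 := sub_ne_zero.2 h3
    have h5 := h.quad_expand h2
    have h6 : X s - X w = (s - (w : ℂ)) • slope X (w : ℂ) s := (sub_smul_slope X (w : ℂ) s).symm
    rw [← hG, ← hXw, h6] at h5
    simp only [Matrix.smul_mul, Matrix.mul_smul, smul_smul, Matrix.smul_mulVec, dotProduct_smul,
      smul_eq_mul] at h5
    rw [div_eq_div_iff h1 (pow_ne_zero 2 h4)]
    linear_combination -h5

end FoldFamily

end Puiseux

/-! ### From the fold to a function of the square root -/

section Branch

variable {S : Type*} [Fintype S] [DecidableEq S]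

attribute [local instance] Matrix.linftyOpNormedRing Matrix.linftyOpNormedAlgebra

theorem cpow_half_sq (z : ℂ) : (z ^ (1 / 2 : ℂ)) ^ 2 = z := by
  simp

/-- A continuous branch of solutions of the quadratic equation that ends at the fold is an analytic
function of the square root. -/
theorem FoldFamily.exists_puiseux [Nonempty S] {am a0 ap : ℂ → Matrix S S ℂ} {zb : ℂ}
    {Bm B0 Bp N : Matrix S S ℝ} {w : ℝ} {y u g : S → ℝ}
    (h : FoldFamily am a0 ap zb Bm B0 Bp N w y u g) {T : Set ℂ} {Gf : ℂ → Matrix S S ℂ}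
    (hGc : ContinuousOn Gf T) (hzb : zb ∈ T) (hG0 : Gf zb = toC N * toC Bm)
    (hq : ∀ z ∈ T, quad (am z) (a0 z) (ap z) (Gf z) = 0)
    (hslit : ∀ z ∈ T, z ≠ zb → zb - z ∈ Complex.slitPlane)
    (hconn : ∀ U ∈ 𝓝 zb, ∃ V ∈ 𝓝 zb, V ⊆ U ∧ IsPreconnected ((T ∩ V) \ {zb}))
    {ψ : S → ℂ} (hψ0 : ψ ≠ 0) (hψ : ψ ᵥ* (toC N * toC Bm) = (w : ℂ) • ψ)
    {x : Matrix S S ℂ → S → ℂ} {α : Matrix S S ℂ → ℂ} (hx : AnalyticAt ℂ x (toC N * toC Bm))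
    (hα : AnalyticAt ℂ α (toC N * toC Bm)) (hx0 : x (toC N * toC Bm) = vecC y)
    (hα0 : α (toC N * toC Bm) = w)
    (heig : ∀ᶠ M in 𝓝 (toC N * toC Bm), M *ᵥ x M = α M • x M ∧ ψ ⬝ᵥ x M = ψ ⬝ᵥ vecC y) :
    ∃ (Gt : ℂ → Matrix S S ℂ) (αt : ℂ → ℂ) (αt' : ℂ), AnalyticAt ℂ Gt 0 ∧ AnalyticAt ℂ αt 0 ∧
      αt 0 = w ∧ HasDerivAt αt αt' 0 ∧ αt' ≠ 0 ∧
      (∀ v : S → ℂ, v ≠ 0 → (toC Bp * toC N) *ᵥ v = (w : ℂ)⁻¹ • v →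
        HasDerivAt Gt (αt' • ((ψ ⬝ᵥ (toC N *ᵥ v))⁻¹ • Matrix.vecMulVec (toC N *ᵥ v) ψ)) 0) ∧
      ∀ᶠ z in 𝓝[T] zb, Gf z = Gt ((zb - z) ^ (1 / 2 : ℂ)) ∧
        αt ((zb - z) ^ (1 / 2 : ℂ)) = α (Gf z) := by
  set G := toC N * toC Bm with hG
  obtain ⟨Z, X, xc, hZ, hX, hxc, hZw, hXw, hxw, heq, huniq⟩ := h.exists_curve hψ0 hψ
  obtain ⟨v₀, hv0, hv⟩ : ∃ v : S → ℂ, v ≠ 0 ∧ (toC Bp * toC N) *ᵥ v = (w : ℂ)⁻¹ • v := by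
    obtain ⟨v, -, h2, h3⟩ := h.fold.exists_right_R
    exact ⟨vecC v, vecC_ne_zero h2, by rw [← toC_mul, toC_mulVec, h3, vecC_smul, Complex.ofReal_inv]⟩
  obtain ⟨c, hc, hlim⟩ := h.exists_fold_limit hψ0 hψ hv0 hv hZ
    (h.hasDerivAt_curve hψ0 hψ hv0 hv hZ hX hxc hZw hXw hxw heq) hZw hXw (heq.mono fun s hs => hs.1)
  obtain ⟨φ, hφ, hφ0, ⟨φ', hφ'0, hφ'⟩, hφ2⟩ := exists_analytic_sqrt (analyticAt_const.sub hZ)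
    (by simp [hZw]) hc hlim
  obtain ⟨ω, hω, hωw, -, hωφ, hω'⟩ := exists_analytic_local_inverse_one hφ hφ' hφ'0
  rw [hφ0] at hω hωw hω'
  have hGt : Tendsto Gf (𝓝[T] zb) (𝓝 G) := hG0 ▸ hGc zb hzb
  have hαt : Tendsto (fun z => α (Gf z)) (𝓝[T] zb) (𝓝 (w : ℂ)) := by
    rw [← hα0]; exact hα.continuousAt.tendsto.comp hGt
  have hxt : Tendsto (fun z => x (Gf z)) (𝓝[T] zb) (𝓝 (vecC y)) := by
    rw [← hx0]; exact hx.continuousAt.tendsto.comp hGt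
  have hzt : Tendsto (fun z : ℂ => z) (𝓝[T] zb) (𝓝 zb) := nhdsWithin_le_nhds
  -- By local uniqueness the branch lies on the curve, at the parameter given by its own eigenvalue.
  have hgood : ∀ᶠ z in 𝓝[T] zb, Gf z = X (α (Gf z)) ∧ φ (α (Gf z)) ^ 2 = zb - z ∧
      ω (φ (α (Gf z))) = α (Gf z) ∧ ContinuousAt α (Gf z) ∧ ContinuousAt φ (α (Gf z)) := by
    have hquad := (hzt.prodMk_nhds (hGt.prodMk_nhds (hxt.prodMk_nhds hαt))).eventually huniq
    filter_upwards [hquad, hGt.eventually heig, hαt.eventually hφ2, hαt.eventually hωφ,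
      hGt.eventually hα.eventually_analyticAt, hαt.eventually hφ.eventually_analyticAt,
      self_mem_nhdsWithin] with z h1 h2 h3 h4 h5 h6 hz
    obtain ⟨h7, h8⟩ := h1 (hq z hz) h2.1 h2.2
    refine ⟨h8, ?_, h4, h5.continuousAt, h6.continuousAt⟩
    rw [← h3]
    simp only [Pi.sub_apply]
    rw [← h7]
  obtain ⟨U, hU, hUT⟩ := mem_nhdsWithin_iff_exists_mem_nhds_inter.1 hgood
  obtain ⟨V, hV, hVU, hVc⟩ := hconn U hU
  have hgoodV : ∀ z ∈ (T ∩ V) \ {zb}, Gf z = X (α (Gf z)) ∧ φ (α (Gf z)) ^ 2 = zb - z ∧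
      ω (φ (α (Gf z))) = α (Gf z) ∧ ContinuousAt α (Gf z) ∧ ContinuousAt φ (α (Gf z)) :=
    fun z hz => hUT ⟨hVU hz.1.2, hz.1.1⟩
  -- Two continuous square roots of a nonvanishing function on a preconnected set differ by a
  -- constant sign, here `σ = 1` or `σ = -1`.
  have hsgn : ∃ σ : ℂ, σ ≠ 0 ∧ ∀ z ∈ (T ∩ V) \ {zb}, φ (α (Gf z)) = σ * (zb - z) ^ (1 / 2 : ℂ) := by
    have hf : ContinuousOn (fun z => φ (α (Gf z))) ((T ∩ V) \ {zb}) := fun z hz => by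
      obtain ⟨-, -, -, h4, h5⟩ := hgoodV z hz
      have h6 : ContinuousWithinAt Gf ((T ∩ V) \ {zb}) z :=
        (hGc z hz.1.1).mono fun z hz => hz.1.1
      have h7 : ContinuousWithinAt (fun z => α (Gf z)) ((T ∩ V) \ {zb}) z :=
        h4.comp_continuousWithinAt h6
      exact ContinuousAt.comp_continuousWithinAt (f := fun z => α (Gf z)) h5 h7
    have hg : ContinuousOn (fun z : ℂ => (zb - z) ^ (1 / 2 : ℂ)) ((T ∩ V) \ {zb}) := fun z hz =>
      ((continuousAt_const.sub continuousAt_id).cpow continuousAt_const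
        (hslit z hz.1.1 hz.2)).continuousWithinAt
    rcases hVc.eq_or_eq_neg_of_sq_eq hf hg (fun z hz => by
        simp only [Pi.pow_apply]
        rw [(hgoodV z hz).2.1, cpow_half_sq]) (fun {z} hz h0 => by
        have := cpow_half_sq (zb - z)
        rw [h0] at this
        refine hz.2 (sub_eq_zero.1 ?_).symm
        rw [← this]; simp) with h1 | h1
    · exact ⟨1, one_ne_zero, fun z hz => by rw [one_mul]; exact h1 hz⟩
    · exact ⟨-1, by simp, fun z hz => by rw [neg_one_mul]; exact h1 hz⟩
  obtain ⟨σ, hσ, hσz⟩ := hsgn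
  have hlin : HasDerivAt (fun t : ℂ => σ * t) σ 0 := by simpa using (hasDerivAt_id (0 : ℂ)).const_mul σ
  have hlin0 : σ * (0 : ℂ) = 0 := mul_zero σ
  have hlina : AnalyticAt ℂ (fun t : ℂ => σ * t) 0 := analyticAt_const.mul analyticAt_id
  have hαta : AnalyticAt ℂ (fun t => ω (σ * t)) 0 :=
    AnalyticAt.comp (f := fun t : ℂ => σ * t) (x := 0) (by rwa [hlin0]) hlina
  have hα0' : ω (σ * 0) = w := by rw [hlin0, hωw]
  have hαd : HasDerivAt (fun t => ω (σ * t)) (φ'⁻¹ * σ) 0 :=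
    HasDerivAt.comp (0 : ℂ) (h₂ := ω) (h := fun t => σ * t) (by rwa [hlin0]) hlin
  refine ⟨fun t => X (ω (σ * t)), fun t => ω (σ * t), φ'⁻¹ * σ,
    AnalyticAt.comp (f := fun t : ℂ => ω (σ * t)) (x := 0) (by rwa [hα0']) hαta, hαta, hα0', hαd,
    mul_ne_zero (inv_ne_zero hφ'0) hσ, fun v hv0 hv => ?_, ?_⟩
  · have h1 := h.hasDerivAt_curve hψ0 hψ hv0 hv hZ hX hxc hZw hXw hxw heq
    rw [← hα0'] at h1
    exact HasDerivAt.scomp (0 : ℂ) (g₁ := X) (h := fun t => ω (σ * t)) h1 hαd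
  · filter_upwards [self_mem_nhdsWithin, nhdsWithin_le_nhds hV] with z hzT hzV
    by_cases hz : z = zb
    · subst hz
      rw [sub_self, Complex.zero_cpow (by norm_num), hα0', hG0, hXw, hα0]
      exact ⟨rfl, rfl⟩
    · obtain ⟨h1, -, h3, -⟩ := hgoodV z ⟨⟨hzT, hzV⟩, hz⟩
      rw [← hσz z ⟨⟨hzT, hzV⟩, hz⟩, h3]
      exact ⟨h1, rfl⟩

end Branch

/-! ### G₁ as a branch at the fold -/

section BranchOfG

variable {S : Type*} [Fintype S] [DecidableEq S] {A : ℤ → ℤ → Matrix S S ℝ} {w : ℝ} {y u g : S → ℝ}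

attribute [local instance] Matrix.linftyOpNormedRing Matrix.linftyOpNormedAlgebra

theorem hasDerivAt_Acol (A : ℤ → ℤ → Matrix S S ℝ) (j : ℤ) {z : ℂ} (hz : z ≠ 0) :
    HasDerivAt (Acol A j) (∑ i ∈ H, ((i : ℂ) * z ^ (i - 1)) • toC (A i j)) z :=
  HasDerivAt.fun_sum fun _ _ => (hasDerivAt_zpow _ z (Or.inl hz)).smul_const _

theorem analyticAt_Acol (A : ℤ → ℤ → Matrix S S ℝ) (j : ℤ) {z : ℂ} (hz : z ≠ 0) :
    AnalyticAt ℂ (Acol A j) z :=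
  Finset.analyticAt_fun_sum _ fun _ _ => (analyticAt_id.zpow hz).smul analyticAt_const

theorem zMaxC_ne_zero (A : ℤ → ℤ → Matrix S S ℝ) : (zMax A : ℂ) ≠ 0 := by
  exact_mod_cast (zMax_pos A).ne'

theorem Critical.foldFamily [Nonempty S] (hc : Critical A w y u g) (hA : Blocks A) :
    FoldFamily (Acol A (-1)) (Acol A 0) (Acol A 1) (zMax A : ℂ) (Ar A (-1) (zMax A))
      (Ar A 0 (zMax A)) (Ar A 1 (zMax A)) (Nr A (zMax A)) w y u g where
  fold := hc.fold hA
  am_analytic := analyticAt_Acol A _ (zMaxC_ne_zero A)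
  a0_analytic := analyticAt_Acol A _ (zMaxC_ne_zero A)
  ap_analytic := analyticAt_Acol A _ (zMaxC_ne_zero A)
  am_eq := Acol_ofReal A _ _
  a0_eq := Acol_ofReal A _ _
  ap_eq := Acol_ofReal A _ _
  transversal := by
    have hz := zMaxC_ne_zero A
    have hw := (hc.fold hA).wC_ne_zero
    have hd : ∀ j, deriv (Acol A j) (zMax A : ℂ)
        = ∑ i ∈ H, ((i : ℂ) * (zMax A : ℂ) ^ (i - 1)) • toC (A i j) :=
      fun j => (hasDerivAt_Acol A j hz).deriv
    change vecC u ⬝ᵥ ((deriv (Acol A (-1)) (zMax A : ℂ) + (w : ℂ) • deriv (Acol A 0) (zMax A : ℂ) +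
      (w : ℂ) ^ 2 • deriv (Acol A 1) (zMax A : ℂ)) *ᵥ vecC y) ≠ 0
    rw [hd, hd, hd]
    -- Differentiating `z ^ i` brings down the weight `i`, so transversality is the positivity of
    -- the first tilted drift; the factor `w / z̄` comes from the powers.
    have h1 : (∑ i ∈ H, ((i : ℂ) * (zMax A : ℂ) ^ (i - 1)) • toC (A i (-1)))
        + (w : ℂ) • (∑ i ∈ H, ((i : ℂ) * (zMax A : ℂ) ^ (i - 1)) • toC (A i 0))
        + (w : ℂ) ^ 2 • (∑ i ∈ H, ((i : ℂ) * (zMax A : ℂ) ^ (i - 1)) • toC (A i 1))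
        = ((w : ℂ) / (zMax A : ℂ)) • toC (Crw A (fun i _ => i) (zMax A) w) := by
      ext a b
      simp only [sum_H, Crw, Matrix.add_apply, Matrix.smul_apply, Matrix.map_apply, smul_eq_mul]
      push_cast
      simp only [zpow_zero, zpow_one, zpow_neg_one]
      field_simp
    rw [h1, Matrix.smul_mulVec, dotProduct_smul, toC_mulVec, vecC_dotProduct, smul_eq_mul]
    refine mul_ne_zero (div_ne_zero hw hz) ?_
    exact_mod_cast hc.drift_pos.ne'

theorem quad_G₁ (hA : Blocks A) (hc : Critical A w y u g) {z : ℂ} (hz : z ∈ annulus A) :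
    quad (Acol A (-1) z) (Acol A 0 z) (Acol A 1 z) (G₁ A z) = 0 := by
  have h1 := N₁_eq hA hc hz
  rw [quad, sub_eq_zero, G₁_eq hA hc hz]
  generalize Acol A (-1) z = B at h1 ⊢
  conv_rhs => rw [h1]
  noncomm_ring

theorem zMax_mem_Icc (hc : Critical A w y u g) : zMax A ∈ Set.Icc (zMin A) (zMax A) :=
  ⟨hc.zMin_lt.le, le_rfl⟩

theorem G₁_ofReal (hA : Blocks A) (hc : Critical A w y u g) {x : ℝ}
    (hx : x ∈ Set.Icc (zMin A) (zMax A)) : G₁ A x = toC (Nr A x) * toC (Ar A (-1) x) := by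
  rw [G₁_eq hA hc (ofReal_mem_annulus hx), N₁_ofReal hA hc hx, Acol_ofReal]

theorem R₁_ofReal (hA : Blocks A) (hc : Critical A w y u g) {x : ℝ}
    (hx : x ∈ Set.Icc (zMin A) (zMax A)) : R₁ A x = toC (Ar A 1 x) * toC (Nr A x) := by
  rw [R₁_eq hA hc (ofReal_mem_annulus hx), N₁_ofReal hA hc hx, Acol_ofReal]

theorem sub_mem_slitPlane {z : ℂ} (hz : z ∈ annulus A) (hne : z ≠ zMax A) :
    (zMax A : ℂ) - z ∈ Complex.slitPlane := by
  refine Complex.mem_slitPlane_iff.2 (Or.inl ?_)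
  rw [Complex.sub_re, Complex.ofReal_re]
  exact sub_pos.2 (Complex.re_lt_of_norm_le hz.2 hne)

theorem isPreconnected_annulus_near (hc : Critical A w y u g) {U : Set ℂ} (hU : U ∈ 𝓝 (zMax A : ℂ)) :
    ∃ V ∈ 𝓝 (zMax A : ℂ), V ⊆ U ∧ IsPreconnected ((annulus A ∩ V) \ {(zMax A : ℂ)}) := by
  obtain ⟨δ, hδ, hδU⟩ := Metric.mem_nhds_iff.1 hU
  set δ' := min δ (zMax A - zMin A) with hδ'
  have hδ'0 : 0 < δ' := lt_min hδ (sub_pos.2 hc.zMin_lt)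
  refine ⟨Metric.ball (zMax A : ℂ) δ', Metric.ball_mem_nhds _ hδ'0,
    (Metric.ball_subset_ball (min_le_left _ _)).trans hδU, ?_⟩
  have heq : (annulus A ∩ Metric.ball (zMax A : ℂ) δ') \ {(zMax A : ℂ)}
      = {z : ℂ | ‖z‖ ≤ zMax A ∧ z ≠ zMax A ∧ z ∈ Metric.ball (zMax A : ℂ) δ'} := by
    ext z
    constructor
    · rintro ⟨⟨h1, h2⟩, h3⟩; exact ⟨h1.2, h3, h2⟩
    · rintro ⟨h1, h2, h3⟩
      refine ⟨⟨⟨?_, h1⟩, h3⟩, h2⟩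
      have h4 : dist z (zMax A : ℂ) < zMax A - zMin A := lt_of_lt_of_le h3 (min_le_right _ _)
      rw [dist_comm, dist_eq_norm] at h4
      have h5 := norm_sub_norm_le (zMax A : ℂ) z
      rw [Complex.norm_real, Real.norm_of_nonneg (zMax_pos A).le] at h5
      linarith
  rw [heq]
  exact (convex_punctured_closedBall _ _).isPreconnected

/-- For real arguments the analytic branch of eigenvalues of `G₁` is the smaller solution of
`χ(x, ·) = 1`. -/
theorem eventually_eq_zetaLow [Nonempty S] (hA : Blocks A) (hc : Critical A w y u g) {ψ : S → ℝ}
    {x : Matrix S S ℂ → S → ℂ} {α : Matrix S S ℂ → ℂ}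
    (hx : ContinuousAt x (toC (Nr A (zMax A)) * toC (Ar A (-1) (zMax A))))
    (hα : ContinuousAt α (toC (Nr A (zMax A)) * toC (Ar A (-1) (zMax A))))
    (hx0 : x (toC (Nr A (zMax A)) * toC (Ar A (-1) (zMax A))) = vecC y)
    (hα0 : α (toC (Nr A (zMax A)) * toC (Ar A (-1) (zMax A))) = w)
    (heig : ∀ᶠ M in 𝓝 (toC (Nr A (zMax A)) * toC (Ar A (-1) (zMax A))),
      M *ᵥ x M = α M • x M ∧ vecC ψ ⬝ᵥ x M = vecC ψ ⬝ᵥ vecC y)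
    (huniq : ∀ᶠ q : Matrix S S ℂ × (S → ℂ) × ℂ in
      𝓝 (toC (Nr A (zMax A)) * toC (Ar A (-1) (zMax A)), vecC y, (w : ℂ)),
      q.1 *ᵥ q.2.1 = q.2.2 • q.2.1 →
        vecC ψ ⬝ᵥ q.2.1 = vecC ψ ⬝ᵥ vecC y → q.2.1 = x q.1 ∧ q.2.2 = α q.1) :
    ∀ᶠ t : ℝ in 𝓝[≤] (zMax A), α (G₁ A t) = zetaLow A t ∧
      ∀ (w' : ℝ) (y' : S → ℝ), 0 < w' → (∀ a, 0 < y' a) → (∀ a, (Cr A t w' *ᵥ y') a ≤ y' a) →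
        zetaLow A t ≤ w' := by
  set G := toC (Nr A (zMax A)) * toC (Ar A (-1) (zMax A)) with hG
  have hI : ∀ᶠ t : ℝ in 𝓝[≤] (zMax A), t ∈ Set.Icc (zMin A) (zMax A) := by
    filter_upwards [self_mem_nhdsWithin, nhdsWithin_le_nhds (lt_mem_nhds hc.zMin_lt)] with t h1 h2
    exact ⟨h2.le, h1⟩
  have hGt : Tendsto (fun t : ℝ => G₁ A t) (𝓝[≤] (zMax A)) (𝓝 G) := by
    have h1 := (continuousOn_G₁ hA hc) _ (ofReal_mem_annulus (zMax_mem_Icc hc))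
    rw [ContinuousWithinAt, G₁_ofReal hA hc (zMax_mem_Icc hc)] at h1
    refine h1.comp (tendsto_nhdsWithin_iff.2 ⟨?_, ?_⟩)
    · exact (Complex.continuous_ofReal.tendsto _).mono_left nhdsWithin_le_nhds
    · exact hI.mono fun t ht => ofReal_mem_annulus ht
  have hxt : Tendsto (fun t : ℝ => x (G₁ A t)) (𝓝[≤] (zMax A)) (𝓝 (vecC y)) := by
    rw [← hx0]; exact hx.tendsto.comp hGt
  have hαt : Tendsto (fun t : ℝ => α (G₁ A t)) (𝓝[≤] (zMax A)) (𝓝 (w : ℂ)) := by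
    rw [← hα0]; exact hα.tendsto.comp hGt
  have hxt' : Tendsto (fun t : ℝ => fun a => (starRingEnd ℂ) (x (G₁ A t) a)) (𝓝[≤] (zMax A))
      (𝓝 (vecC y)) := by
    refine tendsto_pi_nhds.2 fun a => ?_
    have h1 := (Complex.continuous_conj.tendsto _).comp ((tendsto_pi_nhds.1 hxt) a)
    rwa [Complex.conj_ofReal] at h1
  have hαt' : Tendsto (fun t : ℝ => (starRingEnd ℂ) (α (G₁ A t))) (𝓝[≤] (zMax A)) (𝓝 (w : ℂ)) := by
    have h1 := (Complex.continuous_conj.tendsto _).comp hαt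
    rwa [Complex.conj_ofReal] at h1
  have hxpos : ∀ᶠ t : ℝ in 𝓝[≤] (zMax A), ∀ a, 0 < (x (G₁ A t) a).re := by
    refine eventually_all.2 fun a => ?_
    have h1 := (Complex.continuous_re.tendsto _).comp ((tendsto_pi_nhds.1 hxt) a)
    exact h1.eventually_const_lt (by simpa using hc.y_pos a)
  have hαpos : ∀ᶠ t : ℝ in 𝓝[≤] (zMax A), 0 < (α (G₁ A t)).re :=
    ((Complex.continuous_re.tendsto _).comp hαt).eventually_const_lt (by simpa using hc.w_pos)
  filter_upwards [hI, hGt.eventually heig, (hGt.prodMk_nhds (hxt'.prodMk_nhds hαt')).eventually huniq,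
    hxpos, hαpos] with t ht h1 h2 h3 h4
  have ht0 : 0 < t := (zMin_pos A).trans_le ht.1
  set r := (α (G₁ A t)).re with hr
  set y₁ : S → ℝ := fun a => (x (G₁ A t) a).re with hy₁
  have hGr : G₁ A t = toC (Nr A t * Ar A (-1) t) := by rw [G₁_ofReal hA hc ht, toC_mul]
  -- G₁ is real at real `t`, so the conjugate of the eigenpair is again a normalized eigenpair near
  -- `(y, w)`; local uniqueness makes the pair real.
  have hconj := h2 (by
      ext a
      have h5 := congrArg (starRingEnd ℂ) (congrFun h1.1 a)
      simp only [Matrix.mulVec, dotProduct, map_sum, map_mul, Pi.smul_apply, smul_eq_mul, hGr,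
        Matrix.map_apply, Complex.conj_ofReal] at h5 ⊢
      exact h5) (by
      have h5 := congrArg (starRingEnd ℂ) h1.2
      simp only [dotProduct, map_sum, map_mul, Complex.conj_ofReal] at h5 ⊢
      exact h5)
  have hxr : x (G₁ A t) = vecC y₁ := by
    ext a
    exact (Complex.conj_eq_iff_re.1 (congrFun hconj.1 a)).symm
  have hαr : α (G₁ A t) = r := (Complex.conj_eq_iff_re.1 hconj.2).symm
  have heig₁ : (Nr A t * Ar A (-1) t) *ᵥ y₁ = r • y₁ := by
    have h5 := h1.1
    rw [hxr, hαr, hGr, toC_mulVec, ← vecC_smul] at h5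
    ext a
    have := congrFun h5 a
    exact_mod_cast this
  have hmin : ∀ (w' : ℝ) (y' : S → ℝ), 0 < w' → (∀ a, 0 < y' a) →
      (∀ a, (Cr A t w' *ᵥ y') a ≤ y' a) → r ≤ w' := by
    intro w' y' hw' hy' hsup
    have hle := Nr_mulVec_le hA hc ht hw' hy' hsup
    have hne : x (G₁ A t) ≠ 0 := fun h0 => by
      obtain ⟨a⟩ := ‹Nonempty S›
      have := h3 a
      rw [h0] at this
      simp at this
    have h6 := norm_eigenvalue_le (M := Nr A t * Ar A (-1) t) (Z := G₁ A t) (fun a b => by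
      rw [hGr]
      change ‖(((Nr A t * Ar A (-1) t) a b : ℝ) : ℂ)‖ ≤ _
      rw [Complex.norm_real, Real.norm_of_nonneg]
      exact Fold.mul_nonneg' (Nr_nonneg hA hc ht) (hA.Ar_nonneg ht0 (-1) (by simp [H])) a b)
      hy' hle hne h1.1
    rw [hαr, Complex.norm_real, Real.norm_of_nonneg h4.le] at h6
    exact h6
  have hchi : chi A t r = 1 := by
    refine (hA.chi_eq_one_iff ht0 h4).2 ⟨y₁, h3, ?_⟩
    have hq := quad_G₁ hA hc (ofReal_mem_annulus ht)
    rw [quad, sub_eq_zero] at hq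
    have hGy : G₁ A t *ᵥ vecC y₁ = (r : ℂ) • vecC y₁ := by
      rw [hGr, toC_mulVec, heig₁, vecC_smul]
    have h5 := congrArg (· *ᵥ vecC y₁) hq
    simp only [Matrix.add_mulVec, ← Matrix.mulVec_mulVec, hGy, Matrix.mulVec_smul, Acol_ofReal,
      toC_mulVec] at h5
    have h6 : Ar A (-1) t *ᵥ y₁ + r • (Ar A 0 t *ᵥ y₁) + r • r • (Ar A 1 t *ᵥ y₁) = r • y₁ := by
      ext a
      have := congrFun h5 a
      simp only [Pi.add_apply, Pi.smul_apply, smul_eq_mul] at this ⊢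
      exact_mod_cast this
    rw [Cr_eq, Matrix.add_mulVec, Matrix.add_mulVec, Matrix.smul_mulVec, Matrix.smul_mulVec]
    have h7 := congrArg (r⁻¹ • ·) h6
    simp only [smul_add, smul_smul, inv_mul_cancel₀ h4.ne', one_smul,
      inv_mul_cancel_left₀ h4.ne'] at h7
    exact h7
  -- The eigenvalue is itself a root of χ(t,·) = 1, and every root, having a harmonic vector, is at
  -- least as large by `hmin`.
  have hzeta : zetaLow A t = r := by
    refine IsLeast.csInf_eq ⟨⟨h4, hchi⟩, fun w' hw' => ?_⟩
    obtain ⟨y', hy', hCy⟩ := (hA.chi_eq_one_iff ht0 hw'.1).1 hw'.2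
    exact hmin w' y' hw'.1 hy' fun a => (congrFun hCy a).le
  rw [hzeta]
  exact ⟨hαr, hmin⟩

end BranchOfG

/-! ### The slit or sectorial neighbourhood of the branch point -/

section Sector

theorem lt_abs_arg_iff {θ : ℝ} (hθ : θ ∈ Set.Ico 0 (Real.pi / 2)) {ζ : ℂ} (hζ : ζ ≠ 0) :
    θ < |Complex.arg ζ| ↔ ζ.re < Real.cos θ * ‖ζ‖ := by
  have hn : 0 < ‖ζ‖ := norm_pos_iff.2 hζ
  have h1 : ζ.re = Real.cos |Complex.arg ζ| * ‖ζ‖ := by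
    rw [Real.cos_abs, Complex.cos_arg hζ, div_mul_cancel₀ _ hn.ne']
  rw [h1, mul_lt_mul_iff_left₀ hn]
  have hπ : θ ∈ Set.Icc 0 Real.pi := ⟨hθ.1, by linarith [hθ.2, Real.pi_pos]⟩
  exact (Real.strictAntiOn_cos.lt_iff_gt ⟨abs_nonneg _, Complex.abs_arg_le_pi ζ⟩ hπ).symm

/-- The part of the disc of radius `δ` about `r` outside of the sector of half-angle `θ`. -/
def sector (r δ θ : ℝ) : Set ℂ :=
  {z | (z - r).re < Real.cos θ * ‖z - r‖} ∩ Metric.ball (r : ℂ) δ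

theorem deltaTilde_inter_ball {r ε δ θ : ℝ} (hr : 0 ≤ r) (hθ : θ ∈ Set.Ico 0 (Real.pi / 2)) (hδ : δ ≤ ε) :
    deltaTilde r ε θ ∩ Metric.ball (r : ℂ) δ = sector r δ θ := by
  ext z
  constructor
  · rintro ⟨⟨-, h2, h3⟩, h4⟩
    exact ⟨(lt_abs_arg_iff hθ (sub_ne_zero.2 h2)).1 h3, h4⟩
  · rintro ⟨h1, h2⟩
    have hne : z ≠ r := by
      rintro rfl
      simp at h1
    refine ⟨⟨?_, hne, (lt_abs_arg_iff hθ (sub_ne_zero.2 hne)).2 h1⟩, h2⟩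
    have h3 : ‖z - r‖ < δ := by rwa [← dist_eq_norm]
    have h4 := norm_sub_norm_le z (r : ℂ)
    rw [Complex.norm_real, Real.norm_of_nonneg hr] at h4
    linarith

theorem sub_half_mem_sector {r δ θ : ℝ} (hδ : 0 < δ) (hθ : θ ∈ Set.Ico 0 (Real.pi / 2)) :
    (r : ℂ) - (δ / 2 : ℝ) ∈ sector r δ θ := by
  have hcos : 0 < Real.cos θ := Real.cos_pos_of_mem_Ioo ⟨by linarith [hθ.1, Real.pi_pos], hθ.2⟩
  refine ⟨?_, ?_⟩
  · simp only [Set.mem_ofPred_eq, sub_sub_cancel_left, norm_neg, Complex.norm_real, Complex.neg_re,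
      Complex.ofReal_re, Real.norm_of_nonneg (by positivity : 0 ≤ δ / 2)]
    have : 0 < Real.cos θ * (δ / 2) := by positivity
    linarith
  · rw [Metric.mem_ball, dist_eq_norm, sub_sub_cancel_left, norm_neg, Complex.norm_real,
      Real.norm_of_nonneg (by positivity)]
    linarith

/-- The set is star-shaped about `r - δ / 2`: a step to the left lowers the real part by its full
length and the norm by no more than that, so `cos θ ≤ 1` preserves the inequality. -/
theorem isPreconnected_sector {r δ θ : ℝ} (hδ : 0 < δ) (hθ : θ ∈ Set.Ico 0 (Real.pi / 2)) :
    IsPreconnected (sector r δ θ) := by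
  have hcos : 0 < Real.cos θ := Real.cos_pos_of_mem_Ioo ⟨by linarith [hθ.1, Real.pi_pos], hθ.2⟩
  have hmem := sub_half_mem_sector (r := r) hδ hθ
  have hstar : StarConvex ℝ ((r : ℂ) - (δ / 2 : ℝ)) (sector r δ θ) := by
    refine StarConvex.inter ?_ ((convex_ball (r : ℂ) δ).starConvex hmem.2)
    intro z hz a b ha hb hab
    simp only [Set.mem_ofPred_eq] at hz ⊢
    have e : a • ((r : ℂ) - (δ / 2 : ℝ)) + b • z - r = b • (z - r) - a • ((δ / 2 : ℝ) : ℂ) := by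
      have : (a : ℂ) = 1 - b := by rw [← Complex.ofReal_one, ← Complex.ofReal_sub, ← hab]; simp
      simp only [Complex.real_smul, this]
      ring
    rw [e]
    have e2 : (b • (z - r) - a • ((δ / 2 : ℝ) : ℂ)).re = b * (z - r).re - a * (δ / 2) := by
      rw [Complex.sub_re, Complex.smul_re, Complex.smul_re, Complex.ofReal_re, smul_eq_mul,
        smul_eq_mul]
    have e3 : b * ‖z - r‖ - a * (δ / 2) ≤ ‖b • (z - r) - a • ((δ / 2 : ℝ) : ℂ)‖ := by
      have := norm_sub_norm_le (b • (z - (r : ℂ))) (a • ((δ / 2 : ℝ) : ℂ))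
      rwa [norm_smul, norm_smul, Complex.norm_real, Real.norm_of_nonneg ha, Real.norm_of_nonneg hb,
        Real.norm_of_nonneg (by positivity : 0 ≤ δ / 2)] at this
    rw [e2]
    rcases hb.eq_or_lt with rfl | hb'
    · have ha1 : a = 1 := by simpa using hab
      subst ha1
      rw [zero_smul, zero_sub, one_smul, norm_neg, Complex.norm_real,
        Real.norm_of_nonneg (by positivity)]
      have : 0 < Real.cos θ * (δ / 2) := by positivity
      linarith
    · have h1 := mul_lt_mul_of_pos_left hz hb'
      have h2 := mul_le_mul_of_nonneg_left e3 hcos.le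
      have h3 : Real.cos θ * (a * (δ / 2)) ≤ 1 * (a * (δ / 2)) :=
        mul_le_mul_of_nonneg_right (Real.cos_le_one θ) (by positivity)
      linarith
  exact (hstar.isPathConnected hmem).isConnected.isPreconnected

theorem sub_mem_slitPlane_of_mem_sector {r δ θ : ℝ} {z : ℂ}
    (hz : z ∈ sector r δ θ) : (r : ℂ) - z ∈ Complex.slitPlane := by
  by_contra h
  rw [Complex.mem_slitPlane_iff, not_or, not_lt, not_not] at h
  have hre : 0 ≤ (z - r).re := by
    have := h.1
    simp only [Complex.sub_re, Complex.ofReal_re] at this ⊢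
    linarith
  have him : (z - r).im = 0 := by
    have := h.2
    simp only [Complex.sub_im, Complex.ofReal_im] at this ⊢
    linarith
  have hz' := hz.1
  simp only [Set.mem_ofPred_eq] at hz'
  have hnorm : ‖z - r‖ = (z - r).re := by
    have h1 : z - r = (((z - r).re : ℝ) : ℂ) := Complex.ext rfl (by rw [him, Complex.ofReal_im])
    conv_lhs => rw [h1]
    rw [Complex.norm_real, Real.norm_of_nonneg hre]
  rw [hnorm] at hz'
  nlinarith [Real.cos_le_one θ]

theorem tendsto_cpow_half : Tendsto (fun z : ℂ => z ^ (1 / 2 : ℂ)) (𝓝 0) (𝓝 0) := by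
  rw [tendsto_zero_iff_norm_tendsto_zero]
  have h : (fun z : ℂ => ‖z ^ (1 / 2 : ℂ)‖) = fun z => ‖z‖ ^ (1 / 2 : ℝ) := by
    funext z
    have := Complex.norm_cpow_real z (1 / 2)
    simpa using this
  rw [h]
  have := (continuous_norm (E := ℂ)).tendsto 0
  rw [norm_zero] at this
  have h2 := this.rpow_const (p := (1 / 2 : ℝ)) (Or.inr (by norm_num))
  rwa [Real.zero_rpow (by norm_num)] at h2

end Sector

/-! ### Analytic continuation of G₁ beyond the annulus -/

section Continuation

variable {S : Type*} [Fintype S] [DecidableEq S] {A : ℤ → ℤ → Matrix S S ℝ}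

theorem tendsto_root (A : ℤ → ℤ → Matrix S S ℝ) : Tendsto (root A) (𝓝 (zMax A : ℂ)) (𝓝 0) := by
  refine tendsto_cpow_half.comp ?_
  have : Tendsto (fun z : ℂ => (zMax A : ℂ) - z) (𝓝 (zMax A : ℂ)) (𝓝 ((zMax A : ℂ) - zMax A)) :=
    tendsto_const_nhds.sub tendsto_id
  rwa [sub_self] at this

theorem analyticAt_root {z : ℂ} (hz : (zMax A : ℂ) - z ∈ Complex.slitPlane) :
    AnalyticAt ℂ (root A) z :=
  (analyticAt_const.sub analyticAt_id).cpow analyticAt_const hz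

theorem root_ne_zero {z : ℂ} (hz : (zMax A : ℂ) - z ∈ Complex.slitPlane) : root A z ≠ 0 := by
  rw [root, Ne, Complex.cpow_eq_zero_iff]
  exact fun h => Complex.slitPlane_ne_zero hz h.1

/-- Near the branch point the Puiseux series is analytic on the slit disc and agrees with `G₁` on
the annulus. -/
theorem IsPuiseuxG₁.exists_radius {Gt : ℂ → Matrix S S ℂ} (h : IsPuiseuxG₁ A Gt) :
    ∃ δ > 0, (∀ z ∈ annulus A ∩ Metric.ball (zMax A : ℂ) δ, G₁ A z = Gt (root A z)) ∧
      ∀ δ' ≤ δ, ∀ θ ∈ Set.Ico 0 (Real.pi / 2), ∀ a b,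
        AnalyticOnNhd ℂ (fun z => Gt (root A z) a b) (sector (zMax A) δ' θ) := by
  have h1 : ∀ᶠ t in 𝓝 (0 : ℂ), ∀ a b, AnalyticAt ℂ (fun t => Gt t a b) t :=
    eventually_all.2 fun a => eventually_all.2 fun b => (h.analytic a b).eventually_analyticAt
  have h2 := (tendsto_root A).eventually h1
  have h3 := eventually_nhdsWithin_iff.1 h.eq
  obtain ⟨δ, hδ, hball⟩ := Metric.eventually_nhds_iff_ball.1 (h2.and h3)
  refine ⟨δ, hδ, fun z hz => (hball z hz.2).2 hz.1, fun δ' hδ' θ hθ a b z hz => ?_⟩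
  exact AnalyticAt.comp (f := root A) ((hball z (Metric.ball_subset_ball hδ' hz.2)).1 a b)
    (analyticAt_root (sub_mem_slitPlane_of_mem_sector hz))

theorem IsPuiseuxG₁.exists_continuation {Gt : ℂ → Matrix S S ℂ} (h : IsPuiseuxG₁ A Gt) :
    ∃ ε > 0, ∃ F, IsContinuationG₁ A ε 0 F := by
  obtain ⟨δ, hδ, h1, h2⟩ := h.exists_radius
  have h0 : (0 : ℝ) ∈ Set.Ico 0 (Real.pi / 2) := ⟨le_rfl, by positivity⟩
  refine ⟨δ, hδ, fun z => Gt (root A z), ⟨fun a b => ?_, fun z hz => (h1 z hz).symm⟩⟩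
  rw [deltaTilde_inter_ball (zMax_pos A).le h0 le_rfl]
  exact h2 δ le_rfl 0 h0 a b

/-- Identity theorem on the connected sector, starting from a point interior to the annulus, near
which both functions are G₁. -/
theorem IsPuiseuxG₁.continuation_eq {Gt : ℂ → Matrix S S ℂ} (h : IsPuiseuxG₁ A Gt)
    (hlt : zMin A < zMax A) {ε θ : ℝ} (hε : 0 < ε) (hθ : θ ∈ Set.Ico 0 (Real.pi / 2))
    {F : ℂ → Matrix S S ℂ} (hF : IsContinuationG₁ A ε θ F) :
    ∃ δ > 0, ∀ z ∈ deltaTilde (zMax A) ε θ ∩ Metric.ball (zMax A : ℂ) δ,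
      z ∈ sector (zMax A) δ θ ∧ F z = Gt (root A z) := by
  obtain ⟨δ₀, hδ₀, h1, h2⟩ := h.exists_radius
  have hz := zMax_pos A
  -- The last bound keeps `z̄ - δ / 2` strictly between the two radii of the annulus.
  set δ := min (min δ₀ ε) (zMax A - zMin A) with hδdef
  have hδ : 0 < δ := lt_min (lt_min hδ₀ hε) (sub_pos.2 hlt)
  have hδ0 : δ ≤ δ₀ := (min_le_left _ _).trans (min_le_left _ _)
  have hδε : δ ≤ ε := (min_le_left _ _).trans (min_le_right _ _)
  have hδm : δ ≤ zMax A - zMin A := min_le_right _ _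
  refine ⟨δ, hδ, fun z hzm => ?_⟩
  rw [deltaTilde_inter_ball hz.le hθ hδε] at hzm
  refine ⟨hzm, ?_⟩
  set p : ℂ := (zMax A : ℂ) - (δ / 2 : ℝ) with hp
  have hpsec : p ∈ sector (zMax A) δ θ := sub_half_mem_sector hδ hθ
  have hpn : ‖p‖ = zMax A - δ / 2 := by
    rw [hp, ← Complex.ofReal_sub, Complex.norm_real, Real.norm_of_nonneg]
    linarith [zMin_pos A]
  have hann : ∀ᶠ q in 𝓝 p, q ∈ annulus A ∩ Metric.ball (zMax A : ℂ) δ := by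
    have hc := (continuous_norm (E := ℂ)).tendsto p
    rw [hpn] at hc
    filter_upwards [Metric.isOpen_ball.mem_nhds hpsec.2,
      hc.eventually_const_lt (by linarith : zMin A < zMax A - δ / 2),
      hc.eventually_lt_const (by linarith : zMax A - δ / 2 < zMax A)] with q h3 h4 h5
    exact ⟨⟨h4.le, h5.le⟩, h3⟩
  ext a b
  refine AnalyticOnNhd.eqOn_of_preconnected_of_eventuallyEq (f := fun z => F z a b)
    (g := fun z => Gt (root A z) a b) ?_ (h2 δ hδ0 θ hθ a b) (isPreconnected_sector hδ hθ) hpsec ?_ hzm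
  · refine (hF.analytic a b).mono fun z hz' => ?_
    rw [deltaTilde_inter_ball hz.le hθ le_rfl]
    exact ⟨hz'.1, Metric.ball_subset_ball hδε hz'.2⟩
  · filter_upwards [hann] with q hq
    rw [hF.agree q ⟨hq.1, Metric.ball_subset_ball hδε hq.2⟩,
      h1 q ⟨hq.1, Metric.ball_subset_ball hδ0 hq.2⟩]

theorem eventually_mem_ball_inter {s : Set ℂ} {p : ℂ} {δ : ℝ} (hδ : 0 < δ) :
    ∀ᶠ z in 𝓝[s] p, z ∈ s ∩ Metric.ball p δ := by
  filter_upwards [self_mem_nhdsWithin, nhdsWithin_le_nhds (Metric.ball_mem_nhds p hδ)] with z h1 h2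
  exact ⟨h1, h2⟩

theorem IsPuiseuxG₁.tendsto_continuation {Gt : ℂ → Matrix S S ℂ} (h : IsPuiseuxG₁ A Gt)
    (hlt : zMin A < zMax A) (hG0 : G₁ A (zMax A) = Gt 0) {ε θ : ℝ} (hε : 0 < ε) (hθ : θ ∈ Set.Ico 0 (Real.pi / 2))
    {F : ℂ → Matrix S S ℂ} (hF : IsContinuationG₁ A ε θ F) :
    (∀ᶠ z in 𝓝[deltaTilde (zMax A) ε θ] (zMax A : ℂ), F z = Gt (root A z)) ∧
      Tendsto (fun z => (root A z)⁻¹ • (G₁ A (zMax A) - F z))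
        (𝓝[deltaTilde (zMax A) ε θ] (zMax A : ℂ)) (𝓝 (-coeffOne Gt)) := by
  obtain ⟨δ, hδ, hFeq⟩ := h.continuation_eq hlt hε hθ hF
  have hev := (eventually_mem_ball_inter (s := deltaTilde (zMax A) ε θ) (p := (zMax A : ℂ)) hδ).mono hFeq
  refine ⟨hev.mono fun z hz => hz.2, ?_⟩
  refine tendsto_pi_nhds.2 fun a => tendsto_pi_nhds.2 fun b => ?_
  have hd : HasDerivAt (fun t => Gt t a b) (coeffOne Gt a b) 0 :=
    (h.analytic a b).differentiableAt.hasDerivAt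
  have hr : Tendsto (root A) (𝓝[deltaTilde (zMax A) ε θ] (zMax A : ℂ)) (𝓝[≠] 0) := by
    refine tendsto_nhdsWithin_iff.2 ⟨(tendsto_root A).mono_left nhdsWithin_le_nhds, ?_⟩
    exact hev.mono fun z hz => root_ne_zero (sub_mem_slitPlane_of_mem_sector hz.1)
  have h1 := (hd.tendsto_slope.comp hr).neg
  refine h1.congr' (hev.mono fun z hz => ?_)
  simp only [Function.comp_apply, slope, vsub_eq_sub, sub_zero, smul_eq_mul]
  rw [hG0, hz.2]
  simp only [Matrix.smul_apply, Matrix.sub_apply, smul_eq_mul]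
  ring

end Continuation

/-! ### Sign of a derivative from a one-sided bound -/

section Sign

theorem ofReal_sq_cpow_half {t : ℝ} (ht : 0 ≤ t) : (((t ^ 2 : ℝ)) : ℂ) ^ (1 / 2 : ℂ) = t := by
  have h : ((1 / 2 : ℝ) : ℂ) = (1 / 2 : ℂ) := by norm_num
  rw [← h, ← Complex.ofReal_cpow (sq_nonneg t), ← Real.sqrt_eq_rpow, Real.sqrt_sq ht]

/-- A function that is real and at most `w + L t ^ 2` for small `t > 0` has a nonpositive derivative
at the origin. -/
theorem deriv_nonpos_of_le {f : ℂ → ℂ} {f' : ℂ} {w L : ℝ} (hf : HasDerivAt f f' 0) (hf0 : f 0 = w)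
    (hle : ∀ᶠ t : ℝ in 𝓝[>] 0, (f t).im = 0 ∧ (f t).re ≤ w + L * t ^ 2) : f'.im = 0 ∧ f'.re ≤ 0 := by
  have ht : Tendsto (fun t : ℝ => (t : ℂ)) (𝓝[>] 0) (𝓝[≠] 0) := by
    refine tendsto_nhdsWithin_iff.2 ⟨?_, ?_⟩
    · exact (Complex.continuous_ofReal.tendsto' _ _ Complex.ofReal_zero).mono_left nhdsWithin_le_nhds
    · filter_upwards [self_mem_nhdsWithin] with t ht
      exact Complex.ofReal_ne_zero.2 (ne_of_gt ht)
  have hs := hf.tendsto_slope.comp ht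
  have hslope : ∀ t : ℝ, slope f 0 (t : ℂ) = ((t⁻¹ : ℝ) : ℂ) * (f t - w) := fun t => by
    rw [slope_def_field, hf0, sub_zero, Complex.ofReal_inv, div_eq_inv_mul]
  constructor
  · refine tendsto_nhds_unique ((Complex.continuous_im.tendsto _).comp hs)
      (tendsto_const_nhds.congr' ?_)
    filter_upwards [hle] with t h1
    simp only [Function.comp_apply, hslope, Complex.im_ofReal_mul, Complex.sub_im, h1.1,
      Complex.ofReal_im, sub_zero, mul_zero]
  · have hL : Tendsto (fun t : ℝ => L * t) (𝓝[>] 0) (𝓝 0) :=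
      ((continuous_const.mul continuous_id).tendsto' _ _ (mul_zero L)).mono_left nhdsWithin_le_nhds
    refine le_of_tendsto_of_tendsto ((Complex.continuous_re.tendsto _).comp hs) hL ?_
    filter_upwards [hle, self_mem_nhdsWithin] with t h1 h2
    have h2' : 0 < t := h2
    simp only [Function.comp_apply, hslope, Complex.re_ofReal_mul, Complex.sub_re,
      Complex.ofReal_re]
    rw [inv_mul_le_iff₀ h2']
    nlinarith [h1.2]

end Sign

/-! ### Puiseux expansions of G₁ and of its eigenvalue -/

section Branch

variable {S : Type*} [Fintype S] [DecidableEq S] {A : ℤ → ℤ → Matrix S S ℝ} {w : ℝ} {y u g : S → ℝ}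

attribute [local instance] Matrix.linftyOpNormedRing Matrix.linftyOpNormedAlgebra

/-- The Puiseux expansions of `G₁` and of its eigenvalue at the branch point. -/
theorem Critical.exists_puiseux [Nonempty S] (hc : Critical A w y u g) (hA : Blocks A) {ψ : S → ℝ}
    (hψ0 : ψ ≠ 0) (hψ : ψ ᵥ* (Nr A (zMax A) * Ar A (-1) (zMax A)) = w • ψ) :
    ∃ (Gt : ℂ → Matrix S S ℂ) (αt : ℂ → ℂ), IsPuiseuxG₁ A Gt ∧ IsPuiseuxEigenvalue A αt ∧
      G₁ A (zMax A) = Gt 0 ∧ deriv αt 0 ≠ 0 ∧ (deriv αt 0).im = 0 ∧ (deriv αt 0).re ≤ 0 ∧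
      ∀ v : S → ℂ, v ≠ 0 →
        (toC (Ar A 1 (zMax A)) * toC (Nr A (zMax A))) *ᵥ v = (w : ℂ)⁻¹ • v →
        coeffOne Gt = deriv αt 0 • ((vecC ψ ⬝ᵥ (toC (Nr A (zMax A)) *ᵥ v))⁻¹ •
          Matrix.vecMulVec (toC (Nr A (zMax A)) *ᵥ v) (vecC ψ)) := by
  have hI := zMax_mem_Icc hc
  have hann := ofReal_mem_annulus hI
  have hfam := hc.foldFamily hA
  have hfold := hfam.fold
  have hψ' : vecC ψ ᵥ* (toC (Nr A (zMax A)) * toC (Ar A (-1) (zMax A))) = (w : ℂ) • vecC ψ := by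
    rw [← toC_mul, vecMul_toC, hψ, vecC_smul]
  have hψ0' := vecC_ne_zero hψ0
  have hψy := hfold.left_G_dotProduct_ne_zero hψ0' hψ'
  have hG0 := G₁_ofReal hA hc hI
  obtain ⟨x, α, hx, hα, hx0, hα0, heig, huniq⟩ := exists_eigenpair hfold.G_mulVec_complex
    (fun _ => hfold.G_right_unique) hψ' hψy
  obtain ⟨Gt, αt, αt', hGt, hαt, hαt0, hαt', hne, hcoeff, hpuis⟩ := hfam.exists_puiseux
    (continuousOn_G₁ hA hc) hann hG0 (fun z hz => quad_G₁ hA hc hz)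
    (fun z hz => sub_mem_slitPlane hz) (fun U hU => isPreconnected_annulus_near hc hU)
    hψ0' hψ' hx hα hx0 hα0 heig
  have hreal := eventually_eq_zetaLow hA hc hx.continuousAt hα.continuousAt hx0 hα0 heig huniq
  have hcoeffOne : ∀ v : S → ℂ, v ≠ 0 →
      (toC (Ar A 1 (zMax A)) * toC (Nr A (zMax A))) *ᵥ v = (w : ℂ)⁻¹ • v →
      coeffOne Gt = αt' • ((vecC ψ ⬝ᵥ (toC (Nr A (zMax A)) *ᵥ v))⁻¹ •
        Matrix.vecMulVec (toC (Nr A (zMax A)) *ᵥ v) (vecC ψ)) := fun v h1 h2 => by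
    ext a b
    exact (hasDerivAt_entry (hcoeff v h1 h2) a b).deriv
  have hP : IsPuiseuxG₁ A Gt := ⟨fun a b => analyticAt_entry hGt a b, hpuis.mono fun z hz => hz.1⟩
  have hGt0 : G₁ A (zMax A) = Gt 0 := by
    have h1 := (hpuis.self_of_nhdsWithin hann).1
    rwa [sub_self, Complex.zero_cpow (by norm_num)] at h1
  have hann' : Tendsto (fun t : ℝ => (t : ℂ)) (𝓝[≤] (zMax A)) (𝓝[annulus A] (zMax A : ℂ)) := by
    refine tendsto_nhdsWithin_iff.2
      ⟨(Complex.continuous_ofReal.tendsto _).mono_left nhdsWithin_le_nhds, ?_⟩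
    filter_upwards [self_mem_nhdsWithin, nhdsWithin_le_nhds (lt_mem_nhds hc.zMin_lt)] with t h1 h2
    exact ofReal_mem_annulus ⟨h2.le, h1⟩
  have hαreal : ∀ᶠ t : ℝ in 𝓝[≤] (zMax A), αt (root A t) = (zetaLow A t : ℂ) := by
    filter_upwards [hreal, hann'.eventually hpuis] with t h1 h2
    rw [← h1.1]
    exact h2.2
  have hE : IsPuiseuxEigenvalue A αt := by
    refine ⟨hαt, ?_, hαreal⟩
    have h1 : Tendsto (G₁ A) (𝓝[annulus A] (zMax A : ℂ))
        (𝓝 (toC (Nr A (zMax A)) * toC (Ar A (-1) (zMax A)))) :=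
      hG0 ▸ continuousOn_G₁ hA hc _ hann
    have hxne : ∀ᶠ M in 𝓝 (toC (Nr A (zMax A)) * toC (Ar A (-1) (zMax A))), x M ≠ 0 := by
      refine hx.continuousAt.eventually_ne ?_
      rw [hx0]
      exact vecC_ne_zero fun h0 => by
        obtain ⟨a⟩ := ‹Nonempty S›
        exact (hc.y_pos a).ne' (congrFun h0 a)
    filter_upwards [hpuis, h1.eventually heig, h1.eventually hxne] with z h2 h3 h4
    rw [show αt (root A z) = α (G₁ A z) from h2.2]
    exact mem_spectrum_iff_exists_mulVec.2 ⟨_, h4, h3.1⟩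
  have hsign : αt'.im = 0 ∧ αt'.re ≤ 0 := by
    obtain ⟨L, hL⟩ := hc.superharmonic_near
    refine deriv_nonpos_of_le (L := L) hαt' hαt0 ?_
    -- At `z = z̄ - t ^ 2` the principal root is `t`, so a bound linear in `z̄ - z` becomes one
    -- quadratic in `t`.
    have ht : Tendsto (fun t : ℝ => zMax A - t ^ 2) (𝓝[>] 0) (𝓝[≤] (zMax A)) := by
      refine tendsto_nhdsWithin_iff.2 ⟨?_, Eventually.of_forall fun t => ?_⟩
      · exact ((continuous_const.sub (continuous_pow 2)).tendsto' _ _ (by simp)).mono_left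
          nhdsWithin_le_nhds
      · exact sub_le_self _ (sq_nonneg t)
    filter_upwards [ht.eventually hreal, ht.eventually hαreal, ht.eventually hL, self_mem_nhdsWithin]
      with t h1 h2 h3 h4
    have h5 : root A ((zMax A - t ^ 2 : ℝ) : ℂ) = t := by
      rw [root, ← Complex.ofReal_sub, sub_sub_cancel, ofReal_sq_cpow_half (le_of_lt h4)]
    rw [h5] at h2
    rw [h2, Complex.ofReal_im, Complex.ofReal_re]
    obtain ⟨w', y', hw', hy', hsup, hle⟩ := h3
    refine ⟨rfl, (h1.2 w' y' hw' hy' hsup).trans (hle.trans (le_of_eq ?_))⟩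
    rw [sub_sub_cancel]
  have hd : deriv αt 0 = αt' := hαt'.deriv
  exact ⟨Gt, αt, hP, hE, hGt0, hd ▸ hne, hd ▸ hsign.1, hd ▸ hsign.2, hd ▸ hcoeffOne⟩

end Branch

end TwoDQBD

/-! ### Assembly of the proposition -/

theorem proposition5p6 {S : Type*} [Fintype S] [DecidableEq S] [Nonempty S]
    (A : ℤ → ℤ → Matrix S S ℝ)
    (hnonneg : ∀ i ∈ H, ∀ j ∈ H, ∀ a b, 0 ≤ A i j a b)
    (hstoch : ∀ a, ∑ b, Atot A a b = 1)
    (hirr : ChainIrreducible (pTilde A))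
    (haper : ChainAperiodic (pTilde A))
    (p : S → ℝ) (hp : IsStationaryDist (Atot A) p)
    (hdrift : drift₁ A p < 0 ∨ drift₂ A p < 0) :
    (∀ z ∈ annulus A, Summable (fun n => Qterm A n z) ∧ Summable (fun n => Dterm A n z) ∧
      Summable (fun n => Uterm A n z)) ∧
    ∃ (Gt : ℂ → Matrix S S ℂ) (αt : ℂ → ℂ),
      IsPuiseuxG₁ A Gt ∧ IsPuiseuxEigenvalue A αt ∧
      (∃ ε > 0, ∃ F, IsContinuationG₁ A ε 0 F) ∧
      (∀ ε > 0, ∀ θ ∈ Set.Ico 0 (Real.pi / 2), ∀ F, IsContinuationG₁ A ε θ F →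
        (∀ᶠ z in 𝓝[deltaTilde (zMax A) ε θ] (zMax A : ℂ), F z = Gt (root A z)) ∧
        Tendsto (fun z => (root A z)⁻¹ • (G₁ A (zMax A) - F z))
          (𝓝[deltaTilde (zMax A) ε θ] (zMax A : ℂ)) (𝓝 (-coeffOne Gt))) ∧
      (∃ u, IsLeftEigenvector (G₁ A (zMax A)) (zetaLow A (zMax A)) u) ∧
      (∀ u, IsLeftEigenvector (G₁ A (zMax A)) (zetaLow A (zMax A)) u →
        (∃ v, IsRightEigenvector (R₁ A (zMax A)) ((zetaHigh A (zMax A) : ℂ)⁻¹) v ∧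
          u ⬝ᵥ (N₁ A (zMax A) *ᵥ v) = 1) ∧
        ∀ v, IsRightEigenvector (R₁ A (zMax A)) ((zetaHigh A (zMax A) : ℂ)⁻¹) v →
          u ⬝ᵥ (N₁ A (zMax A) *ᵥ v) = 1 →
          coeffOne Gt = deriv αt 0 • Matrix.vecMulVec (N₁ A (zMax A) *ᵥ v) u) ∧
      EntrywiseNonneg (-coeffOne Gt) ∧ -coeffOne Gt ≠ 0 := by
  have hA := blocks_of_irreducible hnonneg hirr
  obtain ⟨w, y, u₀, g, hc⟩ := hA.exists_critical hstoch hp hdrift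
  refine ⟨fun z hz => ⟨summable_Qterm hA hc hz, summable_Dterm hA hc hz, summable_Uterm hA hc hz⟩, ?_⟩
  have hI := zMax_mem_Icc hc
  have hfold := hc.fold hA
  obtain ⟨ψ, hψnn, hψ0, hψ⟩ := hfold.exists_left_G
  obtain ⟨v₀, hvnn, hv0, hv⟩ := hfold.exists_right_R
  have hψ' : vecC ψ ᵥ* (toC (Nr A (zMax A)) * toC (Ar A (-1) (zMax A))) = (w : ℂ) • vecC ψ := by
    rw [← toC_mul, vecMul_toC, hψ, vecC_smul]
  have hv' : (toC (Ar A 1 (zMax A)) * toC (Nr A (zMax A))) *ᵥ vecC v₀ = (w : ℂ)⁻¹ • vecC v₀ := by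
    rw [← toC_mul, toC_mulVec, hv, vecC_smul, Complex.ofReal_inv]
  have hψ0' := vecC_ne_zero hψ0
  have hv0' := vecC_ne_zero hv0
  have hψv := hfold.left_N_right_ne_zero hψ0' hψ' hv0' hv'
  have hG0 := G₁_ofReal hA hc hI
  obtain ⟨Gt, αt, hP, hE, hGt0, hne, him, hre, hcoeffOne⟩ := hc.exists_puiseux hA hψ0 hψ
  have hN := N₁_ofReal hA hc hI
  have hR := R₁_ofReal hA hc hI
  have hNv : ∀ a, 0 ≤ (Nr A (zMax A) *ᵥ v₀) a := fun a =>
    Finset.sum_nonneg fun b _ => mul_nonneg (hfold.N_nonneg a b) (hvnn b)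
  have hψNv : 0 ≤ ψ ⬝ᵥ (Nr A (zMax A) *ᵥ v₀) :=
    Finset.sum_nonneg fun a _ => mul_nonneg (hψnn a) (hNv a)
  have hc₀ := hcoeffOne _ hv0' hv'
  rw [hc.zetaLow_eq, hc.zetaHigh_eq, hG0, hR, hN]
  refine ⟨Gt, αt, hP, hE, hP.exists_continuation, fun ε hε θ hθ F hF => ?_, ⟨vecC ψ, hψ0', hψ'⟩,
    fun u hu => ⟨?_, fun v hv₁ huv => ?_⟩, ?_, ?_⟩
  · rw [← hG0]
    exact hP.tendsto_continuation hc.zMin_lt hGt0 hε hθ hF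
  · have h1 := hfold.left_N_right_ne_zero hu.1 hu.2 hv0' hv'
    refine ⟨(u ⬝ᵥ (toC (Nr A (zMax A)) *ᵥ vecC v₀))⁻¹ • vecC v₀,
      ⟨smul_ne_zero (inv_ne_zero h1) hv0', ?_⟩, ?_⟩
    · rw [Matrix.mulVec_smul, hv', smul_comm]
    · rw [Matrix.mulVec_smul, dotProduct_smul, smul_eq_mul, inv_mul_cancel₀ h1]
  -- Every left eigenvector is `κ • ψ`, and the normalization forces `κ` to be the inverse of `ψ N
  -- v`: the rank-one matrix does not depend on the choice.
  · obtain ⟨κ, rfl⟩ := hfold.G_left_unique hψ0' hψ' hu.2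
    rw [smul_dotProduct, smul_eq_mul] at huv
    rw [hcoeffOne v hv₁.1 hv₁.2, ← eq_inv_of_mul_eq_one_left huv, Matrix.vecMulVec_smul]
  · intro a b
    have h1 : (-coeffOne Gt) a b = (((-(deriv αt 0).re) * ((ψ ⬝ᵥ (Nr A (zMax A) *ᵥ v₀))⁻¹ *
        ((Nr A (zMax A) *ᵥ v₀) a * ψ b)) : ℝ) : ℂ) := by
      rw [hc₀, toC_mulVec, vecC_dotProduct]
      have h2 : deriv αt 0 = ((deriv αt 0).re : ℂ) := Complex.ext rfl (by rw [him, Complex.ofReal_im])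
      simp only [Matrix.neg_apply, Matrix.smul_apply, Matrix.vecMulVec_apply, smul_eq_mul]
      rw [h2]
      push_cast
      simp
    rw [h1, Complex.ofReal_re, Complex.ofReal_im]
    exact ⟨mul_nonneg (neg_nonneg.2 hre) (mul_nonneg (inv_nonneg.2 hψNv)
      (mul_nonneg (hNv a) (hψnn b))), rfl⟩
  -- If the rank-one matrix were zero, then `N v₀ = 0`, since `ψ` has a nonzero entry; this
  -- contradicts the nonvanishing of `ψ N v₀`.
  · rw [hc₀, Ne, neg_eq_zero, smul_eq_zero, smul_eq_zero, not_or, not_or]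
    refine ⟨hne, inv_ne_zero hψv, fun h0 => hψv ?_⟩
    obtain ⟨b, hb⟩ := Function.ne_iff.1 hψ0'
    refine Finset.sum_eq_zero fun a _ => ?_
    have h1 := congrFun (congrFun h0 a) b
    rw [Matrix.vecMulVec_apply] at h1
    rw [(mul_eq_zero.1 h1).resolve_right hb, mul_zero]
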